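/- Let $H$ be a finite-dimensional $\mathbb Q$-vector space, $n\ge 2$, and $Q$ a non-degenerate bilinear form on $H$ with $Q(u,v)=(-1)^nQ(v,u)$. Let $D$ be the period domain of all Hodge structures of weight $n$ on $H$ that are polarized by $Q$ and have given Hodge numbers $h^{p,q}$, $p+q=n$, $p,q\ge 0$. Assume that all these $h^{p,q}$ are non-zero. Points of $D$ are Hodge filtrations $F^n\subset\dots\subset F^0=H_{\mathbb C}$, and $D$ is a complex manifold, the holomorphic maps to $D$ being those along which every $F^p$ is a holomorphic bundle. For $k\ge 1$ let $I(k)\subset T^*D$ be the Pfaffian system given by the relations $dF^p\subseteq F^{p-k}$ for all $p$, that is, the annihilator of the tangent vectors $v$ such that $ds(v)\in F^{p-k}$ for every $p$ and every local holomorphic section $s$ of $F^p$; and let $I=I(1)$ be the infinitesimal period relation. The derived flag of $I$ is defined by $I_{[0]}=I$ and $$I_{[m+1]}=\ker\bigl(\delta:I_{[m]}\to \Lambda^2T^*D/(I_{[m]}\wedge T^*D)\bigr),$$ where $\delta$ is induced by the exterior derivative. Then: (i) All the $I_{[m]}$ are holomorphic sub-bundles of $T^*D$, and $$I_{[m]}=0\quad\text{for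 all integers } m\ge \frac{\log n}{\log 2}.$$ (ii) $I$ is bracket generating: with $W^{[0]}=I^{\perp}\subset TD$ and $W^{[m+1]}=W^{[m]}+[W^{[m]},W^{[m]}]$, the union of the $W^{[m]}$ is $TD$. (iii) If $n$ is odd or $n\le 4$, then $I_{[m]}\subseteq I(2^m)$ for all $m\ge 0$. (iv) If all $h^{p,q}\ge 2$, then $I_{[m]}=I(2^m)$ for all $m\ge 0$. -/

import Mathlib

open scoped TensorProduct

namespace PeriodDomain

noncomputable section

/-! ### Polarized Hodge structures and period domains -/

section Hodge

variable {H : Type*} [AddCommGroup H] [Module ℚ H]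

/-- Complex conjugation on `H_ℂ = ℂ ⊗ H`, as a conjugate-linear map. -/
def conj : (ℂ ⊗[ℚ] H) →ₛₗ[starRingEnd ℂ] (ℂ ⊗[ℚ] H) where
  toFun := TensorProduct.map
    ((starRingEnd ℂ).toAddMonoidHom.toRatLinearMap : ℂ →ₗ[ℚ] ℂ) (LinearMap.id : H →ₗ[ℚ] H)
  map_add' := map_add _
  map_smul' := by
    intro c x
    induction x using TensorProduct.induction_on with
    | zero => simp
    | tmul a h => simp [TensorProduct.smul_tmul']
    | add x y hx hy => rw [smul_add, map_add, hx, hy, map_add, smul_add]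

/-- `H^{p,q} = F^p ∩ conj F^q`. -/
def hodgePiece (F : ℤ → Submodule ℂ (ℂ ⊗[ℚ] H)) (p q : ℤ) : Submodule ℂ (ℂ ⊗[ℚ] H) :=
  F p ⊓ (F q).map conj

/-- `F` is the Hodge filtration of a Hodge structure of weight `n` on `H`; it is extended to all
integers by `F^p = H_ℂ` for `p ≤ 0` and `F^p = 0` for `p > n`. -/
structure IsHodgeFiltration (n : ℕ) (F : ℤ → Submodule ℂ (ℂ ⊗[ℚ] H)) : Prop where
  antitone : Antitone F
  eq_top : ∀ p : ℤ, p ≤ 0 → F p = ⊤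
  eq_bot : ∀ p : ℤ, (n : ℤ) < p → F p = ⊥
  isCompl : ∀ p : ℤ, IsCompl (F p) ((F (n - p + 1)).map conj)

/-- The Hodge structure `F` of weight `n` is polarized by `Q`: the two Hodge–Riemann bilinear
relations `Q(F^p, F^{n-p+1}) = 0` and `Q(C u, conj u) > 0` for `u ≠ 0`. Here `u` is written as
`∑ u_p` with `u_p ∈ H^{p,n-p}`, and the Weil operator is `C u = ∑ i^{p-q} u_p`, `q = n - p`. -/
structure IsPolarizedBy (n : ℕ) (Q : LinearMap.BilinForm ℚ H)
    (F : ℤ → Submodule ℂ (ℂ ⊗[ℚ] H)) : Prop where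
  isotropic : ∀ p : ℤ, ∀ u ∈ F p, ∀ v ∈ F (n - p + 1),
    LinearMap.BilinForm.baseChange ℂ Q u v = 0
  positive : ∀ u : ℤ → ℂ ⊗[ℚ] H, (∀ p, u p ∈ hodgePiece F p (n - p)) →
    ∑ p ∈ Finset.Icc (0 : ℤ) n, u p ≠ 0 →
    ∃ r : ℝ, 0 < r ∧ LinearMap.BilinForm.baseChange ℂ Q
      (∑ p ∈ Finset.Icc (0 : ℤ) n, Complex.I ^ (p - (n - p)) • u p)
      (conj (∑ p ∈ Finset.Icc (0 : ℤ) n, u p)) = (r : ℂ)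

/-- The period domain: all Hodge structures of weight `n` on `H` that are polarized by `Q` and have
the Hodge numbers `h p q = dim H^{p,q}`, `p + q = n`. -/
def periodDomain (Q : LinearMap.BilinForm ℚ H) (n : ℕ) (h : ℕ → ℕ → ℕ) :
    Set (ℤ → Submodule ℂ (ℂ ⊗[ℚ] H)) :=
  {F | IsHodgeFiltration n F ∧ IsPolarizedBy n Q F ∧
    ∀ p q : ℕ, p + q = n → Module.finrank ℂ (hodgePiece F p q) = h p q}

end Hodge

/-! ### Holomorphic families of subspaces -/

section Holomorphic

variable {E : Type*} [NormedAddCommGroup E] [NormedSpace ℂ E]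
variable {V : Type*} [AddCommGroup V] [Module ℂ V]

/-- `s` is holomorphic near `x`, as a function with values in the finite-dimensional space `V`:
all its coordinates are. -/
def HolomorphicNear (s : E → V) (x : E) : Prop :=
  ∀ l : Module.Dual ℂ V, AnalyticAt ℂ (fun y => l (s y)) x

/-- The differential `v ↦ ds(v)` at `x` of a function with values in the finite-dimensional
space `V`, computed in a basis of `V`. -/
def differential [Module.Finite ℂ V] (s : E → V) (x : E) : E →ₗ[ℂ] V :=
  ∑ i, (fderiv ℂ (fun y => (Module.finBasis ℂ V).coord i (s y)) x).toLinearMap.smulRight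
    (Module.finBasis ℂ V i)

/-- Near `x` the subspaces `F y` of `V` form a holomorphic sub-bundle of the trivial bundle with
fibre `V`: they have a holomorphic frame. -/
def IsHolomorphicSubbundleAt (F : E → Submodule ℂ V) (x : E) : Prop :=
  ∃ (r : ℕ) (s : Fin r → E → V), (∀ i, HolomorphicNear (s i) x) ∧
    ∀ᶠ y in nhds x, LinearIndependent ℂ (fun i => s i y) ∧
      F y = Submodule.span ℂ (Set.range fun i => s i y)

/-- `F` is a holomorphic map from the open set `U` to a set `D` of filtrations of `V`: every `F^p`
is a holomorphic bundle. -/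
def IsHolomorphicMap (D : Set (ℤ → Submodule ℂ V)) (U : Set E)
    (F : E → ℤ → Submodule ℂ V) : Prop :=
  ∀ x ∈ U, F x ∈ D ∧ ∀ p, IsHolomorphicSubbundleAt (fun y => F y p) x

/-- A holomorphic chart (inverse of a holomorphic coordinate system) of dimension `d` on a set `D`
of filtrations of `V`: an injective holomorphic map from an open set of `ℂ^d` to `D` through which
holomorphic maps to `D` factor holomorphically, and whose image is open in `D` in the sense that
its preimages under holomorphic maps are open. Any two charts are holomorphically compatible. -/
structure HolomorphicChart (D : Set (ℤ → Submodule ℂ V)) (d : ℕ) where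
  source : Set (Fin d → ℂ)
  toFun : (Fin d → ℂ) → ℤ → Submodule ℂ V
  isOpen_source : IsOpen source
  holomorphic : IsHolomorphicMap D source toFun
  injOn : Set.InjOn toFun source
  lift : ∀ (k : ℕ) (U : Set (Fin k → ℂ)) (f : (Fin k → ℂ) → ℤ → Submodule ℂ V), IsOpen U →
    IsHolomorphicMap D U f →
    IsOpen {y ∈ U | f y ∈ toFun '' source} ∧
    ∃ g : (Fin k → ℂ) → (Fin d → ℂ), AnalyticOnNhd ℂ g {y ∈ U | f y ∈ toFun '' source} ∧
      ∀ y ∈ U, f y ∈ toFun '' source → g y ∈ source ∧ toFun (g y) = f y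

end Holomorphic

/-! ### Pfaffian systems, the derived flag, brackets -/

section Pfaffian

variable {E : Type*} [NormedAddCommGroup E] [NormedSpace ℂ E]

/-- Linear functionals are the alternating `1`-forms. -/
def oneForm : (E →L[ℂ] ℂ) ≃ₗᵢ[ℂ] (E [⋀^Fin 1]→L[ℂ] ℂ) :=
  ContinuousAlternatingMap.ofSubsingletonLIE (0 : Fin 1)

/-- The exterior derivative of a `1`-form. -/
def extD (ω : E → E →L[ℂ] ℂ) (x : E) : E [⋀^Fin 2]→L[ℂ] ℂ :=
  extDeriv (fun y => oneForm (ω y)) x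

theorem extD_zero (x : E) : extD (fun _ => (0 : E →L[ℂ] ℂ)) x = 0 := by
  unfold extD extDeriv
  simp only [map_zero, fderiv_fun_const, Pi.zero_apply]
  ext v
  simp [ContinuousAlternatingMap.alternatizeUncurryFin_apply]

theorem extD_add {ω ω' : E → E →L[ℂ] ℂ} {x : E} (hω : DifferentiableAt ℂ ω x)
    (hω' : DifferentiableAt ℂ ω' x) : extD (ω + ω') x = extD ω x + extD ω' x := by
  unfold extD
  rw [← extDeriv_add]
  · congr 1
  · exact oneForm.toContinuousLinearEquiv.differentiableAt.comp x hω
  · exact oneForm.toContinuousLinearEquiv.differentiableAt.comp x hω'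

theorem extD_smul (c : ℂ) (ω : E → E →L[ℂ] ℂ) (x : E) : extD (c • ω) x = c • extD ω x := by
  unfold extD
  rw [← extDeriv_smul]
  congr 1

/-- `I ∧ T^*` inside `Λ² T^*`: the span of the products `α ∧ β` with `α ∈ I`. -/
def wedgeIdeal (I : Submodule ℂ (E →L[ℂ] ℂ)) : Submodule ℂ (E [⋀^Fin 2]→L[ℂ] ℂ) :=
  Submodule.span ℂ {η | ∃ α ∈ I, ∃ β : E →L[ℂ] ℂ,
    ∀ u v : E, η ![u, v] = α u * β v - α v * β u}

/-- The derived system `I_{[1]}`, the kernel of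
`δ : I → Λ² T^* / I ∧ T^*`, `δ α = dω(x)` for a local holomorphic section `ω` of `I` with
`ω(x) = α`. -/
def derivedSystem (I : E → Submodule ℂ (E →L[ℂ] ℂ)) (x : E) : Submodule ℂ (E →L[ℂ] ℂ) where
  carrier := {α | ∃ ω : E → E →L[ℂ] ℂ, AnalyticAt ℂ ω x ∧ (∀ᶠ y in nhds x, ω y ∈ I y) ∧
    ω x = α ∧ extD ω x ∈ wedgeIdeal (I x)}
  zero_mem' := ⟨fun _ => 0, analyticAt_const, by simp, rfl, by simp [extD_zero]⟩
  add_mem' := by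
    rintro α β ⟨ω, h1, h2, h3, h4⟩ ⟨η, k1, k2, k3, k4⟩
    refine ⟨ω + η, h1.add k1, ?_, by simp [h3, k3], ?_⟩
    · filter_upwards [h2, k2] with y hy hy'
      exact add_mem hy hy'
    · rw [extD_add h1.differentiableAt k1.differentiableAt]
      exact add_mem h4 k4
  smul_mem' := by
    rintro c α ⟨ω, h1, h2, h3, h4⟩
    refine ⟨c • ω, analyticAt_const.smul h1, ?_, by simp [h3], ?_⟩
    · filter_upwards [h2] with y hy
      exact Submodule.smul_mem _ c hy
    · rw [extD_smul]
      exact Submodule.smul_mem _ c h4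

/-- The derived flag `I = I_{[0]} ⊇ I_{[1]} ⊇ I_{[2]} ⊇ …`. -/
def derivedFlag (I : E → Submodule ℂ (E →L[ℂ] ℂ)) : ℕ → E → Submodule ℂ (E →L[ℂ] ℂ)
  | 0 => I
  | m + 1 => derivedSystem (derivedFlag I m)

/-- The flag `W^{[0]} = W`, `W^{[m+1]} = W^{[m]} + [W^{[m]}, W^{[m]}]` of a distribution `W`. -/
def bracketFlag (W : E → Submodule ℂ E) : ℕ → E → Submodule ℂ E
  | 0 => W
  | m + 1 => fun x => bracketFlag W m x ⊔ Submodule.span ℂ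
      {w | ∃ X Y : E → E, AnalyticAt ℂ X x ∧ AnalyticAt ℂ Y x ∧
        (∀ᶠ y in nhds x, X y ∈ bracketFlag W m y) ∧ (∀ᶠ y in nhds x, Y y ∈ bracketFlag W m y) ∧
        w = VectorField.lieBracket ℂ X Y x}

/-- `I` is bracket generating over `U`: the flag of `W = I^⊥` reaches the full tangent space. -/
def IsBracketGenerating (I : E → Submodule ℂ (E →L[ℂ] ℂ)) (U : Set E) : Prop :=
  ∀ x ∈ U, ⨆ m, bracketFlag (fun y => ⨅ α ∈ I y, LinearMap.ker α.toLinearMap) m x = ⊤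

variable {V : Type*} [AddCommGroup V] [Module ℂ V] [Module.Finite ℂ V]

/-- The tangent vectors `v` at `x` along which the holomorphic family `F` of filtrations satisfies
`dF^p ⊆ F^{p-k}`: for all `p` and all local holomorphic sections `s` of `F^p` one has
`ds(v) ∈ F^{p-k}`. -/
def horizontal (F : E → ℤ → Submodule ℂ V) (k : ℤ) (x : E) : Submodule ℂ E :=
  ⨅ (p : ℤ) (s : E → V) (_ : HolomorphicNear s x) (_ : ∀ᶠ y in nhds x, s y ∈ F y p),
    (F x (p - k)).comap (differential s x)

/-- The Pfaffian system `I(k)` of the relation `dF^p ⊆ F^{p-k}`, the annihilator of the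
corresponding distribution; `I(1)` is the infinitesimal period relation. -/
def periodSystem (F : E → ℤ → Submodule ℂ V) (k : ℤ) (x : E) : Submodule ℂ (E →L[ℂ] ℂ) where
  carrier := {α | ∀ v ∈ horizontal F k x, α v = 0}
  zero_mem' := by simp
  add_mem' := by
    intro α β hα hβ v hv
    simp [hα v hv, hβ v hv]
  smul_mem' := by
    intro c α hα v hv
    simp [hα v hv]

end Pfaffian

end

end PeriodDomain

/-! Near a point `F` of the period domain everything is governed by one nilpotent Lie algebra. Let
`U p = conj F^{n-p+1}` be the filtration opposed to `F`, and let `lowerSkew B U` be the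
infinitesimal isometries of the complexified form `B` that strictly lower `U`. The unipotent
isometries `g` attached to `U` correspond bijectively to the isotropic filtrations complementary to
`U`, through `g ↦ gF`. The Cayley transform, used in place of the exponential, is rational and gives
a chart (`exists_cayleyChart`).

In this chart the form `g⁻¹ dg` is a coframe with values in the fixed space `lowerSkew B U`. It
satisfies the Maurer–Cartan equation (`cayleyForm_structure_eq`), and the distribution of `I(k)` is
the preimage of the elements of depth at most `k` (`horizontal_eq`). Relative to such a coframe a
distribution given by a fixed subspace `W` is replaced by the one of `W + [W, W]`, both in the
bracket flag and, after passing to annihilators, in the derived flag (`derivedSystem_eq`,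
`bracketFlag_eq`). Sub-bundles of constant rank result, and the theorem becomes a statement about
the algebraic flag generated by the elements of depth 1.

Depths add under commutators, so step `m` of the flag has depth at most `2^m`. For the opposite
inclusion the algebra is spanned by the rank two elements `v ↦ B(x,v) w - ε B(w,v) x` with
homogeneous `w`, `x`; those with `w ∈ V_r`, `x ∈ V_{n-p}` form the component from degree `p` to
degree `r`. The components `p → q` and `q → r` bracket onto `p → r`, unless `p + q = n` or `q + r =
n` and the pieces are too small (`containsComponent_of_large`). The exception does not occur for odd
`n`, nor for pieces of dimension at least two. For even `n` it is avoided by staying on one side of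
`n/2` and crossing through the middle degree; this exhausts the algebra once `n ≤ 2^m`
(`lowerSkew_le_flag`), and respects depth when `n ≤ 4` (`depth_le_flag_of_small`).

It remains that small moves of `F` by unipotent isometries stay in the domain: the equalities are
preserved by isometries, and complementarity and positivity are open by compactness of the sphere.
Any other chart differs from a Cayley chart by a local biholomorphism, along which the coframe pulls
back. -/

set_option linter.unusedSectionVars false

namespace PeriodDomain

noncomputable section

/-! ### Pfaffian systems with constant coefficients in a Maurer–Cartan coframe -/

section Frame

open Filter Topology

variable {E : Type*} [NormedAddCommGroup E] [NormedSpace ℂ E]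
variable {N : Type*} [NormedAddCommGroup N] [NormedSpace ℂ N]

theorem extD_apply {ω : E → E →L[ℂ] ℂ} {x : E} (hω : DifferentiableAt ℂ ω x) (u v : E) :
    extD ω x ![u, v] = fderiv ℂ ω x u v - fderiv ℂ ω x v u := by
  have h1 : fderiv ℂ (fun y => oneForm (ω y)) x =
      (oneForm (E := E)).toContinuousLinearEquiv.toContinuousLinearMap.comp (fderiv ℂ ω x) :=
    ((oneForm (E := E)).toContinuousLinearEquiv.toContinuousLinearMap.hasFDerivAt.comp x
      hω.hasFDerivAt).fderiv
  unfold extD extDeriv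
  rw [h1, ContinuousAlternatingMap.alternatizeUncurryFin_apply]
  simp [Fin.sum_univ_two, oneForm, Fin.removeNth, sub_eq_add_neg]

/-- The wedge product of two `1`-forms. -/
def wedge (α β : E →L[ℂ] ℂ) : E [⋀^Fin 2]→L[ℂ] ℂ :=
  ContinuousAlternatingMap.alternatizeUncurryFin (α.smulRight (oneForm β))

theorem wedge_apply (α β : E →L[ℂ] ℂ) (u v : E) :
    wedge α β ![u, v] = α u * β v - α v * β u := by
  unfold wedge
  rw [ContinuousAlternatingMap.alternatizeUncurryFin_apply]
  simp [Fin.sum_univ_two, oneForm, Fin.removeNth, sub_eq_add_neg]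

/-- The annihilator of a subspace in the cotangent space. -/
def annihilator (K : Submodule ℂ E) : Submodule ℂ (E →L[ℂ] ℂ) where
  carrier := {α | ∀ v ∈ K, α v = 0}
  zero_mem' := by simp
  add_mem' := by
    intro α β hα hβ v hv
    simp [hα v hv, hβ v hv]
  smul_mem' := by
    intro c α hα v hv
    simp [hα v hv]

theorem annihilator_anti {K K' : Submodule ℂ E} (h : K ≤ K') :
    annihilator K' ≤ annihilator K := fun _ hα v hv => hα v (h hv)

theorem iInf_ker_annihilator [FiniteDimensional ℂ E] (K : Submodule ℂ E) :
    (⨅ α ∈ annihilator K, LinearMap.ker α.toLinearMap) = K := by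
  apply le_antisymm
  · intro v hv
    by_contra hvK
    obtain ⟨f, hf, hfK⟩ := Submodule.exists_le_ker_of_notMem hvK
    simp only [Submodule.mem_iInf] at hv
    exact hf (hv (LinearMap.toContinuousLinearMap f) (fun w hw => hfK hw))
  · intro v hv
    simp only [Submodule.mem_iInf]
    exact fun α hα => hα v hv

/-- A projection `p` onto `K` splits `η(u, v)` into four terms. The one on `K × K` vanishes, and the
others are wedge products with the coordinates of `1 - p`, which annihilate `K`. -/
theorem mem_wedgeIdeal_annihilator [FiniteDimensional ℂ E] (K : Submodule ℂ E)
    (η : E [⋀^Fin 2]→L[ℂ] ℂ) :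
    η ∈ wedgeIdeal (annihilator K) ↔ ∀ u ∈ K, ∀ v ∈ K, η ![u, v] = 0 := by
  constructor
  · intro hη u hu v hv
    induction hη using Submodule.span_induction with
    | mem η h =>
      obtain ⟨α, hα, β, h⟩ := h
      rw [h, hα u hu, hα v hv]
      simp
    | zero => simp
    | add η η' _ _ h h' => simp [h, h']
    | smul c η _ h => simp [h]
  · intro h
    obtain ⟨π, hπ⟩ := K.subtype.exists_leftInverse_of_injective (by simp)
    have hπK : ∀ k (hk : k ∈ K), (π k : E) = k := fun k hk => by
      have := LinearMap.congr_fun hπ ⟨k, hk⟩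
      simpa using congrArg Subtype.val this
    let p : E →L[ℂ] E := LinearMap.toContinuousLinearMap (K.subtype.comp π)
    have hp : ∀ v, p v ∈ K := fun v => (π v).2
    have hpK : ∀ k ∈ K, p k = k := hπK
    let b := Module.finBasis ℂ E
    let α : Fin (Module.finrank ℂ E) → E →L[ℂ] ℂ := fun i =>
      (LinearMap.toContinuousLinearMap (b.coord i)).comp (ContinuousLinearMap.id ℂ E - p)
    have hα : ∀ i, α i ∈ annihilator K := by
      intro i k hk
      simp [α, hpK k hk]
    let η₂ : E → E →L[ℂ] ℂ := fun u => oneForm.symm (η.curryLeft u)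
    have hη₂ : ∀ u v, η₂ u v = η ![u, v] := by
      intro u v
      have : oneForm (η₂ u) ![v] = η ![u, v] := by
        simp [η₂, ContinuousAlternatingMap.curryLeft_apply_apply]
      simpa [oneForm] using this
    have hadd : ∀ u u' v, η ![u + u', v] = η ![u, v] + η ![u', v] := fun u u' v =>
      η.vecCons_add ![v] u u'
    have hsmul : ∀ (c : ℂ) u v, η ![c • u, v] = c * η ![u, v] := fun c u v =>
      η.vecCons_smul ![v] c u
    have hswap : ∀ u v, η ![u, v] = -η ![v, u] := by
      intro u v
      have := η.map_swap ![v, u] (i := 0) (j := 1) (by decide)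
      refine Eq.trans ?_ this
      change η _ = η _
      congr 1
      ext i
      fin_cases i <;> simp
    -- The factor `1/2` is needed because antisymmetrizing counts the part of `η` on the complement
    -- twice, and each mixed part only once.
    let β : Fin (Module.finrank ℂ E) → E →L[ℂ] ℂ := fun i =>
      (η₂ (b i)).comp p + (1 / 2 : ℂ) • (η₂ (b i)).comp (ContinuousLinearMap.id ℂ E - p)
    have hsum : ∀ u v, η ![u - p u, v] = ∑ i, α i u * η ![b i, v] := by
      intro u v
      let l : E →ₗ[ℂ] ℂ :=
        { toFun := fun u => η ![u, v], map_add' := fun u u' => hadd u u' v,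
          map_smul' := fun c u => hsmul c u v }
      change l (u - p u) = _
      conv_lhs => rw [← b.sum_repr (u - p u), map_sum]
      refine Finset.sum_congr rfl fun i _ => ?_
      rw [map_smul]
      rfl
    have key : η = ∑ i, wedge (α i) (β i) := by
      ext w
      have hw : w = ![w 0, w 1] := by
        ext i
        fin_cases i <;> rfl
      rw [hw]
      generalize w 0 = u
      generalize w 1 = v
      have e1 : (∑ i, wedge (α i) (β i)) ![u, v] = ∑ i, (α i u * β i v - α i v * β i u) := by
        rw [ContinuousAlternatingMap.sum_apply]
        simp [wedge_apply]
      have e2 : ∀ u v, ∑ i, α i u * β i v = η ![u - p u, p v] +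
          (1 / 2) * η ![u - p u, v - p v] := by
        intro u v
        rw [hsum, hsum, Finset.mul_sum, ← Finset.sum_add_distrib]
        refine Finset.sum_congr rfl fun i _ => ?_
        simp only [β, add_apply, smul_apply,
          ContinuousLinearMap.comp_apply, sub_apply,
          ContinuousLinearMap.id_apply, hη₂, smul_eq_mul]
        ring
      rw [e1, Finset.sum_sub_distrib, e2, e2, hswap (v - p v) (u - p u), hswap (v - p v) (p u)]
      have e3 : η ![u, v] = η ![u - p u, v - p v] + η ![u - p u, p v] + η ![p u, v - p v]
          + η ![p u, p v] := by
        have e4 : ∀ a b c, η ![a, b + c] = η ![a, b] + η ![a, c] := by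
          intro a b c
          rw [hswap, hadd, hswap b, hswap c]
          ring
        rw [← e4, add_assoc, ← e4, ← hadd]
        simp
      rw [e3, h _ (hp u) _ (hp v)]
      ring
    rw [key]
    exact Submodule.sum_mem _ fun i _ => Submodule.subset_span
      ⟨α i, hα i, β i, fun u v => wedge_apply _ _ u v⟩

theorem exists_frame {M : Type*} [AddCommGroup M] [Module ℂ M] [Module.Finite ℂ M]
    (A : Submodule ℂ M) :
    ∃ (r : ℕ) (b : Fin r → M), LinearIndependent ℂ b ∧ Submodule.span ℂ (Set.range b) = A := by
  let b := Module.finBasis ℂ A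
  refine ⟨_, fun i => (b i : M), b.linearIndependent.map' A.subtype A.ker_subtype, ?_⟩
  have h := congrArg (Submodule.map A.subtype) b.span_eq
  rw [Submodule.map_span, ← Set.range_comp, Submodule.map_subtype_top] at h
  exact h

/-- Every functional vanishing on `W` kills `f` near `y`, hence kills its derivative. -/
theorem hasFDerivAt_apply_mem [FiniteDimensional ℂ N] {W : Submodule ℂ N} {y : E} {f : E → N}
    {f' : E →L[ℂ] N} (hf : HasFDerivAt f f' y) (hfW : ∀ᶠ z in 𝓝 y, f z ∈ W) (u : E) :
    f' u ∈ W := by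
  by_contra hu
  obtain ⟨l, hl, hlW⟩ := Submodule.exists_le_ker_of_notMem hu
  have h1 := (LinearMap.toContinuousLinearMap l).hasFDerivAt.comp y hf
  have h2 : (LinearMap.toContinuousLinearMap l ∘ f) =ᶠ[𝓝 y] fun _ => 0 := by
    filter_upwards [hfW] with z hz
    exact hlW hz
  have h3 := h1.unique ((hasFDerivAt_const (0 : ℂ) y).congr_of_eventuallyEq h2)
  exact hl (by simpa using congrArg (fun f => f u) h3)

/-- `W + [W, W]`. -/
def bracketSpan (br : N → N → N) (W : Submodule ℂ N) : Submodule ℂ N :=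
  W ⊔ Submodule.span ℂ {c | ∃ a ∈ W, ∃ b ∈ W, c = br a b}

/-- The flag `W ⊆ W + [W, W] ⊆ …`. -/
def algebraicFlag (br : N → N → N) (W : Submodule ℂ N) : ℕ → Submodule ℂ N
  | 0 => W
  | m + 1 => bracketSpan br (algebraicFlag br W m)

/-- A coframe `θ` on the open set `S`, with values in `N`, which satisfies the Maurer–Cartan
equation for the bracket `br`. -/
structure IsMaurerCartan (S : Set E) (θ : E → E →L[ℂ] N) (br : N → N → N) : Prop where
  isOpen : IsOpen S
  analytic : AnalyticOnNhd ℂ θ S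
  invertible : ∀ y ∈ S, (θ y).IsInvertible
  structure_eq : ∀ y ∈ S, ∀ u v, fderiv ℂ θ y u v - fderiv ℂ θ y v u = -br (θ y u) (θ y v)

namespace IsMaurerCartan

variable {S : Set E} {θ : E → E →L[ℂ] N} {br : N → N → N}

theorem apply_inverse (h : IsMaurerCartan S θ br) {y : E} (hy : y ∈ S) (a : N) :
    θ y ((θ y).inverse a) = a := by
  obtain ⟨e, he⟩ := h.invertible y hy
  rw [← he]
  simp

theorem inverse_apply (h : IsMaurerCartan S θ br) {y : E} (hy : y ∈ S) (a : E) :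
    (θ y).inverse (θ y a) = a := by
  obtain ⟨e, he⟩ := h.invertible y hy
  rw [← he]
  simp

theorem analyticAt_inverse [CompleteSpace E] (h : IsMaurerCartan S θ br) {y : E} (hy : y ∈ S) :
    AnalyticAt ℂ (fun z => (θ z).inverse) y := by
  have h1 : ContDiffAt ℂ ⊤ (ContinuousLinearMap.inverse : (E →L[ℂ] N) → N →L[ℂ] E) (θ y) :=
    (h.invertible y hy).contDiffAt_map_inverse
  exact h1.analyticAt.comp (h.analytic y hy)

/-- For constant `b ∈ W` the field `z ↦ (θ z)⁻¹ b` is killed by `ω`, while `θ` is constant on it.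
Differentiating both identities expresses the derivative of `ω` through that of `θ`; the structure
equation does the rest. -/
theorem extD_eq [CompleteSpace E] (h : IsMaurerCartan S θ br) (W : Submodule ℂ N) {y : E}
    (hy : y ∈ S) {ω : E → E →L[ℂ] ℂ} (hω : DifferentiableAt ℂ ω y)
    (hωW : ∀ᶠ z in 𝓝 y, ω z ∈ annihilator (W.comap (θ z).toLinearMap)) {u v : E}
    (hu : θ y u ∈ W) (hv : θ y v ∈ W) :
    extD ω y ![u, v] = -ω y ((θ y).inverse (br (θ y u) (θ y v))) := by
  have hS : ∀ᶠ z in 𝓝 y, z ∈ S := h.isOpen.mem_nhds hy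
  have hθ := (h.analytic y hy).differentiableAt.hasFDerivAt
  have hinv := (h.analyticAt_inverse hy).differentiableAt.hasFDerivAt
  have key : ∀ u v, θ y v ∈ W →
      fderiv ℂ ω y u v = ω y ((θ y).inverse (fderiv ℂ θ y u v)) := by
    intro u v hv
    have hY := hinv.clm_apply (hasFDerivAt_const (θ y v) y)
    have h1 := hω.hasFDerivAt.clm_apply hY
    have h2 := hθ.clm_apply hY
    have h3 : (fun z => ω z ((θ z).inverse (θ y v))) =ᶠ[𝓝 y] fun _ => 0 := by
      filter_upwards [hS, hωW] with z hz hz'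
      apply hz'
      simpa [h.apply_inverse hz] using hv
    have h4 : (fun z => θ z ((θ z).inverse (θ y v))) =ᶠ[𝓝 y] fun _ => θ y v := by
      filter_upwards [hS] with z hz
      rw [h.apply_inverse hz]
    have h5 := congrArg (fun f => f u) (h1.unique ((hasFDerivAt_const (0 : ℂ) y).congr_of_eventuallyEq h3))
    have h6 := congrArg (fun f => f u) (h2.unique ((hasFDerivAt_const (θ y v) y).congr_of_eventuallyEq h4))
    simp only [add_apply, ContinuousLinearMap.comp_apply, ContinuousLinearMap.flip_apply,
      zero_apply, map_zero, zero_add, h.inverse_apply hy] at h5 h6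
    have h7 := congrArg (θ y).inverse h6
    rw [map_add, h.inverse_apply hy, map_zero] at h7
    have h8 := eq_neg_of_add_eq_zero_left h7
    rw [h8, map_neg] at h5
    linear_combination h5
  rw [extD_apply hω, key u v hv, key v u hu, ← map_sub, ← map_sub, h.structure_eq y hy]
  simp

/-- By `extD_eq` the condition on `dω` at `y` depends only on the value `ω y`: it must kill the
brackets of `W`. Conversely a covector `α` that does so extends to the section with constant
coefficients in the coframe. -/
theorem derivedSystem_eq [FiniteDimensional ℂ E] (h : IsMaurerCartan S θ br) (W : Submodule ℂ N)
    {I : E → Submodule ℂ (E →L[ℂ] ℂ)}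
    (hI : ∀ z ∈ S, I z = annihilator (W.comap (θ z).toLinearMap)) {y : E} (hy : y ∈ S) :
    derivedSystem I y = annihilator ((bracketSpan br W).comap (θ y).toLinearMap) := by
  have : CompleteSpace E := FiniteDimensional.complete ℂ E
  have hS : ∀ᶠ z in 𝓝 y, z ∈ S := h.isOpen.mem_nhds hy
  have hiff : ∀ ω : E → E →L[ℂ] ℂ, AnalyticAt ℂ ω y → (∀ᶠ z in 𝓝 y, ω z ∈ I z) →
      (extD ω y ∈ wedgeIdeal (I y) ↔
        ∀ a ∈ W, ∀ b ∈ W, ω y ((θ y).inverse (br a b)) = 0) := by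
    intro ω hω hωI
    have hωW : ∀ᶠ z in 𝓝 y, ω z ∈ annihilator (W.comap (θ z).toLinearMap) := by
      filter_upwards [hS, hωI] with z hz hz'
      rwa [← hI z hz]
    rw [hI y hy, mem_wedgeIdeal_annihilator]
    constructor
    · intro H a ha b hb
      have := H ((θ y).inverse a) (by simpa [h.apply_inverse hy] using ha) ((θ y).inverse b)
        (by simpa [h.apply_inverse hy] using hb)
      rwa [h.extD_eq W hy hω.differentiableAt hωW (by rwa [h.apply_inverse hy])
        (by rwa [h.apply_inverse hy]), h.apply_inverse hy, h.apply_inverse hy, neg_eq_zero] at this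
    · intro H u hu v hv
      rw [h.extD_eq W hy hω.differentiableAt hωW hu hv, neg_eq_zero]
      exact H _ hu _ hv
  ext α
  constructor
  · rintro ⟨ω, h1, h2, rfl, h4⟩
    have h5 := (hiff ω h1 h2).1 h4
    have h6 : ω y ∈ I y := h2.self_of_nhds
    rw [hI y hy] at h6
    have h7 : bracketSpan br W ≤
        LinearMap.ker ((ω y).toLinearMap ∘ₗ (θ y).inverse.toLinearMap) := by
      refine sup_le (fun a ha => ?_) (Submodule.span_le.2 ?_)
      · exact h6 _ (by simpa [h.apply_inverse hy] using ha)
      · rintro c ⟨a, ha, b, hb, rfl⟩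
        exact h5 a ha b hb
    intro v hv
    have h8 : ω y ((θ y).inverse (θ y v)) = 0 := h7 hv
    rwa [h.inverse_apply hy] at h8
  · intro hα
    have hαW : ∀ a ∈ bracketSpan br W, α ((θ y).inverse a) = 0 := fun a ha =>
      hα _ (by simpa [h.apply_inverse hy] using ha)
    have hωan : AnalyticAt ℂ (fun z => (α.comp (θ y).inverse).comp (θ z)) y :=
      ((ContinuousLinearMap.compL ℂ E N ℂ (α.comp (θ y).inverse)).analyticAt _).comp
        (h.analytic y hy)
    have hωI : ∀ᶠ z in 𝓝 y, (α.comp (θ y).inverse).comp (θ z) ∈ I z := by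
      filter_upwards [hS] with z hz
      rw [hI z hz]
      intro v hv
      exact hαW _ (Submodule.mem_sup_left hv)
    refine ⟨fun z => (α.comp (θ y).inverse).comp (θ z), hωan, hωI, ?_, ?_⟩
    · ext v
      simp [h.inverse_apply hy]
    · rw [hiff _ hωan hωI]
      intro a ha b hb
      simp only [ContinuousLinearMap.comp_apply, h.apply_inverse hy]
      exact hαW _ (Submodule.mem_sup_right (Submodule.subset_span ⟨a, ha, b, hb, rfl⟩))

/-- The derived system is again given by a fixed subspace of `N`, so `derivedSystem_eq` can be
iterated. -/
theorem derivedFlag_eq [FiniteDimensional ℂ E] (h : IsMaurerCartan S θ br) (W : Submodule ℂ N)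
    {I : E → Submodule ℂ (E →L[ℂ] ℂ)}
    (hI : ∀ z ∈ S, I z = annihilator (W.comap (θ z).toLinearMap)) (m : ℕ) :
    ∀ y ∈ S, derivedFlag I m y =
      annihilator ((algebraicFlag br W m).comap (θ y).toLinearMap) := by
  induction m with
  | zero => exact hI
  | succ m ih => exact fun y hy => h.derivedSystem_eq _ ih hy

/-- By the structure equation the difference is the derivative of `θ(Y)` along `X` minus that of
`θ(X)` along `Y`, and both functions take values in `W`. -/
theorem apply_lieBracket [FiniteDimensional ℂ E] [FiniteDimensional ℂ N]
    (h : IsMaurerCartan S θ br) (W : Submodule ℂ N)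
    {y : E} (hy : y ∈ S) {X Y : E → E} (hX : AnalyticAt ℂ X y) (hY : AnalyticAt ℂ Y y)
    (hXW : ∀ᶠ z in 𝓝 y, θ z (X z) ∈ W) (hYW : ∀ᶠ z in 𝓝 y, θ z (Y z) ∈ W) :
    θ y (VectorField.lieBracket ℂ X Y y) - br (θ y (X y)) (θ y (Y y)) ∈ W := by
  have hθ := (h.analytic y hy).differentiableAt.hasFDerivAt
  have h1 := hasFDerivAt_apply_mem (hθ.clm_apply hX.differentiableAt.hasFDerivAt) hXW (Y y)
  have h2 := hasFDerivAt_apply_mem (hθ.clm_apply hY.differentiableAt.hasFDerivAt) hYW (X y)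
  have h3 := h.structure_eq y hy (X y) (Y y)
  have h4 := W.sub_mem h2 h1
  simp only [add_apply, ContinuousLinearMap.comp_apply, ContinuousLinearMap.flip_apply] at h4
  convert h4 using 1
  rw [VectorField.lieBracket, map_sub, sub_eq_add_neg, ← h3]
  abel

/-- Modulo the current subspace the Lie bracket of two sections is `br` of their values; the fields
that are constant in the coframe realize every such bracket. -/
theorem bracketFlag_eq [FiniteDimensional ℂ E] [FiniteDimensional ℂ N]
    (h : IsMaurerCartan S θ br) (W : Submodule ℂ N) {D : E → Submodule ℂ E}
    (hD : ∀ z ∈ S, D z = W.comap (θ z).toLinearMap) (m : ℕ) :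
    ∀ y ∈ S, bracketFlag D m y = (algebraicFlag br W m).comap (θ y).toLinearMap := by
  induction m with
  | zero => exact hD
  | succ m ih =>
    intro y hy
    have : CompleteSpace E := FiniteDimensional.complete ℂ E
    have hS : ∀ᶠ z in 𝓝 y, z ∈ S := h.isOpen.mem_nhds hy
    apply le_antisymm
    · refine sup_le ?_ (Submodule.span_le.2 ?_)
      · rw [ih y hy]
        exact Submodule.comap_mono le_sup_left
      · rintro w ⟨X, Y, hX, hY, hXW, hYW, rfl⟩
        have hX' : ∀ᶠ z in 𝓝 y, θ z (X z) ∈ algebraicFlag br W m := by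
          filter_upwards [hS, hXW] with z hz hz'
          rwa [ih z hz] at hz'
        have hY' : ∀ᶠ z in 𝓝 y, θ z (Y z) ∈ algebraicFlag br W m := by
          filter_upwards [hS, hYW] with z hz hz'
          rwa [ih z hz] at hz'
        have h1 := h.apply_lieBracket _ hy hX hY hX' hY'
        have h2 : br (θ y (X y)) (θ y (Y y)) ∈ algebraicFlag br W (m + 1) :=
          Submodule.mem_sup_right (Submodule.subset_span
            ⟨_, hX'.self_of_nhds, _, hY'.self_of_nhds, rfl⟩)
        have h3 := add_mem (Submodule.mem_sup_left h1 : _ ∈ algebraicFlag br W (m + 1)) h2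
        rw [sub_add_cancel] at h3
        exact h3
    · suffices H : algebraicFlag br W (m + 1) ≤
          (bracketFlag D (m + 1) y).comap (θ y).inverse.toLinearMap by
        intro v hv
        have h1 : (θ y).inverse (θ y v) ∈ bracketFlag D (m + 1) y := H hv
        rwa [h.inverse_apply hy] at h1
      have hinv : ∀ z ∈ S, ∀ a ∈ algebraicFlag br W m,
          (θ z).inverse a ∈ bracketFlag D m z := by
        intro z hz a ha
        rw [ih z hz]
        simpa [h.apply_inverse hz] using ha
      refine sup_le (fun a ha => Submodule.mem_sup_left (hinv y hy a ha)) (Submodule.span_le.2 ?_)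
      rintro c ⟨a, ha, b, hb, rfl⟩
      have han : ∀ a, AnalyticAt ℂ (fun z => (θ z).inverse a) y := fun a =>
        ((ContinuousLinearMap.apply ℂ E a).analyticAt _).comp (h.analyticAt_inverse hy)
      have hfield : ∀ a ∈ algebraicFlag br W m,
          ∀ᶠ z in 𝓝 y, (θ z).inverse a ∈ bracketFlag D m z := by
        intro a ha
        filter_upwards [hS] with z hz using hinv z hz a ha
      have hfield' : ∀ a ∈ algebraicFlag br W m,
          ∀ᶠ z in 𝓝 y, θ z ((θ z).inverse a) ∈ algebraicFlag br W m := by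
        intro a ha
        filter_upwards [hS] with z hz
        rwa [h.apply_inverse hz]
      have h1 := h.apply_lieBracket _ hy (han a) (han b) (hfield' a ha) (hfield' b hb)
      rw [h.apply_inverse hy, h.apply_inverse hy] at h1
      have h2 := hinv y hy _ h1
      rw [map_sub, h.inverse_apply hy] at h2
      have h3 : VectorField.lieBracket ℂ (fun z => (θ z).inverse a) (fun z => (θ z).inverse b) y ∈
          bracketFlag D (m + 1) y :=
        Submodule.mem_sup_right (Submodule.subset_span
          ⟨_, _, han a, han b, hfield a ha, hfield b hb, rfl⟩)
      have h4 := sub_mem h3 (Submodule.mem_sup_left h2 : _ ∈ bracketFlag D (m + 1) y)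
      rwa [sub_sub_cancel] at h4

theorem isHolomorphicSubbundleAt [FiniteDimensional ℂ E]
    (h : IsMaurerCartan S θ br) (W : Submodule ℂ N) {I : E → Submodule ℂ (E →L[ℂ] ℂ)}
    (hI : ∀ z ∈ S, I z = annihilator (W.comap (θ z).toLinearMap)) {y : E} (hy : y ∈ S) :
    IsHolomorphicSubbundleAt I y := by
  have : FiniteDimensional ℂ N := by
    obtain ⟨e, -⟩ := h.invertible y hy
    exact e.toLinearEquiv.finiteDimensional
  have hS : ∀ᶠ z in 𝓝 y, z ∈ S := h.isOpen.mem_nhds hy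
  obtain ⟨r, b, hb, hspan⟩ := exists_frame (annihilator W)
  refine ⟨r, fun i z => (b i).comp (θ z), ?_, ?_⟩
  · intro i l
    exact ((LinearMap.toContinuousLinearMap l).analyticAt _).comp
      (((ContinuousLinearMap.compL ℂ E N ℂ (b i)).analyticAt _).comp
        (h.analytic y hy))
  · filter_upwards [hS] with z hz
    let T : (N →L[ℂ] ℂ) →ₗ[ℂ] (E →L[ℂ] ℂ) :=
      ((ContinuousLinearMap.compL ℂ E N ℂ).flip (θ z)).toLinearMap
    have hT : Function.Injective T := by
      intro α β hαβ
      refine ContinuousLinearMap.ext fun a => ?_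
      have h1 : α (θ z ((θ z).inverse a)) = β (θ z ((θ z).inverse a)) :=
        congrArg (fun f : E →L[ℂ] ℂ => f ((θ z).inverse a)) hαβ
      rwa [h.apply_inverse hz] at h1
    refine ⟨hb.map' T (LinearMap.ker_eq_bot.2 hT), ?_⟩
    have h1 : (Set.range fun i => (b i).comp (θ z)) =
        T '' (Set.range b) := by
      rw [← Set.range_comp]
      rfl
    rw [h1, ← Submodule.map_span, hspan, hI z hz]
    ext α
    constructor
    · intro hα
      refine ⟨α.comp (θ z).inverse, fun a ha => hα _ ?_, ?_⟩
      · simpa [h.apply_inverse hz] using ha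
      · ext v
        simp [T, h.inverse_apply hz]
    · rintro ⟨β, hβ, rfl⟩ v hv
      exact hβ _ hv

end IsMaurerCartan

end Frame
end
end PeriodDomain

namespace PeriodDomain

noncomputable section

/-! ### Polarized gradings and the algebra of infinitesimal isometries -/

section Grading

variable {V : Type*} [NormedAddCommGroup V] [NormedSpace ℂ V] [FiniteDimensional ℂ V]

/-- A grading of `V` by the projections `π p`, `0 ≤ p ≤ n`, compatible with the `(-1)^n`-symmetric
form `B`, with its decreasing filtration `F p = ⨁_{q ≥ p} V_q` and its increasing filtration
`U p = ⨁_{q < p} V_q`. -/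
structure IsPolarizedGrading (n : ℕ) (B : LinearMap.BilinForm ℂ V) (π : ℤ → V →ₗ[ℂ] V)
    (F U : ℤ → Submodule ℂ V) : Prop where
  nondeg : ∀ u, (∀ v, B u v = 0) → u = 0
  symm : ∀ u v, B u v = (-1) ^ n * B v u
  proj_self : ∀ p v, π p (π p v) = π p v
  proj_ne : ∀ p q v, p ≠ q → π p (π q v) = 0
  sum_proj : ∀ v, ∑ p ∈ Finset.Icc (0 : ℤ) n, π p v = v
  mem_F : ∀ p v, v ∈ F p ↔ ∀ q < p, π q v = 0
  mem_U : ∀ p v, v ∈ U p ↔ ∀ q ≥ p, π q v = 0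
  proj_zero : ∀ p, p < 0 ∨ (n : ℤ) < p → ∀ v, π p v = 0
  adj : ∀ p u v, B (π p u) v = B u (π (n - p) v)

/-- The Lie algebra of the isometry group of `B`. -/
def skew (B : LinearMap.BilinForm ℂ V) : Submodule ℂ (V →L[ℂ] V) where
  carrier := {A | ∀ u v, B (A u) v = -B u (A v)}
  zero_mem' := by simp
  add_mem' := by
    intro A A' h h' u v
    simp [h u v, h' u v]
    ring
  smul_mem' := by
    intro c A h u v
    simp [h u v]

/-- The endomorphisms which map `U p` to `U' p` for all `p`. -/
def filteredMaps (U U' : ℤ → Submodule ℂ V) : Submodule ℂ (V →L[ℂ] V) where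
  carrier := {A | ∀ p, ∀ v ∈ U p, A v ∈ U' p}
  zero_mem' := by simp
  add_mem' := fun h h' p v hv => add_mem (h p v hv) (h' p v hv)
  smul_mem' := fun c _ h p v hv => (U' p).smul_mem c (h p v hv)

theorem mem_skew {B : LinearMap.BilinForm ℂ V} {A : V →L[ℂ] V} :
    A ∈ skew B ↔ ∀ u v, B (A u) v = -B u (A v) := Iff.rfl

/-- The nilpotent Lie algebra of the infinitesimal isometries which strictly lower `U`. -/
def lowerSkew (B : LinearMap.BilinForm ℂ V) (U : ℤ → Submodule ℂ V) :
    Submodule ℂ (V →L[ℂ] V) :=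
  skew B ⊓ filteredMaps (fun p => U (p + 1)) U

/-- The part of depth at most `k` of `lowerSkew B U` with respect to the filtration `F`. -/
def lowerSkewDepth (B : LinearMap.BilinForm ℂ V) (F U : ℤ → Submodule ℂ V) (k : ℤ) :
    Submodule ℂ (V →L[ℂ] V) :=
  lowerSkew B U ⊓ filteredMaps F (fun p => F (p - k))

/-- The endomorphism `v ↦ B(x,v) w - ε B(w,v) x`. -/
def rankTwo (B : LinearMap.BilinForm ℂ V) (ε : ℂ) (w x : V) : V →L[ℂ] V :=
  LinearMap.toContinuousLinearMap ((B x).smulRight w - ε • (B w).smulRight x)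

theorem rankTwo_apply (B : LinearMap.BilinForm ℂ V) (ε : ℂ) (w x v : V) :
    rankTwo B ε w x v = B x v • w - (ε * B w v) • x := by
  simp [rankTwo, smul_smul]

/-- An infinitesimal isometry acts on the bilinear expression `rankTwo B ε z x` as a derivation. -/
theorem commutator_rankTwo {B : LinearMap.BilinForm ℂ V} {A : V →L[ℂ] V} (hA : A ∈ skew B)
    (ε : ℂ) (z x : V) :
    A * rankTwo B ε z x - rankTwo B ε z x * A = rankTwo B ε (A z) x + rankTwo B ε z (A x) := by
  rw [mem_skew] at hA
  ext v
  simp only [sub_apply, mul_apply_eq_comp,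
    add_apply, rankTwo_apply, map_sub, map_smul, hA]
  module

theorem rankTwo_add_left (B : LinearMap.BilinForm ℂ V) (ε : ℂ) (w w' x : V) :
    rankTwo B ε (w + w') x = rankTwo B ε w x + rankTwo B ε w' x := by
  ext v
  simp only [add_apply, rankTwo_apply, map_add, LinearMap.add_apply]
  module

theorem rankTwo_sum_left (B : LinearMap.BilinForm ℂ V) (ε : ℂ) {ι : Type*} (s : Finset ι)
    (w : ι → V) (x : V) :
    rankTwo B ε (∑ i ∈ s, w i) x = ∑ i ∈ s, rankTwo B ε (w i) x := by
  classical
  induction s using Finset.induction_on with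
  | empty =>
    ext v
    simp [rankTwo_apply]
  | insert i s hi ih => rw [Finset.sum_insert hi, Finset.sum_insert hi, rankTwo_add_left, ih]

theorem rankTwo_zero_left (B : LinearMap.BilinForm ℂ V) (ε : ℂ) (x : V) :
    rankTwo B ε 0 x = 0 := by
  ext v
  simp [rankTwo_apply]

theorem rankTwo_zero_right (B : LinearMap.BilinForm ℂ V) (ε : ℂ) (w : V) :
    rankTwo B ε w 0 = 0 := by
  ext v
  simp [rankTwo_apply]

namespace IsPolarizedGrading

variable {n : ℕ} {B : LinearMap.BilinForm ℂ V} {π : ℤ → V →ₗ[ℂ] V} {F U : ℤ → Submodule ℂ V}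

/-- These elements model `Λ²V` for even `n` (orthogonal case) and `Sym²V` for odd `n` (symplectic
case). The two behave differently when `w` and `x` are proportional. -/
theorem rankTwo_swap (w x : V) :
    rankTwo B ((-1) ^ n) w x = (-(-1) ^ n : ℂ) • rankTwo B ((-1) ^ n) x w := by
  have h : ((-1 : ℂ) ^ n) * (-1) ^ n = 1 := by rw [← mul_pow]; simp
  ext v
  simp only [smul_apply, rankTwo_apply, smul_sub, smul_smul]
  have h2 : -(-1 : ℂ) ^ n * ((-1) ^ n * B x v) = -B x v := by linear_combination -B x v * h
  rw [h2]
  module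

theorem orthogonal (h : IsPolarizedGrading n B π F U) {r s : ℤ} {w x : V} (hw : π r w = w)
    (hx : π s x = x) (hrs : r + s ≠ n) : B w x = 0 := by
  rw [← hw, h.adj, ← hx, h.proj_ne _ _ _ (by omega), map_zero]

theorem mem_F_of_proj (h : IsPolarizedGrading n B π F U) {r p : ℤ} {w : V} (hw : π r w = w)
    (hp : p ≤ r) : w ∈ F p := by
  rw [h.mem_F]
  intro q hq
  rw [← hw, h.proj_ne _ _ _ (by omega)]

theorem mem_U_of_proj (h : IsPolarizedGrading n B π F U) {r p : ℤ} {w : V} (hw : π r w = w)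
    (hp : r < p) : w ∈ U p := by
  rw [h.mem_U]
  intro q hq
  rw [← hw, h.proj_ne _ _ _ (by omega)]

theorem rankTwo_mem_skew (h : IsPolarizedGrading n B π F U) (w x : V) :
    rankTwo B ((-1) ^ n) w x ∈ skew B := by
  have h1 : ((-1 : ℂ) ^ n) * (-1) ^ n = 1 := by rw [← mul_pow]; simp
  intro u v
  simp only [rankTwo_apply, map_sub, map_smul, LinearMap.sub_apply, LinearMap.smul_apply,
    smul_eq_mul]
  rw [h.symm u w, h.symm u x]
  linear_combination (-(B x u * B w v)) * h1

/-- The two terms map degree `p` to `r` and degree `n - r` to `n - p`, and vanish on the other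
degrees. Both lower the degree by `p - r`. -/
theorem rankTwo_mem_depth (h : IsPolarizedGrading n B π F U) {p r k : ℤ} {w x : V}
    (hw : π r w = w) (hx : π (n - p) x = x) (hrp : r < p) (hk : p - r ≤ k) :
    rankTwo B ((-1) ^ n) w x ∈ lowerSkewDepth B F U k := by
  have hxB : ∀ v, B x v = B x (π p v) := fun v => by
    conv_lhs => rw [← hx, h.adj]
    rw [sub_sub_cancel]
  have hwB : ∀ v, B w v = B w (π (n - r) v) := fun v => by
    conv_lhs => rw [← hw, h.adj]
  refine ⟨⟨h.rankTwo_mem_skew w x, fun q v hv => ?_⟩, fun q v hv => ?_⟩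
  · rw [rankTwo_apply]
    rw [h.mem_U] at hv
    refine sub_mem ?_ ?_
    · by_cases hq : q + 1 ≤ p
      · rw [hxB, hv p hq, map_zero, zero_smul]
        exact zero_mem _
      · exact Submodule.smul_mem _ _ (h.mem_U_of_proj hw (by omega))
    · by_cases hq : q + 1 ≤ n - r
      · rw [hwB, hv _ hq, map_zero, mul_zero, zero_smul]
        exact zero_mem _
      · exact Submodule.smul_mem _ _ (h.mem_U_of_proj hx (by omega))
  · rw [rankTwo_apply]
    rw [h.mem_F] at hv
    refine sub_mem ?_ ?_
    · by_cases hq : p < q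
      · rw [hxB, hv p hq, map_zero, zero_smul]
        exact zero_mem _
      · exact Submodule.smul_mem _ _ (h.mem_F_of_proj hw (by omega))
    · by_cases hq : n - r < q
      · rw [hwB, hv _ hq, map_zero, mul_zero, zero_smul]
        exact zero_mem _
      · exact Submodule.smul_mem _ _ (h.mem_F_of_proj hx (by omega))

theorem nondegenerate (h : IsPolarizedGrading n B π F U) : B.Nondegenerate := by
  refine ⟨h.nondeg, fun v hv => h.nondeg v fun u => ?_⟩
  rw [h.symm, hv u, mul_zero]

/-- A functional that separates `y` from `w` is represented through `B`; its representative is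
projected to the degree dual to that of `y` and normalized. -/
theorem exists_pairing_eq_one (h : IsPolarizedGrading n B π F U) {r : ℤ} {y w : V}
    (hy : π r y = y) (hyw : y ∉ Submodule.span ℂ {w}) :
    ∃ z, π (n - r) z = z ∧ B y z = 1 ∧ (π r w = w → B w z = 0) := by
  obtain ⟨f, hf, hfw⟩ := Submodule.exists_le_ker_of_notMem hyw
  have hfw' : f w = 0 := hfw (Submodule.mem_span_singleton_self w)
  let z := (B.toDual h.nondegenerate).symm f
  have hz : ∀ v, B v z = (-1) ^ n * f v := fun v => by
    rw [h.symm]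
    congr 1
    exact LinearMap.BilinForm.apply_toDual_symm_apply _ _
  have hyz : B y z ≠ 0 := by rw [hz]; exact mul_ne_zero (by simp) hf
  refine ⟨(B y z)⁻¹ • π (n - r) z, ?_, ?_, ?_⟩
  · rw [map_smul, h.proj_self]
  · rw [map_smul, ← h.adj, hy, smul_eq_mul, inv_mul_cancel₀ hyz]
  · intro hw
    rw [map_smul, ← h.adj, hw, hz w, hfw']
    simp

/-- `S` contains the infinitesimal isometries with components only in `Hom(V_p, V_r)` and
`Hom(V_{n-r}, V_{n-p})`. -/
def ContainsComponent (n : ℕ) (B : LinearMap.BilinForm ℂ V) (π : ℤ → V →ₗ[ℂ] V)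
    (S : Submodule ℂ (V →L[ℂ] V)) (p r : ℤ) : Prop :=
  ∀ w x, π r w = w → π (n - p) x = x → rankTwo B ((-1) ^ n) w x ∈ S

/-- Duality under `B` exchanges the two vectors of a rank two element, so both pairs of degrees name
the same component. -/
theorem containsComponent_swap {S : Submodule ℂ (V →L[ℂ] V)} {p r : ℤ}
    (hS : ContainsComponent n B π S p r) : ContainsComponent n B π S (n - r) (n - p) := by
  intro w x hw hx
  rw [rankTwo_swap]
  exact S.smul_mem _ (hS x w (by simpa using hx) hw)

/-- Dual bases of `B` write `A` as a sum of rank two elements; splitting it by degree leaves only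
the components in which `A` is nonzero. -/
theorem mem_of_containsComponent (h : IsPolarizedGrading n B π F U)
    {S : Submodule ℂ (V →L[ℂ] V)} {A : V →L[ℂ] V} (hA : A ∈ skew B)
    (hS : ∀ p r v, π r (A (π p v)) ≠ 0 → ContainsComponent n B π S p r) : A ∈ S := by
  have h1 : ((-1 : ℂ) ^ n) * (-1) ^ n = 1 := by rw [← mul_pow]; simp
  let b := Module.finBasis ℂ V
  let b' := B.dualBasis h.nondegenerate b
  have hb : ∀ v, ∑ i, B (b' i) v • b i = v := by
    intro v
    have hv : ∀ i, B (b' i) v = b.repr v i := by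
      intro i
      have : B (b' i) = b.coord i := by
        refine b.ext fun j => ?_
        rw [LinearMap.BilinForm.apply_dualBasis_left]
        simp [Finsupp.single_apply]
      rw [this]
      rfl
    simp only [hv, b.sum_repr]
  have hb' : ∀ v, ∑ i, B v (b i) • b' i = v := by
    intro v
    have hv : ∀ i, B v (b i) = b'.repr v i := fun i =>
      (LinearMap.BilinForm.dualBasis_repr_apply h.nondegenerate b v i).symm
    simp only [hv, b'.sum_repr]
  have hsum' : ∀ v, ∑ p ∈ Finset.Icc (0 : ℤ) n, π (n - p) v = v := by
    intro v
    conv_rhs => rw [← h.sum_proj v]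
    refine Finset.sum_nbij' (fun p => n - p) (fun p => n - p) ?_ ?_ ?_ ?_ ?_ <;>
      simp +contextual
  -- The factor `2` appears because each term of `rankTwo` sums to `A` separately, the second by
  -- skewness.
  have key : (2 : ℂ) • A = ∑ p ∈ Finset.Icc (0 : ℤ) n, ∑ i,
      rankTwo B ((-1) ^ n) (A (π p (b i))) (π (n - p) (b' i)) := by
    ext v
    simp only [sum_apply, rankTwo_apply, Finset.sum_sub_distrib,
      smul_apply]
    have e1 : ∑ p ∈ Finset.Icc (0 : ℤ) n, ∑ i, B (π (n - p) (b' i)) v • A (π p (b i)) = A v := by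
      conv_rhs => rw [← h.sum_proj v, map_sum]
      refine Finset.sum_congr rfl fun p _ => ?_
      conv_rhs => rw [← h.proj_self, ← hb (π p v), map_sum, map_sum]
      refine Finset.sum_congr rfl fun i _ => ?_
      rw [h.adj, sub_sub_cancel, map_smul, map_smul]
    have e2 : ∑ p ∈ Finset.Icc (0 : ℤ) n, ∑ i,
        ((-1) ^ n * B (A (π p (b i))) v) • π (n - p) (b' i) = -A v := by
      conv_rhs => rw [← hsum' (A v), ← Finset.sum_neg_distrib]
      refine Finset.sum_congr rfl fun p _ => ?_
      conv_rhs => rw [← h.proj_self, ← hb' (π (n - p) (A v)), map_sum, ← Finset.sum_neg_distrib]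
      refine Finset.sum_congr rfl fun i _ => ?_
      rw [hA, h.adj, h.symm (b i), map_smul, ← neg_smul]
      congr 1
      linear_combination -B (π (n - p) (A v)) (b i) * h1
    rw [e1, e2, two_smul]
    abel
  have h2 : (2 : ℂ) • A ∈ S := by
    rw [key]
    refine Submodule.sum_mem _ fun p _ => Submodule.sum_mem _ fun i _ => ?_
    rw [← h.sum_proj (A (π p (b i))), rankTwo_sum_left]
    refine Submodule.sum_mem _ fun r _ => ?_
    by_cases hr : π r (A (π p (b i))) = 0
    · rw [hr, rankTwo_zero_left]
      exact zero_mem _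
    · exact hS p r (b i) hr _ _ (h.proj_self _ _) (h.proj_self _ _)
  simpa using S.smul_mem (2⁻¹ : ℂ) h2

theorem depth_le_of_containsComponent (h : IsPolarizedGrading n B π F U)
    {S : Submodule ℂ (V →L[ℂ] V)} {k : ℤ}
    (hS : ∀ p r, r < p → p - r ≤ k → ContainsComponent n B π S p r) :
    lowerSkewDepth B F U k ≤ S := by
  rintro A ⟨⟨hA, hU⟩, hF⟩
  refine h.mem_of_containsComponent hA fun p r v hv => hS p r ?_ ?_
  · by_contra hrp
    have := hU p _ (h.mem_U_of_proj (h.proj_self p v) (lt_add_one p))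
    exact hv ((h.mem_U _ _).1 this r (by omega))
  · by_contra hrp
    have := hF p _ (h.mem_F_of_proj (h.proj_self p v) le_rfl)
    exact hv ((h.mem_F _ _).1 this r (by omega))

theorem lowerSkew_le_of_containsComponent (h : IsPolarizedGrading n B π F U)
    {S : Submodule ℂ (V →L[ℂ] V)}
    (hS : ∀ p r : ℤ, r < p → 0 ≤ r → p ≤ n → ContainsComponent n B π S p r) :
    lowerSkew B U ≤ S := by
  rintro A ⟨hA, hU⟩
  refine h.mem_of_containsComponent hA fun p r v hv => hS p r ?_ ?_ ?_
  · by_contra hrp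
    have := hU p _ (h.mem_U_of_proj (h.proj_self p v) (lt_add_one p))
    exact hv ((h.mem_U _ _).1 this r (by omega))
  · by_contra hr
    exact hv (h.proj_zero r (by omega) _)
  · by_contra hp
    rw [h.proj_zero p (by omega), map_zero, map_zero] at hv
    exact hv rfl

/-! ### Generating the components by brackets -/

section Bracket

variable {S S' : Submodule ℂ (V →L[ℂ] V)}

/-- The commutator of the elements of `(w, y)` and `(z, x)` is the element of `(w, x)` plus a term
with `rankTwo w y x`. The latter is zero, since `x` is orthogonal to `y` by `p + q ≠ n` and to `w`
by `r < p`. -/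
theorem containsComponent_of_bracket (h : IsPolarizedGrading n B π F U)
    (hbr : ∀ X ∈ S, ∀ Y ∈ S, X * Y - Y * X ∈ S') {p q r : ℤ} (hqp : q < p) (hrq : r < q)
    (hpq : ContainsComponent n B π S p q) (hqr : ContainsComponent n B π S q r)
    (hne : p + q ≠ n)
    (hz : ∀ w, π r w = w → w ≠ 0 → ∃ y z, π (n - q) y = y ∧ π q z = z ∧
      rankTwo B ((-1) ^ n) w y z = w) :
    ContainsComponent n B π S' p r := by
  intro w x hw hx
  by_cases hw0 : w = 0
  · rw [hw0, rankTwo_zero_left]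
    exact zero_mem _
  obtain ⟨y, z, hy, hz, hwz⟩ := hz w hw hw0
  have h1 := hbr _ (hqr w y hw hy) _ (hpq z x hz hx)
  rw [commutator_rankTwo (h.rankTwo_mem_skew w y), hwz, rankTwo_apply,
    h.orthogonal hy hx (by omega), h.orthogonal hw hx (by omega)] at h1
  simpa [rankTwo_zero_right] using h1

/-- Because `q + r ≠ n`, the vectors `w` and `z` are orthogonal, so a single nonzero vector `z` of
degree `q` and a partner `y` pairing to `1` suffice. -/
theorem containsComponent_of_ne (h : IsPolarizedGrading n B π F U)
    (hbr : ∀ X ∈ S, ∀ Y ∈ S, X * Y - Y * X ∈ S') {p q r : ℤ} (hqp : q < p) (hrq : r < q)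
    (hpq : ContainsComponent n B π S p q) (hqr : ContainsComponent n B π S q r)
    (hne : p + q ≠ n) (hne' : q + r ≠ n) (hq : ∃ z, π q z = z ∧ z ≠ 0) :
    ContainsComponent n B π S' p r := by
  refine h.containsComponent_of_bracket hbr hqp hrq hpq hqr hne fun w hw _ => ?_
  obtain ⟨z, hz, hz0⟩ := hq
  obtain ⟨y, hy, hzy, -⟩ := h.exists_pairing_eq_one (w := 0) hz (by simpa using hz0)
  refine ⟨((-1) ^ n : ℂ) • y, z, by rw [map_smul, hy], hz, ?_⟩
  have h1 : ((-1 : ℂ) ^ n) * (-1) ^ n = 1 := by rw [← mul_pow]; simp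
  rw [rankTwo_apply, h.orthogonal hw hz (by omega), map_smul, LinearMap.smul_apply,
    h.symm y z, hzy, mul_one, smul_eq_mul, h1]
  simp

/-- Every component is a bracket through a middle degree `q`, if the components of `V` of that
degree are large enough. -/
theorem containsComponent_of_large (h : IsPolarizedGrading n B π F U)
    (hbr : ∀ X ∈ S, ∀ Y ∈ S, X * Y - Y * X ∈ S') {p q r : ℤ} (hqp : q < p) (hrq : r < q)
    (hpq : ContainsComponent n B π S p q) (hqr : ContainsComponent n B π S q r)
    (hq : ∀ q : ℤ, 0 ≤ q → q ≤ n → ∃ z, π q z = z ∧ z ≠ 0)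
    (hl : Odd n ∨ ∀ q : ℤ, 0 ≤ q → q ≤ n → ∀ w, ∃ z, π q z = z ∧ z ∉ Submodule.span ℂ {w}) :
    ContainsComponent n B π S' p r := by
  by_cases hr0 : r < 0
  · intro w x hw hx
    rw [← hw, h.proj_zero r (Or.inl hr0), rankTwo_zero_left]
    exact zero_mem _
  by_cases hpn : (n : ℤ) < p
  · intro w x hw hx
    rw [← hx, h.proj_zero (n - p) (Or.inl (by omega)), rankTwo_zero_right]
    exact zero_mem _
  have key : ∀ p q r : ℤ, 0 ≤ r → q < p → r < q → p ≤ n → ContainsComponent n B π S p q →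
      ContainsComponent n B π S q r → q + r = n → ContainsComponent n B π S' p r := by
    intro p q r hr0 hqp hrq hpn hpq hqr hn
    refine h.containsComponent_of_bracket hbr hqp hrq hpq hqr (by omega) fun w hw hw0 => ?_
    have hqr' : (n : ℤ) - q = r := by omega
    have hrq' : (n : ℤ) - r = q := by omega
    rw [hqr']
    rcases Nat.even_or_odd n with he | ho
    · rcases hl with ho | hl
      · exact absurd he (Nat.not_even_iff_odd.2 ho)
      -- Here `y` and `w` have the same degree and the unwanted term is `B(w, z) y`. Independence of
      -- `y` from `w` allows `B(y, z) = 1` and `B(w, z) = 0`.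
      obtain ⟨y, hy, hyw⟩ := hl r (by omega) (by omega) w
      obtain ⟨z, hz, hyz, hwz⟩ := h.exists_pairing_eq_one hy hyw
      refine ⟨y, z, hy, hrq' ▸ hz, ?_⟩
      rw [rankTwo_apply, hyz, hwz hw]
      simp
    · obtain ⟨z, hz, hwz, -⟩ := h.exists_pairing_eq_one (w := 0) hw (by simpa using hw0)
      -- In the symplectic case the two terms of `rankTwo w w` add up instead of cancelling, so half
      -- of `w` serves as `y` in any dimension.
      refine ⟨(1 / 2 : ℂ) • w, z, by rw [map_smul, hw], hrq' ▸ hz, ?_⟩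
      rw [rankTwo_apply, map_smul, LinearMap.smul_apply, hwz, ho.neg_one_pow]
      module
  by_cases h1 : q + r = n
  · exact key p q r (by omega) hqp hrq (by omega) hpq hqr h1
  by_cases h2 : p + q = n
  -- Duality turns the coincidence `p + q = n` into the one already treated.
  · have := key (n - r) (n - q) (n - p) (by omega) (by omega) (by omega) (by omega)
      (containsComponent_swap hqr) (containsComponent_swap hpq) (by omega)
    simpa using containsComponent_swap this
  · exact h.containsComponent_of_ne hbr hqp hrq hpq hqr h2 h1 (hq q (by omega) (by omega))

end Bracket

/-- An increasing sequence `W` of subspaces with `[W m, W m] ⊆ W (m + 1)`, which starts with the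
infinitesimal isometries of depth `1`. -/
structure IsBracketFlag (B : LinearMap.BilinForm ℂ V) (F U : ℤ → Submodule ℂ V)
    (W : ℕ → Submodule ℂ (V →L[ℂ] V)) : Prop where
  zero : lowerSkewDepth B F U 1 ≤ W 0
  mono : ∀ m, W m ≤ W (m + 1)
  bracket : ∀ m, ∀ X ∈ W m, ∀ Y ∈ W m, X * Y - Y * X ∈ W (m + 1)

variable {W : ℕ → Submodule ℂ (V →L[ℂ] V)}

theorem containsComponent_flag_zero (h : IsPolarizedGrading n B π F U)
    (hW : IsBracketFlag B F U W) {p r : ℤ} (hrp : r < p) (hk : p - r ≤ 1) :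
    ContainsComponent n B π (W 0) p r :=
  fun _ _ hw hx => hW.zero (h.rankTwo_mem_depth hw hx hrp hk)

theorem containsComponent_mono (hW : IsBracketFlag B F U W) {m : ℕ} {p r : ℤ}
    (hm : ContainsComponent n B π (W m) p r) : ContainsComponent n B π (W (m + 1)) p r :=
  fun w x hw hx => hW.mono m (hm w x hw hx)

theorem containsComponent_flag_of_large (h : IsPolarizedGrading n B π F U)
    (hW : IsBracketFlag B F U W)
    (hq : ∀ q : ℤ, 0 ≤ q → q ≤ n → ∃ z, π q z = z ∧ z ≠ 0)
    (hl : Odd n ∨ ∀ q : ℤ, 0 ≤ q → q ≤ n → ∀ w, ∃ z, π q z = z ∧ z ∉ Submodule.span ℂ {w})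
    (m : ℕ) : ∀ p r : ℤ, r < p → p - r ≤ 2 ^ m → ContainsComponent n B π (W m) p r := by
  induction m with
  | zero => exact fun p r hrp hk => h.containsComponent_flag_zero hW hrp (by simpa using hk)
  | succ m ih =>
    intro p r hrp hk
    have h2 : (2 : ℤ) ^ (m + 1) = 2 * 2 ^ m := by ring
    have h1 : (1 : ℤ) ≤ 2 ^ m := one_le_pow₀ (by norm_num)
    by_cases hs : p - r ≤ 2 ^ m
    · exact containsComponent_mono hW (ih p r hrp hs)
    -- Both parts of the gap, `2^m` and the remainder, are at most `2^m`.
    · exact h.containsComponent_of_large (hW.bracket m) (q := r + 2 ^ m) (by omega) (by omega)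
        (ih _ _ (by omega) (by omega)) (ih _ _ (by omega) (by omega)) hq hl

/-- When `p` and `r` lie on one side of `n/2`, no `q` strictly between them satisfies `p + q = n` or
`q + r = n`, so nonzero pieces are enough. -/
theorem containsComponent_flag_of_half (h : IsPolarizedGrading n B π F U)
    (hW : IsBracketFlag B F U W)
    (hq : ∀ q : ℤ, 0 ≤ q → q ≤ n → ∃ z, π q z = z ∧ z ≠ 0) (m : ℕ) :
    ∀ p r : ℤ, r < p → 0 ≤ r → p ≤ n → p - r ≤ 2 ^ m → (n ≤ 2 * r ∨ 2 * p ≤ n) →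
      ContainsComponent n B π (W m) p r := by
  induction m with
  | zero => exact fun p r hrp _ _ hk _ => h.containsComponent_flag_zero hW hrp (by simpa using hk)
  | succ m ih =>
    intro p r hrp hr0 hpn hk hhalf
    have h2 : (2 : ℤ) ^ (m + 1) = 2 * 2 ^ m := by ring
    have h1 : (1 : ℤ) ≤ 2 ^ m := one_le_pow₀ (by norm_num)
    by_cases hs : p - r ≤ 2 ^ m
    · exact containsComponent_mono hW (ih p r hrp hr0 hpn hs hhalf)
    · exact h.containsComponent_of_ne (hW.bracket m) (q := r + 2 ^ m) (by omega) (by omega)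
        (ih _ _ (by omega) (by omega) (by omega) (by omega) (by omega))
        (ih _ _ (by omega) (by omega) (by omega) (by omega) (by omega))
        (by omega) (by omega) (hq _ (by omega) (by omega))

/-- A component across the middle is a bracket through `l = n/2`. No coincidence arises because `p`
and `r` differ from `l`, and each half lies on one side. -/
theorem containsComponent_flag_of_middle (h : IsPolarizedGrading n B π F U)
    (hW : IsBracketFlag B F U W)
    (hq : ∀ q : ℤ, 0 ≤ q → q ≤ n → ∃ z, π q z = z ∧ z ≠ 0) (m : ℕ) {l p r : ℤ}
    (hl : 2 * l = n) (hr0 : 0 ≤ r) (hpn : p ≤ n) (hrl : r < l) (hlp : l < p) (hp : p - l ≤ 2 ^ m)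
    (hr : l - r ≤ 2 ^ m) : ContainsComponent n B π (W (m + 1)) p r :=
  h.containsComponent_of_ne (hW.bracket m) hlp hrl
    (h.containsComponent_flag_of_half hW hq m _ _ hlp (by omega) hpn hp (by omega))
    (h.containsComponent_flag_of_half hW hq m _ _ hrl (by omega) (by omega) hr (by omega))
    (by omega) (by omega) (hq l (by omega) (by omega))

/-- For even `n = 2l` the halves of a component across the middle have length at most `l ≤ 2^(m-1)`,
so the crossing is completed by step `m`. For odd `n` doubling works without restriction. -/
theorem lowerSkew_le_flag (h : IsPolarizedGrading n B π F U)
    (hW : IsBracketFlag B F U W) (hn : 2 ≤ n)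
    (hq : ∀ q : ℤ, 0 ≤ q → q ≤ n → ∃ z, π q z = z ∧ z ≠ 0) {m : ℕ} (hm : n ≤ 2 ^ m) :
    lowerSkew B U ≤ W m := by
  have hm' : (n : ℤ) ≤ 2 ^ m := by exact_mod_cast hm
  refine h.lowerSkew_le_of_containsComponent fun p r hrp hr0 hpn => ?_
  rcases Nat.even_or_odd' n with ⟨l, hl | hl⟩
  · by_cases hhalf : (n : ℤ) ≤ 2 * r ∨ 2 * p ≤ n
    · exact h.containsComponent_flag_of_half hW hq m p r hrp hr0 hpn (by omega) hhalf
    · obtain _ | m := m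
      · omega
      have h2 : (2 : ℤ) ^ (m + 1) = 2 * 2 ^ m := by ring
      exact h.containsComponent_flag_of_middle hW hq m (l := l) (by omega) hr0 hpn (by omega)
        (by omega) (by omega) (by omega)
  · exact h.containsComponent_flag_of_large hW hq (Or.inl ⟨l, hl⟩) m p r hrp (by omega)

theorem depth_le_flag_of_large (h : IsPolarizedGrading n B π F U)
    (hW : IsBracketFlag B F U W)
    (hq : ∀ q : ℤ, 0 ≤ q → q ≤ n → ∃ z, π q z = z ∧ z ≠ 0)
    (hl : Odd n ∨ ∀ q : ℤ, 0 ≤ q → q ≤ n → ∀ w, ∃ z, π q z = z ∧ z ∉ Submodule.span ℂ {w})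
    (m : ℕ) : lowerSkewDepth B F U (2 ^ m) ≤ W m :=
  h.depth_le_of_containsComponent fun p r hrp hk =>
    h.containsComponent_flag_of_large hW hq hl m p r hrp hk

/-- For even `n ≤ 4` only `m = 1` is in question, since `2^m ≥ n` from `m = 2` on. A component of
depth at most `2` across the middle has `r = l - 1` and `p = l + 1`, hence is one bracket through
`l`. -/
theorem depth_le_flag_of_small (h : IsPolarizedGrading n B π F U)
    (hW : IsBracketFlag B F U W) (hn : 2 ≤ n) (hn4 : Odd n ∨ n ≤ 4)
    (hq : ∀ q : ℤ, 0 ≤ q → q ≤ n → ∃ z, π q z = z ∧ z ≠ 0) (m : ℕ) :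
    lowerSkewDepth B F U (2 ^ m) ≤ W m := by
  rcases Nat.even_or_odd' n with ⟨l, hl | hl⟩
  · have hn4 : n ≤ 4 := hn4.resolve_left (Nat.not_odd_iff_even.2 ⟨l, by omega⟩)
    match m with
    | 0 => simpa using hW.zero
    | 1 =>
      refine h.depth_le_of_containsComponent fun p r hrp hk w x hw hx => ?_
      by_cases hr0 : r < 0
      · rw [← hw, h.proj_zero r (Or.inl hr0), rankTwo_zero_left]
        exact zero_mem _
      by_cases hpn : (n : ℤ) < p
      · rw [← hx, h.proj_zero (n - p) (Or.inl (by omega)), rankTwo_zero_right]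
        exact zero_mem _
      by_cases hhalf : (n : ℤ) ≤ 2 * r ∨ 2 * p ≤ n
      · exact h.containsComponent_flag_of_half hW hq 1 p r hrp (by omega) (by omega) hk hhalf
          w x hw hx
      · exact h.containsComponent_flag_of_middle hW hq 0 (l := l) (by omega) (by omega)
          (by omega) (by omega) (by omega) (by omega) (by omega) w x hw hx
    | m + 2 =>
      refine le_trans inf_le_left (h.lowerSkew_le_flag hW hn hq (hn4.trans ?_))
      have : 1 ≤ 2 ^ m := Nat.one_le_two_pow
      rw [pow_add]
      omega
  · exact h.depth_le_flag_of_large hW hq (Or.inl ⟨l, hl⟩) m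

end IsPolarizedGrading

/-- The commutator respects depth. -/
theorem commutator_mem_depth {B : LinearMap.BilinForm ℂ V} {F U : ℤ → Submodule ℂ V}
    (hU : Monotone U) {j k : ℤ} {X Y : V →L[ℂ] V} (hX : X ∈ lowerSkewDepth B F U j)
    (hY : Y ∈ lowerSkewDepth B F U k) : X * Y - Y * X ∈ lowerSkewDepth B F U (j + k) := by
  obtain ⟨⟨hX1, hX2⟩, hX3⟩ := hX
  obtain ⟨⟨hY1, hY2⟩, hY3⟩ := hY
  refine ⟨⟨fun u v => ?_, fun p v hv => ?_⟩, fun p v hv => ?_⟩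
  · simp only [sub_apply, mul_apply_eq_comp, map_sub,
      LinearMap.sub_apply]
    rw [hX1, hY1, hY1, hX1]
    ring
  · exact sub_mem (hX2 p _ (hU (by omega) (hY2 p v hv))) (hY2 p _ (hU (by omega) (hX2 p v hv)))
  · refine sub_mem ?_ ?_
    · have h1 : X (Y v) ∈ F (p - k - j) := hX3 _ _ (hY3 p v hv)
      rwa [sub_sub, add_comm k j] at h1
    · have h1 : Y (X v) ∈ F (p - j - k) := hY3 _ _ (hX3 p v hv)
      rwa [sub_sub] at h1

end Grading
end
end PeriodDomain

namespace PeriodDomain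

noncomputable section

/-! ### The Cayley transform in a ring -/

section CayleyRing

variable {R : Type*} [Ring R] [Algebra ℂ R]

/-- The Cayley transform `(1 + A) (1 - A)⁻¹`. -/
def cayley (A : R) : R := (1 + A) * Ring.inverse (1 - A)

/-- The inverse `(g - 1) (g + 1)⁻¹` of the Cayley transform. -/
def cayleyInv (g : R) : R := (g - 1) * Ring.inverse (g + 1)

theorem cayley_zero : cayley (0 : R) = 1 := by simp [cayley]

theorem cayley_mul {A : R} (h : IsUnit (1 - A)) : cayley A * (1 - A) = 1 + A := by
  rw [cayley, mul_assoc, Ring.inverse_mul_cancel _ h, mul_one]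

theorem cayley_add_one {A : R} (h : IsUnit (1 - A)) :
    cayley A + 1 = (2 : ℂ) • Ring.inverse (1 - A) := by
  have h1 : (1 : R) = (1 - A) * Ring.inverse (1 - A) := (Ring.mul_inverse_cancel _ h).symm
  conv_lhs => rw [cayley]; enter [2]; rw [h1]
  rw [← add_mul, two_smul]
  noncomm_ring

theorem cayley_sub_one {A : R} (h : IsUnit (1 - A)) :
    cayley A - 1 = (2 : ℂ) • (A * Ring.inverse (1 - A)) := by
  have h1 : (1 : R) = (1 - A) * Ring.inverse (1 - A) := (Ring.mul_inverse_cancel _ h).symm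
  conv_lhs => rw [cayley]; enter [2]; rw [h1]
  rw [← sub_mul, two_smul]
  noncomm_ring

theorem isUnit_two_smul {a : R} (h : IsUnit a) : IsUnit ((2 : ℂ) • a) := by
  have h2 : IsUnit (algebraMap ℂ R 2) := (IsUnit.mk0 (2 : ℂ) two_ne_zero).map (algebraMap ℂ R)
  rw [Algebra.smul_def]
  exact h2.mul h

theorem isUnit_cayley_add_one {A : R} (h : IsUnit (1 - A)) : IsUnit (cayley A + 1) := by
  rw [cayley_add_one h]
  exact isUnit_two_smul h.ringInverse

theorem isUnit_cayley {A : R} (h : IsUnit (1 - A)) (h' : IsUnit (1 + A)) : IsUnit (cayley A) :=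
  h'.mul h.ringInverse

theorem cayleyInv_cayley {A : R} (h : IsUnit (1 - A)) : cayleyInv (cayley A) = A := by
  symm
  rw [cayleyInv, Ring.eq_mul_inverse_iff_mul_eq _ _ _ (isUnit_cayley_add_one h),
    cayley_add_one h, cayley_sub_one h, mul_smul_comm]

theorem one_sub_cayleyInv {g : R} (h : IsUnit (g + 1)) :
    1 - cayleyInv g = (2 : ℂ) • Ring.inverse (g + 1) := by
  have h1 : (1 : R) = (g + 1) * Ring.inverse (g + 1) := (Ring.mul_inverse_cancel _ h).symm
  conv_lhs => rw [cayleyInv]; enter [1]; rw [h1]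
  rw [← sub_mul, two_smul]
  noncomm_ring

theorem one_add_cayleyInv {g : R} (h : IsUnit (g + 1)) :
    1 + cayleyInv g = (2 : ℂ) • (g * Ring.inverse (g + 1)) := by
  have h1 : (1 : R) = (g + 1) * Ring.inverse (g + 1) := (Ring.mul_inverse_cancel _ h).symm
  conv_lhs => rw [cayleyInv]; enter [1]; rw [h1]
  rw [← add_mul, two_smul]
  noncomm_ring

theorem isUnit_one_sub_cayleyInv {g : R} (h : IsUnit (g + 1)) : IsUnit (1 - cayleyInv g) := by
  rw [one_sub_cayleyInv h]
  exact isUnit_two_smul h.ringInverse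

theorem cayley_cayleyInv {g : R} (h : IsUnit (g + 1)) : cayley (cayleyInv g) = g := by
  symm
  rw [cayley, Ring.eq_mul_inverse_iff_mul_eq _ _ _ (isUnit_one_sub_cayleyInv h),
    one_sub_cayleyInv h, one_add_cayleyInv h, mul_smul_comm]

end CayleyRing

/-! ### The Cayley transform between skew maps and unipotent isometries -/

section Isometries

variable {V : Type*} [NormedAddCommGroup V] [NormedSpace ℂ V] [FiniteDimensional ℂ V]

theorem isUnit_of_injective {X : V →L[ℂ] V} (h : Function.Injective X) : IsUnit X := by
  have : CompleteSpace V := FiniteDimensional.complete ℂ V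
  rw [ContinuousLinearMap.isUnit_iff_bijective]
  exact ⟨h, (LinearMap.injective_iff_surjective (f := X.toLinearMap)).1 h⟩

theorem injective_of_isUnit {X : V →L[ℂ] V} (h : IsUnit X) : Function.Injective X := by
  have : CompleteSpace V := FiniteDimensional.complete ℂ V
  exact (ContinuousLinearMap.isUnit_iff_bijective.1 h).1

theorem apply_inverse_apply {X : V →L[ℂ] V} (h : IsUnit X) (v : V) :
    X (Ring.inverse X v) = v := by
  have := congrArg (fun Y : V →L[ℂ] V => Y v) (Ring.mul_inverse_cancel _ h)
  simpa using this

theorem inverse_apply_apply {X : V →L[ℂ] V} (h : IsUnit X) (v : V) :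
    Ring.inverse X (X v) = v := by
  have := congrArg (fun Y : V →L[ℂ] V => Y v) (Ring.inverse_mul_cancel _ h)
  simpa using this

theorem map_eq_of_isUnit {X : V →L[ℂ] V} (h : IsUnit X) {K K' : Submodule ℂ V}
    (hK : ∀ v ∈ K, X v ∈ K') (hdim : Module.finrank ℂ K' = Module.finrank ℂ K) :
    K.map X.toLinearMap = K' := by
  refine Submodule.eq_of_le_of_finrank_eq ?_ ?_
  · rintro _ ⟨v, hv, rfl⟩
    exact hK v hv
  · rw [hdim]
    exact (Submodule.equivMapOfInjective X.toLinearMap (injective_of_isUnit h) K).finrank_eq.symm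

/-- In finite dimension an invertible map preserving `K` maps `K` onto itself. -/
theorem inverse_apply_mem {X : V →L[ℂ] V} (h : IsUnit X) {K : Submodule ℂ V}
    (hK : ∀ v ∈ K, X v ∈ K) : ∀ v ∈ K, Ring.inverse X v ∈ K := by
  intro v hv
  rw [← map_eq_of_isUnit h hK rfl] at hv
  obtain ⟨w, hw, rfl⟩ := hv
  change Ring.inverse X (X w) ∈ K
  rwa [inverse_apply_apply h]

variable {B : LinearMap.BilinForm ℂ V} {U : ℤ → Submodule ℂ V}

/-- The isometries of `B` which are unipotent with respect to `U`. -/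
structure IsUnipotentIsometry (B : LinearMap.BilinForm ℂ V) (U : ℤ → Submodule ℂ V)
    (g : V →L[ℂ] V) : Prop where
  isometry : ∀ u v, B (g u) (g v) = B u v
  lower : ∀ p, ∀ v ∈ U (p + 1), g v - v ∈ U p

theorem one_sub_apply_mem (hU : Monotone U) {A : V →L[ℂ] V} (hA : A ∈ lowerSkew B U) :
    ∀ p, ∀ v ∈ U p, (1 - A) v ∈ U p := by
  intro p v hv
  refine sub_mem hv ?_
  have := hA.2 (p - 1) v (by simpa using hv)
  exact hU (by omega) this

theorem one_add_apply_mem (hU : Monotone U) {A : V →L[ℂ] V} (hA : A ∈ lowerSkew B U) :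
    ∀ p, ∀ v ∈ U p, (1 + A) v ∈ U p := by
  intro p v hv
  refine add_mem hv ?_
  have := hA.2 (p - 1) v (by simpa using hv)
  exact hU (by omega) this

/-- Substituting `(1 - A) u` for the argument, isometry says that `1 + A` and `1 - A` pull `B` back
to the same form, which is skewness. Unipotence follows from `cayley A - 1 = 2 A (1 - A)⁻¹`. -/
theorem isUnipotentIsometry_cayley (hU : Monotone U) {A : V →L[ℂ] V} (hA : A ∈ lowerSkew B U)
    (h : IsUnit (1 - A)) : IsUnipotentIsometry B U (cayley A) := by
  constructor
  · intro u v
    have hc : ∀ u, cayley A ((1 - A) u) = u + A u := fun u => by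
      have := congrArg (fun Y : V →L[ℂ] V => Y u) (cayley_mul h)
      simpa using this
    rw [← apply_inverse_apply h u, ← apply_inverse_apply h v, hc, hc]
    generalize Ring.inverse (1 - A) u = u
    generalize Ring.inverse (1 - A) v = v
    have h1 : ∀ u v, B (A u) v = -B u (A v) := hA.1
    simp only [sub_apply, one_apply_eq_self, map_add, map_sub, LinearMap.add_apply, LinearMap.sub_apply, h1]
    ring
  · intro p v hv
    have h1 := congrArg (fun Y : V →L[ℂ] V => Y v) (cayley_sub_one h)
    simp only [sub_apply, smul_apply, mul_apply_eq_comp] at h1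
    have h2 : cayley A v - v = (2 : ℂ) • A (Ring.inverse (1 - A) v) := h1
    rw [h2]
    exact Submodule.smul_mem _ _ (hA.2 p _ (inverse_apply_mem h (one_sub_apply_mem hU hA _) v hv))

theorem IsUnipotentIsometry.apply_mem (hU : Monotone U) {g : V →L[ℂ] V}
    (hg : IsUnipotentIsometry B U g) : ∀ p, ∀ v ∈ U p, g v ∈ U p := by
  intro p v hv
  have h1 := hU (sub_le_self p zero_le_one) (hg.lower (p - 1) v (by simpa using hv))
  simpa using add_mem h1 hv

theorem IsUnipotentIsometry.isUnit (hB : ∀ u, (∀ v, B u v = 0) → u = 0) {g : V →L[ℂ] V}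
    (hg : IsUnipotentIsometry B U g) : IsUnit g := by
  refine isUnit_of_injective ((injective_iff_map_eq_zero g).2 fun u hu => hB u fun v => ?_)
  rw [← hg.isometry, hu, map_zero, LinearMap.zero_apply]

/-- On vectors `(g + 1) u` the transform takes the value `g u - u`, from which both conditions can
be read off. -/
theorem cayleyInv_mem (hU : Monotone U) {g : V →L[ℂ] V} (hg : IsUnipotentIsometry B U g)
    (h : IsUnit (g + 1)) : cayleyInv g ∈ lowerSkew B U := by
  have hc : ∀ u, cayleyInv g ((g + 1) u) = g u - u := fun u => by
    have h1 : cayleyInv g * (g + 1) = g - 1 := by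
      rw [cayleyInv, mul_assoc, Ring.inverse_mul_cancel _ h, mul_one]
    have := congrArg (fun Y : V →L[ℂ] V => Y u) h1
    simpa using this
  constructor
  · intro u v
    rw [← apply_inverse_apply h u, ← apply_inverse_apply h v, hc, hc]
    generalize Ring.inverse (g + 1) u = u
    generalize Ring.inverse (g + 1) v = v
    simp only [add_apply, one_apply_eq_self, map_add, map_sub, LinearMap.add_apply,
      LinearMap.sub_apply, hg.isometry]
    ring
  · intro p v hv
    have h1 : ∀ v ∈ U (p + 1), (g + 1) v ∈ U (p + 1) := fun v hv =>
      add_mem (hg.apply_mem hU _ v hv) hv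
    have h2 := inverse_apply_mem h h1 v hv
    rw [← apply_inverse_apply h v, hc]
    exact hg.lower p _ h2

end Isometries

/-! ### Isotropic filtrations and unipotent isometries -/

section Flags

variable {V : Type*} [NormedAddCommGroup V] [NormedSpace ℂ V] [FiniteDimensional ℂ V]

/-- A pair of complementary filtrations, both isotropic for the `(-1)^n`-symmetric form `B`. -/
structure IsIsotropicPair (n : ℕ) (B : LinearMap.BilinForm ℂ V) (F U : ℤ → Submodule ℂ V) :
    Prop where
  nondeg : ∀ u, (∀ v, B u v = 0) → u = 0
  symm : ∀ u v, B u v = (-1) ^ n * B v u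
  antitone : Antitone F
  monotone : Monotone U
  isCompl : ∀ p, IsCompl (F p) (U p)
  eq_top : ∀ p, p ≤ 0 → F p = ⊤
  eq_bot : ∀ p : ℤ, n < p → F p = ⊥
  isotropic_F : ∀ p, ∀ u ∈ F p, ∀ v ∈ F (n - p + 1), B u v = 0
  isotropic_U : ∀ p, ∀ u ∈ U p, ∀ v ∈ U (n - p + 1), B u v = 0

theorem sum_sub_succ (f : ℤ → V) (n : ℕ) :
    ∑ p ∈ Finset.Icc (0 : ℤ) n, (f p - f (p + 1)) = f 0 - f (n + 1) := by
  induction n with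
  | zero => simp
  | succ n ih =>
    have h : Finset.Icc (0 : ℤ) ((n + 1 : ℕ) : ℤ) =
        insert ((n : ℤ) + 1) (Finset.Icc (0 : ℤ) n) := by
      ext p
      simp only [Finset.mem_Icc, Finset.mem_insert]
      omega
    rw [h, Finset.sum_insert (by simp), ih]
    push_cast
    abel

/-- The projections to the pieces `F p ∩ U (p + 1)`. -/
def gradingProj (F U : ℤ → Submodule ℂ V) (hc : ∀ p, IsCompl (F p) (U p)) (p : ℤ) :
    V →ₗ[ℂ] V :=
  (F p).projection (U p) (hc p) - (F (p + 1)).projection (U (p + 1)) (hc (p + 1))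

/-- The projections `P p` onto `F p` along `U p` satisfy `P p ∘ P q = P (max p q)`, so their
consecutive differences are orthogonal idempotents with telescoping sum. Isotropy of both
filtrations makes `1 - P (n - p + 1)` the adjoint of `P p`. -/
theorem IsIsotropicPair.isPolarizedGrading {n : ℕ} {B : LinearMap.BilinForm ℂ V}
    {F U : ℤ → Submodule ℂ V} (h : IsIsotropicPair n B F U) :
    IsPolarizedGrading n B (gradingProj F U h.isCompl) F U := by
  let P : ℤ → V →ₗ[ℂ] V := fun p => (F p).projection (U p) (h.isCompl p)
  have hP : ∀ p v, gradingProj F U h.isCompl p v = P p v - P (p + 1) v := fun p v => rfl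
  have hPF : ∀ p v, P p v ∈ F p := fun p v => Submodule.projection_apply_mem _ _
  have hPU : ∀ p v, v - P p v ∈ U p := fun p v => Submodule.sub_projection_mem _ _
  have hfix : ∀ p v, v ∈ F p ↔ P p v = v := fun p v =>
    (Submodule.projection_eq_self_iff (h.isCompl p) v).symm
  have hker : ∀ p v, v ∈ U p ↔ P p v = 0 := fun p v =>
    (Submodule.projection_apply_eq_zero_iff (h.isCompl p)).symm
  have hle : ∀ p q v, p ≤ q → P p (P q v) = P q v := fun p q v hpq =>
    (hfix p _).1 (h.antitone hpq (hPF q v))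
  have hge : ∀ p q v, p ≤ q → P q (P p v) = P q v := by
    intro p q v hpq
    have h1 := (hker q _).1 (h.monotone hpq (hPU p v))
    rw [map_sub, sub_eq_zero] at h1
    exact h1.symm
  have htop : ∀ p v, p ≤ 0 → P p v = v := fun p v hp => by
    rw [← hfix, h.eq_top p hp]
    trivial
  have hbot : ∀ (p : ℤ) v, n < p → P p v = 0 := fun p v hp => by
    have := hPF p v
    rwa [h.eq_bot p hp, Submodule.mem_bot] at this
  have hadj : ∀ (p q : ℤ) u v, p + q = n + 1 → B (P p u) v = B u (v - P q v) := by
    intro p q u v hpq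
    obtain rfl : q = n - p + 1 := by omega
    have h1 := h.isotropic_F p _ (hPF p u) _ (hPF (n - p + 1) v)
    have h2 := h.isotropic_U p _ (hPU p u) _ (hPU (n - p + 1) v)
    simp only [map_sub, LinearMap.sub_apply] at h2 ⊢
    linear_combination h1 - h2
  refine ⟨h.nondeg, h.symm, ?_, ?_, ?_, ?_, ?_, ?_, ?_⟩
  · intro p v
    simp only [hP, map_sub]
    rw [hle p p v le_rfl, hle (p + 1) (p + 1) v le_rfl, hle p (p + 1) v (by omega),
      hge p (p + 1) v (by omega)]
    abel
  · intro p q v hpq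
    simp only [hP, map_sub]
    rcases lt_or_gt_of_ne hpq with hlt | hlt
    · rw [hle p q v (by omega), hle p (q + 1) v (by omega), hle (p + 1) q v (by omega),
        hle (p + 1) (q + 1) v (by omega)]
      abel
    · rw [hge q p v (by omega), hge (q + 1) p v (by omega), hge q (p + 1) v (by omega),
        hge (q + 1) (p + 1) v (by omega)]
      abel
  · intro v
    simp only [hP]
    rw [sum_sub_succ (fun p => P p v), htop 0 v le_rfl, hbot _ v (by omega), sub_zero]
  · intro p v
    constructor
    · intro hv q hq
      rw [hP, (hfix q v).1 (h.antitone hq.le hv), (hfix (q + 1) v).1 (h.antitone (by omega) hv),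
        sub_self]
    · intro hv
      rw [hfix]
      by_cases hp : p ≤ 0
      · exact htop p v hp
      obtain ⟨k, rfl⟩ := Int.eq_ofNat_of_zero_le (by omega : 0 ≤ p)
      clear hp
      induction k with
      | zero => exact htop _ v (by simp)
      | succ k ih =>
        have h1 := hv k (by push_cast; omega)
        rw [hP, ih fun q hq => hv q (by push_cast; omega), sub_eq_zero] at h1
        push_cast
        exact h1.symm
  · intro p v
    constructor
    · intro hv q hq
      rw [hP, (hker q v).1 (h.monotone hq hv), (hker (q + 1) v).1 (h.monotone (by omega) hv),
        sub_self]
    · intro hv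
      rw [hker]
      have key : ∀ k : ℕ, ∀ p, (n : ℤ) < p + k → (∀ q ≥ p, gradingProj F U h.isCompl q v = 0) →
          P p v = 0 := by
        intro k
        induction k with
        | zero => exact fun p hp _ => hbot p v (by simpa using hp)
        | succ k ih =>
          intro p hp hv
          have h1 := hv p le_rfl
          rw [hP, ih (p + 1) (by push_cast at hp; omega) fun q hq => hv q (by omega),
            sub_zero] at h1
          exact h1
      exact key (n + 1 - p).toNat p (by omega) hv
  · intro p hp v
    rw [hP]
    rcases hp with hp | hp
    · rw [htop p v hp.le, htop (p + 1) v (by omega), sub_self]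
    · rw [hbot p v hp, hbot (p + 1) v (by omega), sub_self]
  · intro p u v
    rw [hP, hP, map_sub, LinearMap.sub_apply, hadj p (n - p + 1) u v (by omega),
      hadj (p + 1) (n - p) u v (by omega)]
    simp only [map_sub]
    ring

theorem IsIsotropicPair.isotropic_U_of_le {n : ℕ} {B : LinearMap.BilinForm ℂ V}
    {F U : ℤ → Submodule ℂ V} (h : IsIsotropicPair n B F U) {a b : ℤ} (hab : a + b ≤ n + 1)
    {u v : V} (hu : u ∈ U a) (hv : v ∈ U b) : B u v = 0 :=
  h.isotropic_U a u hu v (h.monotone (by omega) hv)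

/-- The image of a filtration. -/
def mapFlag (g : V →L[ℂ] V) (F : ℤ → Submodule ℂ V) (p : ℤ) : Submodule ℂ V :=
  (F p).map g.toLinearMap

open Classical in
/-- The projection to `F` along `U`, and zero if these spaces are not complementary. -/
def projAlong (F U : Submodule ℂ V) : V →L[ℂ] V :=
  if h : IsCompl F U then LinearMap.toContinuousLinearMap (F.projection U h) else 0

theorem projAlong_eq {F U : Submodule ℂ V} (h : IsCompl F U) {v w : V} (hw : w ∈ F)
    (hvw : v - w ∈ U) : projAlong F U v = w := by
  rw [projAlong, dif_pos h]
  have h1 := (Submodule.projection_apply_eq_zero_iff h).2 hvw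
  rw [map_sub, (Submodule.projection_eq_self_iff h w).2 hw, sub_eq_zero] at h1
  exact h1

theorem projAlong_mem {F U : Submodule ℂ V} (h : IsCompl F U) (v : V) : projAlong F U v ∈ F := by
  rw [projAlong, dif_pos h]
  exact Submodule.projection_apply_mem _ _

theorem projAlong_sub_mem {F U : Submodule ℂ V} (h : IsCompl F U) (v : V) :
    projAlong F U v - v ∈ U := by
  rw [projAlong, dif_pos h, ← neg_sub]
  exact neg_mem (Submodule.sub_projection_mem _ _)

/-- For a filtration `F'` complementary to `U`, the linear map `g` which is unipotent with respect
to `U` and maps the filtration of the grading `π` to `F'`. -/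
def flagSection (n : ℕ) (π : ℤ → V →ₗ[ℂ] V) (U F' : ℤ → Submodule ℂ V) : V →L[ℂ] V :=
  ∑ p ∈ Finset.Icc (0 : ℤ) n, projAlong (F' p) (U p) * LinearMap.toContinuousLinearMap (π p)

theorem flagSection_apply (n : ℕ) (π : ℤ → V →ₗ[ℂ] V) (U F' : ℤ → Submodule ℂ V) (v : V) :
    flagSection n π U F' v = ∑ p ∈ Finset.Icc (0 : ℤ) n, projAlong (F' p) (U p) (π p v) := by
  simp [flagSection]

variable {n : ℕ} {B : LinearMap.BilinForm ℂ V} {F U : ℤ → Submodule ℂ V}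

theorem isCompl_mapFlag (h : IsIsotropicPair n B F U) {g : V →L[ℂ] V}
    (hg : IsUnipotentIsometry B U g) (p : ℤ) : IsCompl (mapFlag g F p) (U p) := by
  have hu := hg.isUnit h.nondeg
  have h1 : (U p).map g.toLinearMap = U p :=
    map_eq_of_isUnit hu (hg.apply_mem h.monotone p) rfl
  rw [← h1]
  let e : V ≃ₗ[ℂ] V := LinearEquiv.ofInjectiveEndo g.toLinearMap (injective_of_isUnit hu)
  exact (Submodule.orderIsoMapComap e).isCompl (h.isCompl p)

/-- For `v` of degree `p` one has `g v ∈ gF p` and `g v - v ∈ U p`, so `g v` is the projection of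
`v` along `U p`: a unipotent isometry is recovered from the image of `F`. -/
theorem flagSection_mapFlag (h : IsIsotropicPair n B F U) {g : V →L[ℂ] V}
    (hg : IsUnipotentIsometry B U g) :
    flagSection n (gradingProj F U h.isCompl) U (mapFlag g F) = g := by
  have hπ := h.isPolarizedGrading
  ext v
  rw [flagSection_apply]
  conv_rhs => rw [← hπ.sum_proj v, map_sum]
  refine Finset.sum_congr rfl fun p _ => projAlong_eq (isCompl_mapFlag h hg p) ?_ ?_
  · exact Submodule.mem_map_of_mem (hπ.mem_F_of_proj (hπ.proj_self p v) le_rfl)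
  · rw [← neg_sub]
    exact neg_mem (hg.lower p _ (hπ.mem_U_of_proj (hπ.proj_self p v) (lt_add_one p)))

variable {F' : ℤ → Submodule ℂ V}

theorem flagSection_mem (h : IsIsotropicPair n B F U) (hF' : Antitone F')
    (hc : ∀ p, IsCompl (F' p) (U p)) {p : ℤ} {v : V} (hv : v ∈ F p) :
    flagSection n (gradingProj F U h.isCompl) U F' v ∈ F' p := by
  have hπ := h.isPolarizedGrading
  rw [flagSection_apply]
  refine Submodule.sum_mem _ fun q _ => ?_
  by_cases hq : q < p
  · rw [(hπ.mem_F p v).1 hv q hq, map_zero]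
    exact zero_mem _
  · exact hF' (by omega) (projAlong_mem (hc q) _)

/-- On degrees `p`, `q` with `p + q > n` both pairings vanish, by orthogonality and isotropy of
`F'`. If `p + q ≤ n`, the corrections lie in `U p` and `U q` and pair to zero by isotropy of `U`. -/
theorem isUnipotentIsometry_flagSection (h : IsIsotropicPair n B F U) (hF' : Antitone F')
    (hiso : ∀ p, ∀ u ∈ F' p, ∀ v ∈ F' (n - p + 1), B u v = 0)
    (hc : ∀ p, IsCompl (F' p) (U p)) :
    IsUnipotentIsometry B U (flagSection n (gradingProj F U h.isCompl) U F') := by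
  have hπ := h.isPolarizedGrading
  constructor
  · intro u v
    rw [flagSection_apply, flagSection_apply]
    conv_rhs => rw [← hπ.sum_proj u, ← hπ.sum_proj v]
    simp only [map_sum, LinearMap.sum_apply]
    refine Finset.sum_congr rfl fun q _ => Finset.sum_congr rfl fun p _ => ?_
    have hu := hπ.proj_self p u
    have hv := hπ.proj_self q v
    generalize gradingProj F U h.isCompl p u = u at *
    generalize gradingProj F U h.isCompl q v = v at *
    by_cases hpq : n < p + q
    · rw [hπ.orthogonal hu hv (by omega)]
      exact hiso p _ (projAlong_mem (hc p) u) _ (hF' (by omega) (projAlong_mem (hc q) v))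
    · have hcu := projAlong_sub_mem (hc p) u
      have hcv := projAlong_sub_mem (hc q) v
      have h1 := h.isotropic_U_of_le (by omega) (hπ.mem_U_of_proj hu (lt_add_one p)) hcv
      have h2 := h.isotropic_U_of_le (by omega) hcu (hπ.mem_U_of_proj hv (lt_add_one q))
      have h3 := h.isotropic_U_of_le (by omega) hcu hcv
      simp only [map_sub, LinearMap.sub_apply] at h1 h2 h3
      linear_combination h1 + h2 + h3
  · intro q v hv
    rw [flagSection_apply]
    have e : ∑ p ∈ Finset.Icc (0 : ℤ) n,
        projAlong (F' p) (U p) (gradingProj F U h.isCompl p v) - v =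
        ∑ p ∈ Finset.Icc (0 : ℤ) n, (projAlong (F' p) (U p) (gradingProj F U h.isCompl p v) -
          gradingProj F U h.isCompl p v) := by
      rw [Finset.sum_sub_distrib, hπ.sum_proj]
    rw [e]
    refine Submodule.sum_mem _ fun p _ => ?_
    by_cases hp : q + 1 ≤ p
    · rw [(hπ.mem_U (q + 1) v).1 hv p hp, map_zero, sub_zero]
      exact zero_mem _
    · exact h.monotone (by omega) (projAlong_sub_mem (hc p) _)

/-- The image of `F p` lies in `F' p`, and both have the dimension of a complement of `U p`. -/
theorem mapFlag_flagSection (h : IsIsotropicPair n B F U) (hF' : Antitone F')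
    (hiso : ∀ p, ∀ u ∈ F' p, ∀ v ∈ F' (n - p + 1), B u v = 0)
    (hc : ∀ p, IsCompl (F' p) (U p)) :
    mapFlag (flagSection n (gradingProj F U h.isCompl) U F') F = F' := by
  funext p
  refine map_eq_of_isUnit ((isUnipotentIsometry_flagSection h hF' hiso hc).isUnit h.nondeg)
    (fun v hv => flagSection_mem h hF' hc hv) ?_
  have h1 := Submodule.finrank_add_eq_of_isCompl (hc p)
  have h2 := Submodule.finrank_add_eq_of_isCompl (h.isCompl p)
  omega

end Flags
end
end PeriodDomain

namespace PeriodDomain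

noncomputable section

/-! ### Holomorphic families of filtrations and the Cayley chart -/

section Chart

open Filter Topology

variable {E : Type*} [NormedAddCommGroup E] [NormedSpace ℂ E]
variable {V : Type*} [NormedAddCommGroup V] [NormedSpace ℂ V] [FiniteDimensional ℂ V]
  [CompleteSpace V]

theorem holomorphicNear_iff {s : E → V} {x : E} : HolomorphicNear s x ↔ AnalyticAt ℂ s x := by
  constructor
  · intro h
    let b := Module.finBasis ℂ V
    have h1 : s = fun y => ∑ i, b.coord i (s y) • b i := by
      funext y
      exact (b.sum_repr (s y)).symm
    rw [h1]
    exact Finset.analyticAt_fun_sum _ fun i _ => (h (b.coord i)).smul analyticAt_const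
  · exact fun h l => ((LinearMap.toContinuousLinearMap l).analyticAt _).comp h

theorem differential_apply {s : E → V} {x : E} (h : AnalyticAt ℂ s x) (v : E) :
    differential s x v = fderiv ℂ s x v := by
  have h1 : ∀ i, fderiv ℂ (fun y => (Module.finBasis ℂ V).coord i (s y)) x v =
      (Module.finBasis ℂ V).coord i (fderiv ℂ s x v) := by
    intro i
    have := ((LinearMap.toContinuousLinearMap ((Module.finBasis ℂ V).coord i)).hasFDerivAt.comp x
      h.differentiableAt.hasFDerivAt).fderiv
    exact congrArg (fun f => f v) this
  rw [differential, LinearMap.sum_apply]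
  simp only [LinearMap.smulRight_apply, ContinuousLinearMap.coe_coe, h1]
  exact (Module.finBasis ℂ V).sum_repr _

theorem analyticAt_inverse_comp {R : Type*} [NormedRing R] [NormedAlgebra ℂ R] [CompleteSpace R]
    {X : E → R} {x : E} (hX : AnalyticAt ℂ X x)
    (h : IsUnit (X x)) : AnalyticAt ℂ (fun y => Ring.inverse (X y)) x := by
  obtain ⟨u, hu⟩ := h
  exact AnalyticAt.comp (hu ▸ analyticAt_inverse (𝕜 := ℂ) u) hX

theorem eventually_isUnit {R : Type*} [NormedRing R] [CompleteSpace R] {X : E → R} {x : E}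
    (hX : ContinuousAt X x) (h : IsUnit (X x)) : ∀ᶠ y in 𝓝 x, IsUnit (X y) :=
  hX.eventually (Units.isOpen.mem_nhds h)

theorem analyticAt_apply {X : E → V →L[ℂ] V} {x : E} (hX : AnalyticAt ℂ X x) {s : E → V}
    (hs : AnalyticAt ℂ s x) : AnalyticAt ℂ (fun y => X y (s y)) x :=
  ((ContinuousLinearMap.apply ℂ V).flip.analyticAt_bilinear (X x, s x)).comp₂ hX hs

theorem analyticAt_cayley {A : E → V →L[ℂ] V} {x : E} (hA : AnalyticAt ℂ A x)
    (h : IsUnit (1 - A x)) : AnalyticAt ℂ (fun y => cayley (A y)) x :=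
  (analyticAt_const.add hA).mul (analyticAt_inverse_comp (analyticAt_const.sub hA) h)

theorem isHolomorphicSubbundleAt_map {g : E → V →L[ℂ] V} {x : E} (hg : AnalyticAt ℂ g x)
    (hu : IsUnit (g x)) (K : Submodule ℂ V) :
    IsHolomorphicSubbundleAt (fun y => K.map (g y).toLinearMap) x := by
  obtain ⟨r, b, hb, hspan⟩ := exists_frame K
  refine ⟨r, fun i y => g y (b i), fun i => ?_, ?_⟩
  · exact holomorphicNear_iff.2 (analyticAt_apply hg analyticAt_const)
  · filter_upwards [eventually_isUnit hg.continuousAt hu] with y hy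
    refine ⟨hb.map' (g y).toLinearMap (LinearMap.ker_eq_bot.2 (injective_of_isUnit hy)), ?_⟩
    rw [← hspan, Submodule.map_span, ← Set.range_comp]
    rfl

/-- A holomorphic family of subspaces is moved by a holomorphic family of automorphisms, which
can be chosen to fix a given complement. -/
theorem exists_moving_frame {f : E → Submodule ℂ V} {x : E} (hf : IsHolomorphicSubbundleAt f x)
    {K : Submodule ℂ V} (hK : IsCompl (f x) K) :
    ∃ M : E → V →L[ℂ] V, AnalyticAt ℂ M x ∧ IsUnit (M x) ∧
      ∀ᶠ y in 𝓝 x, (∀ v ∈ K, M y v = v) ∧ f y = (f x).map (M y).toLinearMap := by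
  obtain ⟨r, s, hs, hspan⟩ := hf
  obtain ⟨hli, hfx⟩ := hspan.self_of_nhds
  let b : Module.Basis (Fin r) ℂ (f x) :=
    (Module.Basis.span hli).map (LinearEquiv.ofEq _ _ hfx.symm)
  have hb : ∀ i, (b i : V) = s i x := fun i => by simp [b, Module.Basis.span_apply]
  let P : V →L[ℂ] V := LinearMap.toContinuousLinearMap ((f x).projection K hK)
  let c : Fin r → V →L[ℂ] ℂ := fun i =>
    LinearMap.toContinuousLinearMap (b.coord i ∘ₗ (f x).projectionOnto K hK)
  -- This is the identity on `K` and sends the frame at `x` to the frame at `y`.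
  let M : E → V →L[ℂ] V := fun y => (1 - P) + ∑ i, (c i).smulRight (s i y)
  have hMapp : ∀ y v, M y v = v - P v + ∑ i, c i v • s i y := fun y v => by
    simp [M]
  have hMK : ∀ y, ∀ v ∈ K, M y v = v := by
    intro y v hv
    have h1 : (f x).projectionOnto K hK v = 0 := (Submodule.projectionOnto_apply_eq_zero_iff hK).2 hv
    have h2 : P v = 0 := (Submodule.projection_apply_eq_zero_iff hK).2 hv
    rw [hMapp, h2]
    simp [c, h1]
  have hMb : ∀ y i, M y (b i) = s i y := by
    intro y i
    have h1 : (f x).projectionOnto K hK (b i) = b i := Submodule.projectionOnto_apply_left hK _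
    have h2 : P (b i) = b i := (Submodule.projection_eq_self_iff hK _).2 (b i).2
    rw [hMapp, h2]
    simp [c, h1, Finsupp.single_apply]
  have hMx : M x = 1 := by
    have h1 : ∀ v ∈ f x, M x v = v := by
      intro v hv
      have h2 : ∀ w : f x, (M x).toLinearMap.comp (f x).subtype w = (f x).subtype w := by
        intro w
        refine LinearMap.congr_fun (b.ext fun i => ?_) w
        change M x (b i) = b i
        rw [hMb, hb]
      exact h2 ⟨v, hv⟩
    ext v
    have h3 := Submodule.sub_projection_mem hK v
    have h4 := Submodule.projection_apply_mem hK v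
    rw [← sub_add_cancel v ((f x).projection K hK v), map_add, hMK x _ h3, h1 _ h4]
    rfl
  refine ⟨M, ?_, hMx ▸ isUnit_one, ?_⟩
  · refine analyticAt_const.add (Finset.analyticAt_fun_sum _ fun i _ => ?_)
    exact ((ContinuousLinearMap.smulRightL ℂ V V (c i)).analyticAt _).comp
      (holomorphicNear_iff.1 (hs i))
  · filter_upwards [hspan] with y hy
    refine ⟨hMK y, ?_⟩
    have h1 : Submodule.span ℂ (Set.range fun i => (b i : V)) = f x := by
      simp only [hb]
      exact hfx.symm
    rw [← h1, hy.2, Submodule.map_span, ← Set.range_comp]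
    congr 2
    funext i
    exact (hMb y i).symm

theorem isCompl_map_of_fixes {F K : Submodule ℂ V} (h : IsCompl F K) {M : V →L[ℂ] V}
    (hM : IsUnit M) (hMK : ∀ v ∈ K, M v = v) : IsCompl (F.map M.toLinearMap) K := by
  have h1 : K.map M.toLinearMap = K :=
    map_eq_of_isUnit hM (fun v hv => by rwa [hMK v hv]) rfl
  let e : V ≃ₗ[ℂ] V := LinearEquiv.ofInjectiveEndo M.toLinearMap (injective_of_isUnit hM)
  have h2 : IsCompl (F.map M.toLinearMap) (K.map M.toLinearMap) :=
    (Submodule.orderIsoMapComap e).isCompl h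
  rwa [h1] at h2

/-- Conjugating the projection at `x` by a moving frame that fixes `K` gives the projection at
nearby points. -/
theorem analyticAt_projAlong {f : E → Submodule ℂ V} {x : E} (hf : IsHolomorphicSubbundleAt f x)
    {K : Submodule ℂ V} (hK : IsCompl (f x) K) :
    (∀ᶠ y in 𝓝 x, IsCompl (f y) K) ∧ AnalyticAt ℂ (fun y => projAlong (f y) K) x := by
  obtain ⟨M, hM, hMx, hMy⟩ := exists_moving_frame hf hK
  have h1 : ∀ᶠ y in 𝓝 x, IsCompl (f y) K := by
    filter_upwards [hMy, eventually_isUnit hM.continuousAt hMx] with y hy hu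
    rw [hy.2]
    exact isCompl_map_of_fixes hK hu hy.1
  refine ⟨h1, ?_⟩
  have h2 : AnalyticAt ℂ (fun y => M y * projAlong (f x) K * Ring.inverse (M y)) x :=
    (hM.mul analyticAt_const).mul (analyticAt_inverse_comp hM hMx)
  refine h2.congr ?_
  filter_upwards [h1, hMy, eventually_isUnit hM.continuousAt hMx] with y hc hy hu
  ext v
  refine (projAlong_eq hc ?_ ?_).symm
  · rw [hy.2]
    exact Submodule.mem_map_of_mem (projAlong_mem hK _)
  · have h3 := projAlong_sub_mem hK (Ring.inverse (M y) v)
    have h4 := hy.1 _ h3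
    rw [map_sub, apply_inverse_apply hu] at h4
    rw [← neg_sub, mul_apply_eq_comp, mul_apply_eq_comp, h4]
    exact neg_mem h3

variable {n : ℕ} {B : LinearMap.BilinForm ℂ V} {F U : ℤ → Submodule ℂ V}

theorem analyticAt_flagSection (π : ℤ → V →ₗ[ℂ] V) {f : E → ℤ → Submodule ℂ V} {x : E}
    (hf : ∀ p, IsHolomorphicSubbundleAt (fun y => f y p) x) (hc : ∀ p, IsCompl (f x p) (U p)) :
    AnalyticAt ℂ (fun y => flagSection n π U (f y)) x :=
  Finset.analyticAt_fun_sum _ fun p _ =>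
    (analyticAt_projAlong (hf p) (hc p)).2.mul analyticAt_const

/-- A linear retraction to a subspace. -/
theorem exists_retraction {M : Type*} [NormedAddCommGroup M] [NormedSpace ℂ M]
    [FiniteDimensional ℂ M] (K : Submodule ℂ M) :
    ∃ r : M →L[ℂ] K, ∀ a (ha : a ∈ K), r a = ⟨a, ha⟩ := by
  obtain ⟨r, hr⟩ := K.subtype.exists_leftInverse_of_injective K.ker_subtype
  exact ⟨LinearMap.toContinuousLinearMap r, fun a ha => LinearMap.congr_fun hr ⟨a, ha⟩⟩

/-- The Cayley chart of a set `D` of isotropic filtrations which contains all filtrations of the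
orbit of `F` near `F`. -/
theorem exists_cayleyChart (h : IsIsotropicPair n B F U) {D : Set (ℤ → Submodule ℂ V)}
    (hanti : ∀ F' ∈ D, Antitone F') (htop : ∀ F' ∈ D, ∀ p, p ≤ 0 → F' p = ⊤)
    (hbot : ∀ F' ∈ D, ∀ p : ℤ, n < p → F' p = ⊥)
    (hiso : ∀ F' ∈ D, ∀ p, ∀ u ∈ F' p, ∀ v ∈ F' (n - p + 1), B u v = 0)
    (hnear : ∀ᶠ A in 𝓝 (0 : V →L[ℂ] V), A ∈ lowerSkew B U → mapFlag (cayley A) F ∈ D) :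
    ∃ (d : ℕ) (c : HolomorphicChart D d) (L : (Fin d → ℂ) ≃L[ℂ] lowerSkew B U),
      0 ∈ c.source ∧ (∀ z, c.toFun z = mapFlag (cayley (L z : V →L[ℂ] V)) F) ∧
      ∀ z ∈ c.source, IsUnit (1 - (L z : V →L[ℂ] V)) ∧ IsUnit (1 + (L z : V →L[ℂ] V)) := by
  have hFDcl : FiniteDimensional ℂ (V →L[ℂ] V) := inferInstance
  let N := lowerSkew B U
  let L : (Fin (Module.finrank ℂ N) → ℂ) ≃L[ℂ] N :=
    (LinearEquiv.ofFinrankEq (Fin (Module.finrank ℂ N) → ℂ) N (by simp)).toContinuousLinearEquiv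
  obtain ⟨r, hr⟩ := exists_retraction N
  obtain ⟨O, hOD, hO, hO0⟩ := eventually_nhds_iff.1 hnear
  let O' : Set (V →L[ℂ] V) := {A | IsUnit (1 - A) ∧ IsUnit (1 + A) ∧ A ∈ O}
  have hO'open : IsOpen O' := by
    refine ((Units.isOpen (R := V →L[ℂ] V)).preimage (continuous_const.sub continuous_id)).inter
      (((Units.isOpen (R := V →L[ℂ] V)).preimage (continuous_const.add continuous_id)).inter hO)
  have hO'0 : (0 : V →L[ℂ] V) ∈ O' := ⟨by simp, by simp, hO0⟩
  let g : (Fin (Module.finrank ℂ N) → ℂ) → V →L[ℂ] V := fun z => (L z : V →L[ℂ] V)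
  have hgan : ∀ z, AnalyticAt ℂ g z := fun z =>
    (N.subtypeL.comp L.toContinuousLinearMap).analyticAt z
  let source : Set (Fin (Module.finrank ℂ N) → ℂ) := {z | g z ∈ O'}
  have hsource : IsOpen source :=
    hO'open.preimage (continuous_iff_continuousAt.2 fun z => (hgan z).continuousAt)
  let c : (Fin (Module.finrank ℂ N) → ℂ) → ℤ → Submodule ℂ V := fun z =>
    mapFlag (cayley (g z)) F
  have hiu : ∀ z ∈ source, IsUnipotentIsometry B U (cayley (g z)) := fun z hz =>
    isUnipotentIsometry_cayley h.monotone (L z).2 hz.1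
  let π := gradingProj F U h.isCompl
  let a : (ℤ → Submodule ℂ V) → V →L[ℂ] V := fun F' => cayleyInv (flagSection n π U F')
  have hac : ∀ z ∈ source, a (c z) = g z := by
    intro z hz
    change cayleyInv (flagSection n _ U (mapFlag (cayley (g z)) F)) = g z
    rw [flagSection_mapFlag h (hiu z hz), cayleyInv_cayley hz.1]
  let lift : (ℤ → Submodule ℂ V) → Fin (Module.finrank ℂ N) → ℂ := fun F' => L.symm (r (a F'))
  have hlift : ∀ z ∈ source, lift (c z) = z := by
    intro z hz
    change L.symm (r (a (c z))) = z
    rw [hac z hz, hr _ (L z).2]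
    exact L.symm_apply_apply z
  -- The inverse of the chart is explicit: a filtration determines its unipotent isometry by
  -- `flagSection`, and this its inverse Cayley transform. Both depend analytically on a holomorphic
  -- family.
  have hlocal : ∀ (k : ℕ) (Y : Set (Fin k → ℂ)) (f : (Fin k → ℂ) → ℤ → Submodule ℂ V),
      IsOpen Y → IsHolomorphicMap D Y f → ∀ y ∈ Y, f y ∈ c '' source →
      AnalyticAt ℂ (fun y => a (f y)) y ∧ ∀ᶠ y' in 𝓝 y, f y' ∈ c '' source := by
    intro k Y f hY hf y hy hfy
    obtain ⟨z, hz, hzy⟩ := hfy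
    have hcy : ∀ p, IsCompl (f y p) (U p) := fun p => by
      rw [← hzy]
      exact isCompl_mapFlag h (hiu z hz) p
    have hG := analyticAt_flagSection (n := n) π (hf y hy).2 hcy
    have hGy : flagSection n π U (f y) = cayley (g z) := by
      rw [← hzy]
      exact flagSection_mapFlag h (hiu z hz)
    have hunit : IsUnit (flagSection n π U (f y) + 1) := by
      rw [hGy]
      exact isUnit_cayley_add_one hz.1
    have han : AnalyticAt ℂ (fun y => a (f y)) y :=
      (hG.sub analyticAt_const).mul (analyticAt_inverse_comp (hG.add analyticAt_const) hunit)
    refine ⟨han, ?_⟩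
    -- Only finitely many degrees need a neighbourhood; outside this range the filtrations in `D`
    -- are constant.
    have hc' : ∀ᶠ y' in 𝓝 y, ∀ p ∈ Finset.Icc (0 : ℤ) n, IsCompl (f y' p) (U p) := by
      rw [eventually_all_finset]
      exact fun p _ => (analyticAt_projAlong ((hf y hy).2 p) (hcy p)).1
    have hay : a (f y) ∈ O' := by
      rw [← hzy, hac z hz]
      exact hz
    filter_upwards [hY.mem_nhds hy, hc', han.continuousAt.eventually (hO'open.mem_nhds hay),
      eventually_isUnit (hG.add analyticAt_const).continuousAt hunit] with y' hy' hc' hO' hu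
    have hD := (hf y' hy').1
    have hcall : ∀ p, IsCompl (f y' p) (U p) := by
      intro p
      by_cases hp : p ∈ Finset.Icc (0 : ℤ) n
      · exact hc' p hp
      · rw [Finset.mem_Icc, not_and_or, not_le, not_le] at hp
        rcases hp with hp | hp
        · rw [htop _ hD p hp.le, ← h.eq_top p hp.le]
          exact h.isCompl p
        · rw [hbot _ hD p hp, ← h.eq_bot p hp]
          exact h.isCompl p
    have hui := isUnipotentIsometry_flagSection h (hanti _ hD) (hiso _ hD) hcall
    have hmem : a (f y') ∈ N := cayleyInv_mem h.monotone hui hu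
    have hg : g (L.symm ⟨a (f y'), hmem⟩) = a (f y') := by simp [g]
    refine ⟨L.symm ⟨a (f y'), hmem⟩, ?_, ?_⟩
    · change g _ ∈ O'
      rw [hg]
      exact hO'
    · change mapFlag (cayley (g _)) F = _
      rw [hg, cayley_cayleyInv hu]
      exact mapFlag_flagSection h (hanti _ hD) (hiso _ hD) hcall
  refine ⟨_, ⟨source, c, hsource, ?_, ?_, ?_⟩, L, ?_, fun z => rfl, fun z hz => ⟨hz.1, hz.2.1⟩⟩
  · intro z hz
    refine ⟨hOD _ hz.2.2 (L z).2, fun p => ?_⟩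
    exact isHolomorphicSubbundleAt_map (analyticAt_cayley (hgan z) hz.1)
      (isUnit_cayley hz.1 hz.2.1) (F p)
  · intro z hz z' hz' hzz'
    rw [← hlift z hz, ← hlift z' hz', hzz']
  · intro k Y f hY hf
    refine ⟨isOpen_iff_mem_nhds.2 ?_, fun y => lift (f y), ?_, ?_⟩
    · rintro y ⟨hy, hfy⟩
      filter_upwards [hY.mem_nhds hy, (hlocal k Y f hY hf y hy hfy).2] with y' h1 h2
      exact ⟨h1, h2⟩
    · rintro y ⟨hy, hfy⟩
      exact (L.symm.toContinuousLinearMap.analyticAt _).comp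
        ((r.analyticAt _).comp (hlocal k Y f hY hf y hy hfy).1)
    · rintro y hy ⟨z, hz, hzy⟩
      have e : lift (f y) = z := by rw [← hzy, hlift z hz]
      change lift (f y) ∈ source ∧ c (lift (f y)) = f y
      rw [e]
      exact ⟨hz, hzy⟩
  · change g 0 ∈ O'
    simpa [g] using hO'0

end Chart
end
end PeriodDomain

namespace PeriodDomain

noncomputable section

/-! ### The Maurer–Cartan form of the Cayley chart -/

section CayleyForm

open Filter Topology

variable {E : Type*} [NormedAddCommGroup E] [NormedSpace ℂ E]
variable {R : Type*} [NormedRing R] [NormedAlgebra ℂ R] [CompleteSpace R]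

theorem analyticAt_clm_comp {M M' : Type*} [NormedAddCommGroup M] [NormedSpace ℂ M]
    [NormedAddCommGroup M'] [NormedSpace ℂ M'] {T : E → M →L[ℂ] M'} {T' : E → E →L[ℂ] M} {y : E}
    (hT : AnalyticAt ℂ T y) (hT' : AnalyticAt ℂ T' y) :
    AnalyticAt ℂ (fun z => (T z).comp (T' z)) y :=
  ((ContinuousLinearMap.compL ℂ E M M').analyticAt_bilinear (T y, T' y)).comp₂ hT hT'

theorem fderiv_clm_comp {M M' : Type*} [NormedAddCommGroup M] [NormedSpace ℂ M]
    [NormedAddCommGroup M'] [NormedSpace ℂ M'] (T : M →L[ℂ] M') {T' : E → E →L[ℂ] M} {y : E}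
    (hT' : DifferentiableAt ℂ T' y) (u : E) :
    fderiv ℂ (fun z => T.comp (T' z)) y u = T.comp (fderiv ℂ T' y u) :=
  congrArg (fun S => S u)
    ((ContinuousLinearMap.compL ℂ E M M' T).hasFDerivAt.comp y hT'.hasFDerivAt).fderiv

theorem analyticAt_subtype {M : Type*} [NormedAddCommGroup M] [NormedSpace ℂ M]
    {K : Submodule ℂ M} {L : E → K} {y : E} (hL : AnalyticAt ℂ L y) :
    AnalyticAt ℂ (fun z => (L z : M)) y :=
  (K.subtypeL.analyticAt (L y)).comp hL

theorem fderiv_subtype {M : Type*} [NormedAddCommGroup M] [NormedSpace ℂ M]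
    {K : Submodule ℂ M} {L : E → K} {y : E} (hL : DifferentiableAt ℂ L y) (v : E) :
    fderiv ℂ (fun z => (L z : M)) y v = (fderiv ℂ L y v : M) :=
  congrArg (fun T => T v) (K.subtypeL.hasFDerivAt.comp y hL.hasFDerivAt).fderiv

/-- The form `g⁻¹ dg = 2 (1 + A)⁻¹ dA (1 - A)⁻¹` of the Cayley transform `g` of `A`. -/
def cayleyForm (A : E → R) (y : E) : E →L[ℂ] R :=
  ((2 : ℂ) • ContinuousLinearMap.mulLeftRight ℂ R (Ring.inverse (1 + A y))
    (Ring.inverse (1 - A y))).comp (fderiv ℂ A y)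

theorem cayleyForm_apply (A : E → R) (y v : E) :
    cayleyForm A y v =
      (2 : ℂ) • (Ring.inverse (1 + A y) * fderiv ℂ A y v * Ring.inverse (1 - A y)) := by
  simp [cayleyForm]

variable {A : E → R} {y : E}

theorem analyticAt_cayleyForm (hA : AnalyticAt ℂ A y) (h1 : IsUnit (1 - A y))
    (h2 : IsUnit (1 + A y)) : AnalyticAt ℂ (cayleyForm A) y := by
  have e1 : AnalyticAt ℂ (fun z => Ring.inverse (1 + A z)) y :=
    analyticAt_inverse_comp (analyticAt_const.add hA) h2
  have e2 : AnalyticAt ℂ (fun z => Ring.inverse (1 - A z)) y :=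
    analyticAt_inverse_comp (analyticAt_const.sub hA) h1
  have e3 : AnalyticAt ℂ (fun z => (2 : ℂ) • ContinuousLinearMap.mulLeftRight ℂ R
      (Ring.inverse (1 + A z)) (Ring.inverse (1 - A z))) y :=
    AnalyticAt.fun_smul analyticAt_const
      (((ContinuousLinearMap.mulLeftRight ℂ R).analyticAt_bilinear (_, _)).comp₂ e1 e2)
  exact analyticAt_clm_comp e3 hA.fderiv

theorem hasFDerivAt_inverse_comp {X : E → R} {X' : E →L[ℂ] R}
    (hX : HasFDerivAt X X' y) (h : IsUnit (X y)) :
    HasFDerivAt (fun z => Ring.inverse (X z))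
      ((-ContinuousLinearMap.mulLeftRight ℂ R (Ring.inverse (X y))
        (Ring.inverse (X y))).comp X') y := by
  obtain ⟨u, hu⟩ := h
  have h1 := hasFDerivAt_ringInverse (𝕜 := ℂ) u
  rw [← Ring.inverse_unit] at h1
  rw [hu] at h1
  exact h1.comp y hX

theorem inverse_add_inverse {R : Type*} [Ring R] {A : R} (h1 : IsUnit (1 - A))
    (h2 : IsUnit (1 + A)) :
    Ring.inverse (1 + A) + Ring.inverse (1 - A) =
      (2 : ℕ) • (Ring.inverse (1 - A) * Ring.inverse (1 + A)) := by
  have e1 : Ring.inverse (1 + A) = Ring.inverse (1 - A) * (1 - A) * Ring.inverse (1 + A) := by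
    rw [Ring.inverse_mul_cancel _ h1, one_mul]
  have e2 : Ring.inverse (1 - A) = Ring.inverse (1 - A) * (1 + A) * Ring.inverse (1 + A) := by
    rw [mul_assoc, Ring.mul_inverse_cancel _ h2, mul_one]
  conv_lhs => rw [e1]; enter [2]; rw [e2]
  noncomm_ring

/-- With `P = (1 + A)⁻¹` and `Q = (1 - A)⁻¹` the form is `2 P dA Q`. The second derivatives of `A`
cancel by symmetry, and `P + Q = 2 Q P` turns the remaining terms into the commutator. -/
theorem cayleyForm_structure_eq (hA : AnalyticAt ℂ A y) (h1 : IsUnit (1 - A y))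
    (h2 : IsUnit (1 + A y)) (u v : E) :
    fderiv ℂ (cayleyForm A) y u v - fderiv ℂ (cayleyForm A) y v u =
      -(cayleyForm A y u * cayleyForm A y v - cayleyForm A y v * cayleyForm A y u) := by
  have hdA := hA.differentiableAt.hasFDerivAt
  have hddA := hA.fderiv.differentiableAt.hasFDerivAt
  have hP := hasFDerivAt_inverse_comp (hdA.const_add 1) h2
  have hQ := hasFDerivAt_inverse_comp (hdA.const_sub 1) h1
  obtain ⟨P, hPdef⟩ : ∃ P, P = Ring.inverse (1 + A y) := ⟨_, rfl⟩
  obtain ⟨Q, hQdef⟩ : ∃ Q, Q = Ring.inverse (1 - A y) := ⟨_, rfl⟩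
  rw [← hPdef] at hP
  rw [← hQdef] at hQ
  have key : ∀ u v, fderiv ℂ (cayleyForm A) y u v = (2 : ℂ) •
      (P * fderiv ℂ (fderiv ℂ A) y u v * Q - P * fderiv ℂ A y u * P * fderiv ℂ A y v * Q +
        P * fderiv ℂ A y v * Q * fderiv ℂ A y u * Q) := by
    intro u v
    have e1 := (analyticAt_cayleyForm hA h1 h2).differentiableAt.hasFDerivAt.clm_apply
      (hasFDerivAt_const v y)
    have e2 := ((hP.mul' (hddA.clm_apply (hasFDerivAt_const v y))).mul' hQ).const_smul (2 : ℂ)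
    have e3 : (fun z => cayleyForm A z v) = (2 : ℂ) • ((fun z => Ring.inverse (1 + A z)) *
        (fun z => fderiv ℂ A z v) * fun z => Ring.inverse (1 - A z)) := by
      funext z
      exact cayleyForm_apply A z v
    rw [e3] at e1
    have e4 := congrArg (fun f => f u) (e1.unique e2)
    simp only [add_apply, ContinuousLinearMap.comp_apply, ContinuousLinearMap.flip_apply,
      zero_apply, map_zero, zero_add, smul_apply, neg_apply,
      ContinuousLinearMap.mulLeftRight_apply, Pi.mul_apply, smul_eq_mul,
      MulOpposite.smul_eq_mul_unop, MulOpposite.unop_op] at e4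
    rw [e4]
    congr 1
    simp only [← hPdef, ← hQdef]
    noncomm_ring
  have hsymm : fderiv ℂ (fderiv ℂ A) y u v = fderiv ℂ (fderiv ℂ A) y v u :=
    (hA.contDiffAt (n := ⊤)).isSymmSndFDerivAt_of_omega u v
  have hPQ : P + Q = (2 : ℕ) • (Q * P) := by
    rw [hPdef, hQdef]
    exact inverse_add_inverse h1 h2
  rw [key, key, hsymm, cayleyForm_apply, cayleyForm_apply, ← hPdef, ← hQdef]
  generalize fderiv ℂ A y u = a
  generalize fderiv ℂ A y v = b
  generalize fderiv ℂ (fderiv ℂ A) y v u = s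
  rw [← smul_sub, smul_mul_smul_comm, smul_mul_smul_comm, ← smul_sub, ← smul_neg, mul_smul]
  congr 1
  have e5 : P * s * Q - P * a * P * b * Q + P * b * Q * a * Q -
      (P * s * Q - P * b * P * a * Q + P * a * Q * b * Q) =
      P * b * (P + Q) * a * Q - P * a * (P + Q) * b * Q := by noncomm_ring
  rw [e5, hPQ, two_smul ℂ]
  noncomm_ring

/-- Justifies reading `cayleyForm` as `g⁻¹ dg`; the derivative is computed from `cayley A = 2 (1 -
A)⁻¹ - 1`. -/
theorem fderiv_cayley_apply (hA : AnalyticAt ℂ A y) (h1 : IsUnit (1 - A y))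
    (h2 : IsUnit (1 + A y)) (v : E) :
    fderiv ℂ (fun z => cayley (A z)) y v = cayley (A y) * cayleyForm A y v := by
  have hdA := hA.differentiableAt.hasFDerivAt
  have hQ := ((hasFDerivAt_inverse_comp (hdA.const_sub 1) h1).const_smul (2 : ℂ)).sub_const 1
  have e1 : (fun z => cayley (A z)) =ᶠ[𝓝 y] fun z => (2 : ℂ) • Ring.inverse (1 - A z) - 1 := by
    filter_upwards [eventually_isUnit (analyticAt_const.sub hA).continuousAt h1] with z hz
    rw [← cayley_add_one hz, add_sub_cancel_right]
  have e2 := (hQ.congr_of_eventuallyEq e1).fderiv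
  have e3 := congrArg (fun f => f v) e2
  simp only [smul_apply, neg_apply, ContinuousLinearMap.comp_apply,
    ContinuousLinearMap.mulLeftRight_apply] at e3
  have e4 : cayley (A y) = Ring.inverse (1 - A y) * (1 + A y) := by
    symm
    rw [Ring.inverse_mul_eq_iff_eq_mul _ _ _ h1, cayley, ← mul_assoc]
    symm
    have : (1 - A y) * (1 + A y) = (1 + A y) * (1 - A y) := by noncomm_ring
    rw [this, mul_assoc, Ring.mul_inverse_cancel _ h1, mul_one]
  rw [e3, e4, cayleyForm_apply, mul_smul_comm]
  congr 1
  have e5 : Ring.inverse (1 - A y) * (1 + A y) * (Ring.inverse (1 + A y) * fderiv ℂ A y v *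
      Ring.inverse (1 - A y)) = Ring.inverse (1 - A y) * ((1 + A y) * Ring.inverse (1 + A y)) *
      fderiv ℂ A y v * Ring.inverse (1 - A y) := by noncomm_ring
  rw [e5, Ring.mul_inverse_cancel _ h2, mul_one]
  simp

variable {V : Type*} [NormedAddCommGroup V] [NormedSpace ℂ V] [FiniteDimensional ℂ V]
  [CompleteSpace V]

variable {B : LinearMap.BilinForm ℂ V} {F U : ℤ → Submodule ℂ V}

/-- The two outer factors are adjoint to each other with respect to `B`, so the product is a
congruence, and this preserves skewness. -/
theorem conjugate_mem_lowerSkew (hU : Monotone U) {X a : V →L[ℂ] V} (hX : X ∈ lowerSkew B U)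
    (ha : a ∈ lowerSkew B U) (h1 : IsUnit (1 - X)) (h2 : IsUnit (1 + X)) :
    Ring.inverse (1 + X) * a * Ring.inverse (1 - X) ∈ lowerSkew B U := by
  constructor
  · have hXs : ∀ u v, B (X u) v = -B u (X v) := hX.1
    have has : ∀ u v, B (a u) v = -B u (a v) := ha.1
    have e1 : ∀ u v, B (Ring.inverse (1 + X) u) v = B u (Ring.inverse (1 - X) v) := by
      intro u v
      conv_lhs => rw [← apply_inverse_apply h1 v]
      conv_rhs => rw [← apply_inverse_apply h2 u]
      simp only [add_apply, sub_apply, one_apply_eq_self, map_add, map_sub,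
        LinearMap.add_apply, hXs]
      ring
    have e2 : ∀ u v, B (Ring.inverse (1 - X) u) v = B u (Ring.inverse (1 + X) v) := by
      intro u v
      conv_lhs => rw [← apply_inverse_apply h2 v]
      conv_rhs => rw [← apply_inverse_apply h1 u]
      simp only [add_apply, sub_apply, one_apply_eq_self, map_add, map_sub,
        LinearMap.sub_apply, hXs]
      ring
    intro u v
    simp only [mul_apply_eq_comp]
    rw [e1, has, e2]
  · intro p v hv
    exact inverse_apply_mem h2 (one_add_apply_mem hU hX p) _
      (ha.2 p _ (inverse_apply_mem h1 (one_sub_apply_mem hU hX _) v hv))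

theorem cayleyForm_mem {L : E → lowerSkew B U} (hU : Monotone U)
    (hA : AnalyticAt ℂ (fun z => (L z : V →L[ℂ] V)) y)
    (h1 : IsUnit (1 - (L y : V →L[ℂ] V))) (h2 : IsUnit (1 + (L y : V →L[ℂ] V))) (v : E) :
    cayleyForm (fun z => (L z : V →L[ℂ] V)) y v ∈ lowerSkew B U := by
  rw [cayleyForm_apply]
  refine Submodule.smul_mem _ _ (conjugate_mem_lowerSkew hU (L y).2 ?_ h1 h2)
  exact hasFDerivAt_apply_mem hA.differentiableAt.hasFDerivAt
    (Eventually.of_forall fun z => (L z).2) v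

theorem commutator_mem_lowerSkew (hU : Monotone U) {X Y : V →L[ℂ] V} (hX : X ∈ lowerSkew B U)
    (hY : Y ∈ lowerSkew B U) : X * Y - Y * X ∈ lowerSkew B U :=
  have htop : ∀ Z ∈ lowerSkew B U, Z ∈ lowerSkewDepth B (fun _ => ⊤) U 0 :=
    fun _ hZ => ⟨hZ, fun _ _ _ => trivial⟩
  (commutator_mem_depth hU (htop X hX) (htop Y hY)).1

/-- The tangent vectors of depth at most `k` for a family of filtrations `g F`. -/
theorem horizontal_eq (hF : Antitone F) {g : E → V →L[ℂ] V} (hg : AnalyticAt ℂ g y)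
    (hu : IsUnit (g y)) {Θ : E →L[ℂ] V →L[ℂ] V} (hΘ : ∀ v, fderiv ℂ g y v = g y * Θ v)
    {f : E → ℤ → Submodule ℂ V} (hf : ∀ᶠ z in 𝓝 y, f z = mapFlag (g z) F) {k : ℤ} (hk : 0 ≤ k) :
    horizontal f k y = (filteredMaps F fun p => F (p - k)).comap Θ.toLinearMap := by
  have hfy := hf.self_of_nhds
  ext v
  simp only [horizontal, Submodule.mem_iInf, Submodule.mem_comap]
  constructor
  · intro hv p w hw
    have hs : AnalyticAt ℂ (fun z => g z w) y := analyticAt_apply hg analyticAt_const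
    have h1 := hv p (fun z => g z w) (holomorphicNear_iff.2 hs) (by
      filter_upwards [hf] with z hz
      rw [hz]
      exact Submodule.mem_map_of_mem hw)
    rw [differential_apply hs, hfy] at h1
    have h2 := (hg.differentiableAt.hasFDerivAt.clm_apply (hasFDerivAt_const w y)).fderiv
    rw [h2] at h1
    simp only [add_apply, ContinuousLinearMap.comp_apply, ContinuousLinearMap.flip_apply,
      zero_apply, map_zero, zero_add, hΘ] at h1
    obtain ⟨x, hx, hxv⟩ := h1
    have h3 : x = Θ v w := injective_of_isUnit hu hxv
    change Θ v w ∈ F (p - k)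
    rwa [← h3]
  · intro hv p s hs hsf
    have hs' := holomorphicNear_iff.1 hs
    rw [differential_apply hs', hfy]
    -- Moving `s` back by `g` gives a section `t` of the fixed space `F p`, and `ds = g (Θ t + dt)`.
    -- Here `dt` stays in `F p`, which lies in `F (p - k)` because `k ≥ 0`.
    have ht : AnalyticAt ℂ (fun z => Ring.inverse (g z) (s z)) y :=
      analyticAt_apply (analyticAt_inverse_comp hg hu) hs'
    have htF : ∀ᶠ z in 𝓝 y, Ring.inverse (g z) (s z) ∈ F p := by
      filter_upwards [hf, hsf, eventually_isUnit hg.continuousAt hu] with z hz hsz hgz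
      rw [hz] at hsz
      obtain ⟨w, hw, hwz⟩ := hsz
      rw [← hwz]
      change Ring.inverse (g z) (g z w) ∈ F p
      rwa [inverse_apply_apply hgz]
    have hst : s =ᶠ[𝓝 y] fun z => g z (Ring.inverse (g z) (s z)) := by
      filter_upwards [eventually_isUnit hg.continuousAt hu] with z hgz
      rw [apply_inverse_apply hgz]
    have h2 := ((hg.differentiableAt.hasFDerivAt.clm_apply
      ht.differentiableAt.hasFDerivAt).congr_of_eventuallyEq hst).fderiv
    rw [h2]
    simp only [add_apply, ContinuousLinearMap.comp_apply, ContinuousLinearMap.flip_apply, hΘ]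
    rw [mul_apply_eq_comp]
    refine add_mem (Submodule.mem_map_of_mem ?_) (Submodule.mem_map_of_mem ?_)
    · exact hF (by omega) (hasFDerivAt_apply_mem ht.differentiableAt.hasFDerivAt htF v)
    · exact hv p _ htF.self_of_nhds

theorem periodSystem_eq_annihilator (f : E → ℤ → Submodule ℂ V) (k : ℤ) (x : E) :
    periodSystem f k x = annihilator (horizontal f k x) := rfl

/-- The bracket of `lowerSkew B U`. -/
def lowerBracket (hU : Monotone U) (a b : lowerSkew B U) : lowerSkew B U :=
  ⟨(a : V →L[ℂ] V) * b - (b : V →L[ℂ] V) * a, commutator_mem_lowerSkew hU a.2 b.2⟩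

/-- The subspace of elements of depth at most `k` of `lowerSkew B U`. -/
def lowerDepth (B : LinearMap.BilinForm ℂ V) (F U : ℤ → Submodule ℂ V) (k : ℤ) :
    Submodule ℂ (lowerSkew B U) :=
  (lowerSkewDepth B F U k).comap (lowerSkew B U).subtype

/-- The coframe is the Cayley form with its codomain cut down to `lowerSkew B U`. It is invertible
because it differs from the derivative of `L` by invertible factors on the left and right. A general
`L` is allowed so that the result applies in every chart. -/
theorem exists_maurerCartan [FiniteDimensional ℂ E] (hU : Monotone U) (hF : Antitone F)
    {S : Set E} (hS : IsOpen S)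
    {L : E → lowerSkew B U} (hL : ∀ z ∈ S, AnalyticAt ℂ L z)
    (hLinv : ∀ z ∈ S, Function.Bijective (fderiv ℂ L z))
    (hu : ∀ z ∈ S, IsUnit (1 - (L z : V →L[ℂ] V)) ∧ IsUnit (1 + (L z : V →L[ℂ] V)))
    {f : E → ℤ → Submodule ℂ V}
    (hf : ∀ z ∈ S, f z = mapFlag (cayley (L z : V →L[ℂ] V)) F) :
    ∃ θ : E → E →L[ℂ] lowerSkew B U, IsMaurerCartan S θ (lowerBracket hU) ∧
      ∀ k : ℤ, 0 ≤ k → ∀ z ∈ S,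
        horizontal f k z = (lowerDepth B F U k).comap (θ z).toLinearMap := by
  obtain ⟨r, hr⟩ := exists_retraction (lowerSkew B U)
  let A : E → V →L[ℂ] V := fun z => (L z : V →L[ℂ] V)
  have hA : ∀ z ∈ S, AnalyticAt ℂ A z := fun z hz =>
    analyticAt_subtype (hL z hz)
  have hmem : ∀ z ∈ S, ∀ v, cayleyForm A z v ∈ lowerSkew B U := fun z hz v =>
    cayleyForm_mem hU (hA z hz) (hu z hz).1 (hu z hz).2 v
  have hθ : ∀ z (hz : z ∈ S) v, r (cayleyForm A z v) = ⟨cayleyForm A z v, hmem z hz v⟩ :=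
    fun z hz v => hr _ _
  have han : ∀ z ∈ S, AnalyticAt ℂ (cayleyForm A) z := fun z hz =>
    analyticAt_cayleyForm (hA z hz) (hu z hz).1 (hu z hz).2
  refine ⟨fun z => r.comp (cayleyForm A z), ⟨hS, ?_, ?_, ?_⟩, ?_⟩
  · exact fun z hz => analyticAt_clm_comp analyticAt_const (han z hz)
  · intro z hz
    have hdA : ∀ v, fderiv ℂ A z v = (fderiv ℂ L z v : lowerSkew B U) := by
      exact fun v => fderiv_subtype (hL z hz).differentiableAt v
    have hinj : Function.Injective (r.comp (cayleyForm A z)) := by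
      rw [injective_iff_map_eq_zero]
      intro v hv
      rw [ContinuousLinearMap.comp_apply, hθ z hz, Subtype.ext_iff] at hv
      change cayleyForm A z v = 0 at hv
      rw [cayleyForm_apply, smul_eq_zero, or_iff_right two_ne_zero] at hv
      have h1 : fderiv ℂ A z v = (1 + A z) * (Ring.inverse (1 + A z) * fderiv ℂ A z v *
          Ring.inverse (1 - A z)) * (1 - A z) := by
        rw [mul_assoc, mul_assoc (_ * _), Ring.inverse_mul_cancel _ (hu z hz).1, mul_one,
          ← mul_assoc, Ring.mul_inverse_cancel _ (hu z hz).2, one_mul]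
      rw [hv, mul_zero, zero_mul, hdA] at h1
      refine (injective_iff_map_eq_zero _).1 (hLinv z hz).1 v (Subtype.ext h1)
    have hdim : Module.finrank ℂ E = Module.finrank ℂ (lowerSkew B U) :=
      (LinearEquiv.ofBijective (fderiv ℂ L z).toLinearMap (hLinv z hz)).finrank_eq
    exact ⟨(LinearMap.linearEquivOfInjective (r.comp (cayleyForm A z)).toLinearMap hinj
      hdim).toContinuousLinearEquiv, by ext v; rfl⟩
  · intro z hz u v
    have h1 : ∀ u, fderiv ℂ (fun z => r.comp (cayleyForm A z)) z u =
        r.comp (fderiv ℂ (cayleyForm A) z u) := by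
      intro u
      exact fderiv_clm_comp r (han z hz).differentiableAt u
    rw [h1, h1, ContinuousLinearMap.comp_apply, ContinuousLinearMap.comp_apply, ← map_sub,
      cayleyForm_structure_eq (hA z hz) (hu z hz).1 (hu z hz).2, map_neg,
      hr _ (commutator_mem_lowerSkew hU (hmem z hz u) (hmem z hz v))]
    simp only [ContinuousLinearMap.comp_apply, hθ z hz]
    rfl
  · intro k hk z hz
    have h1 := horizontal_eq (Θ := cayleyForm A z) hF (analyticAt_cayley (hA z hz) (hu z hz).1)
      (isUnit_cayley (hu z hz).1 (hu z hz).2)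
      (fderiv_cayley_apply (hA z hz) (hu z hz).1 (hu z hz).2)
      (f := f) (by filter_upwards [hS.mem_nhds hz] with z' hz' using hf z' hz') hk
    rw [h1]
    ext v
    constructor
    · intro hv
      change (r (cayleyForm A z v) : V →L[ℂ] V) ∈ lowerSkewDepth B F U k
      rw [hθ z hz]
      exact ⟨hmem z hz v, hv⟩
    · intro hv
      change (r (cayleyForm A z v) : V →L[ℂ] V) ∈ lowerSkewDepth B F U k at hv
      rw [hθ z hz] at hv
      exact hv.2

end CayleyForm
end
end PeriodDomain

namespace PeriodDomain

noncomputable section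

/-! ### The flag generated in depth one, and the derived flag -/

section Flag

variable {V : Type*} [NormedAddCommGroup V] [NormedSpace ℂ V] [FiniteDimensional ℂ V]
  [CompleteSpace V]
variable {B : LinearMap.BilinForm ℂ V} {F U : ℤ → Submodule ℂ V}

theorem mem_lowerDepth {k : ℤ} {a : lowerSkew B U} :
    a ∈ lowerDepth B F U k ↔ (a : V →L[ℂ] V) ∈ lowerSkewDepth B F U k := Iff.rfl

/-- The flag generated by the elements of depth `1`. -/
def lowerFlag (hU : Monotone U) (F : ℤ → Submodule ℂ V) (m : ℕ) : Submodule ℂ (lowerSkew B U) :=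
  algebraicFlag (lowerBracket (B := B) hU) (lowerDepth B F U 1) m

theorem isBracketFlag_lowerFlag (hU : Monotone U) :
    IsPolarizedGrading.IsBracketFlag B F U
      (fun m => (lowerFlag (B := B) hU F m).map (lowerSkew B U).subtype) := by
  refine ⟨fun A hA => ?_, fun m => Submodule.map_mono le_sup_left, ?_⟩
  · exact ⟨⟨A, hA.1⟩, hA, rfl⟩
  · rintro m _ ⟨X, hX, rfl⟩ _ ⟨Y, hY, rfl⟩
    exact ⟨lowerBracket hU X Y, Submodule.mem_sup_right (Submodule.subset_span
      ⟨X, hX, Y, hY, rfl⟩), rfl⟩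

/-- Depths add under commutators, so each step at most doubles the depth. -/
theorem lowerFlag_le_depth (hU : Monotone U) (hF : Antitone F) (m : ℕ) :
    lowerFlag (B := B) hU F m ≤ lowerDepth B F U (2 ^ m) := by
  induction m with
  | zero => exact le_of_eq (by simp [lowerFlag, algebraicFlag])
  | succ m ih =>
    have h2 : (2 : ℤ) ^ (m + 1) = 2 ^ m + 2 ^ m := by ring
    refine sup_le (ih.trans ?_) (Submodule.span_le.2 ?_)
    · rintro a ⟨h1, h3⟩
      refine ⟨h1, fun p v hv => hF ?_ (h3 p v hv)⟩
      have : (0 : ℤ) ≤ 2 ^ m := by positivity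
      omega
    · rintro _ ⟨a, ha, b, hb, rfl⟩
      have := commutator_mem_depth hU (mem_lowerDepth.1 (ih ha)) (mem_lowerDepth.1 (ih hb))
      rw [← h2] at this
      exact this

variable {n : ℕ}

/-- The graded pieces are nonzero. -/
def HasNonzeroPieces (n : ℕ) (F U : ℤ → Submodule ℂ V) : Prop :=
  ∀ q : ℤ, 0 ≤ q → q ≤ n → ∃ z, z ∈ F q ∧ z ∈ U (q + 1) ∧ z ≠ 0

/-- The graded pieces are of dimension at least two. -/
def HasLargePieces (n : ℕ) (F U : ℤ → Submodule ℂ V) : Prop :=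
  ∀ q : ℤ, 0 ≤ q → q ≤ n → ∀ w, ∃ z, z ∈ F q ∧ z ∈ U (q + 1) ∧ z ∉ Submodule.span ℂ {w}

theorem IsIsotropicPair.gradingProj_eq (h : IsIsotropicPair n B F U) {q : ℤ} {z : V}
    (hF : z ∈ F q) (hU : z ∈ U (q + 1)) : gradingProj F U h.isCompl q z = z := by
  rw [gradingProj, LinearMap.sub_apply, (Submodule.projection_eq_self_iff (h.isCompl q) z).2 hF,
    (Submodule.projection_apply_eq_zero_iff (h.isCompl (q + 1))).2 hU, sub_zero]

theorem HasNonzeroPieces.exists_proj (hz : HasNonzeroPieces n F U) (h : IsIsotropicPair n B F U)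
    (q : ℤ) (h0 : 0 ≤ q) (hn : q ≤ n) : ∃ z, gradingProj F U h.isCompl q z = z ∧ z ≠ 0 := by
  obtain ⟨z, hF, hU, hz⟩ := hz q h0 hn
  exact ⟨z, h.gradingProj_eq hF hU, hz⟩

theorem lowerFlag_eq_top (h : IsIsotropicPair n B F U) (hn : 2 ≤ n)
    (hz : HasNonzeroPieces n F U) {m : ℕ} (hm : n ≤ 2 ^ m) :
    lowerFlag (B := B) h.monotone F m = ⊤ := by
  rw [eq_top_iff]
  rintro a -
  obtain ⟨b, hb, hba⟩ := h.isPolarizedGrading.lowerSkew_le_flag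
    (isBracketFlag_lowerFlag h.monotone) hn (hz.exists_proj h) hm a.2
  rwa [← Subtype.ext hba]

theorem depth_le_lowerFlag (h : IsIsotropicPair n B F U) (hn : 2 ≤ n) (hn4 : Odd n ∨ n ≤ 4)
    (hz : HasNonzeroPieces n F U) (m : ℕ) :
    lowerDepth B F U (2 ^ m) ≤ lowerFlag h.monotone F m := by
  intro a ha
  obtain ⟨b, hb, hba⟩ := h.isPolarizedGrading.depth_le_flag_of_small
    (isBracketFlag_lowerFlag h.monotone) hn hn4 (hz.exists_proj h) m ha
  rwa [← Subtype.ext hba]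

theorem lowerFlag_eq_depth (h : IsIsotropicPair n B F U)
    (hz : HasNonzeroPieces n F U) (hl : HasLargePieces n F U) (m : ℕ) :
    lowerFlag h.monotone F m = lowerDepth B F U (2 ^ m) := by
  refine le_antisymm (lowerFlag_le_depth h.monotone h.antitone m) fun a ha => ?_
  obtain ⟨b, hb, hba⟩ := h.isPolarizedGrading.depth_le_flag_of_large
    (isBracketFlag_lowerFlag h.monotone) (hz.exists_proj h) (Or.inr fun q h0 hn w => by
      obtain ⟨z, hF, hU, hz⟩ := hl q h0 hn w
      exact ⟨z, h.gradingProj_eq hF hU, hz⟩) m ha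
  rwa [← Subtype.ext hba]

/-- The properties of the derived flag of the system `dF^p ⊆ F^{p-1}` of a family `f` of
filtrations at the point `x`. -/
theorem derivedFlag_properties {E : Type*} [NormedAddCommGroup E] [NormedSpace ℂ E]
    [FiniteDimensional ℂ E] (h : IsIsotropicPair n B F U) (hn : 2 ≤ n)
    (hz : HasNonzeroPieces n F U)
    {S : Set E} {θ : E → E →L[ℂ] lowerSkew B U}
    (hθ : IsMaurerCartan S θ (lowerBracket h.monotone)) {f : E → ℤ → Submodule ℂ V}
    (hf : ∀ k : ℤ, 0 ≤ k → ∀ z ∈ S,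
      horizontal f k z = (lowerDepth B F U k).comap (θ z).toLinearMap) {x : E} (hx : x ∈ S) :
    (∀ m, IsHolomorphicSubbundleAt (derivedFlag (periodSystem f 1) m) x) ∧
    (∀ m : ℕ, n ≤ 2 ^ m → derivedFlag (periodSystem f 1) m x = ⊥) ∧
    (⨆ m, bracketFlag (fun y => ⨅ α ∈ periodSystem f 1 y, LinearMap.ker α.toLinearMap) m x = ⊤) ∧
    ((Odd n ∨ n ≤ 4) → ∀ m, derivedFlag (periodSystem f 1) m x ≤ periodSystem f (2 ^ m) x) ∧
    (HasLargePieces n F U →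
      ∀ m, derivedFlag (periodSystem f 1) m x = periodSystem f (2 ^ m) x) := by
  have h1 : ∀ k : ℤ, 0 ≤ k → ∀ z ∈ S, periodSystem f k z =
      annihilator ((lowerDepth B F U k).comap (θ z).toLinearMap) := fun k hk z hz => by
    rw [periodSystem_eq_annihilator, hf k hk z hz]
  have hflag : ∀ m, ∀ z ∈ S, derivedFlag (periodSystem f 1) m z =
      annihilator ((lowerFlag h.monotone F m).comap (θ z).toLinearMap) := fun m =>
    hθ.derivedFlag_eq _ (h1 1 zero_le_one) m
  have hbr := fun m => hθ.bracketFlag_eq (lowerDepth B F U 1)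
    (D := fun y => ⨅ α ∈ periodSystem f 1 y, LinearMap.ker α.toLinearMap)
    (fun z hz => by rw [h1 1 zero_le_one z hz, iInf_ker_annihilator]) m x hx
  refine ⟨fun m => hθ.isHolomorphicSubbundleAt _ (hflag m) hx, fun m hm => ?_, ?_,
    fun hn4 m => ?_, fun hl m => ?_⟩
  · rw [hflag m x hx, lowerFlag_eq_top h hn hz hm, eq_bot_iff]
    intro α hα
    exact (Submodule.mem_bot ℂ).2 (ContinuousLinearMap.ext fun v => hα v trivial)
  -- The index `n` is far enough, as `n ≤ 2^n`.
  · refine eq_top_iff.2 (le_trans ?_ (le_iSup _ n))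
    rw [hbr n]
    have := lowerFlag_eq_top h hn hz (Nat.lt_two_pow_self (n := n)).le
    rw [lowerFlag] at this
    rw [this]
    exact le_rfl
  · rw [hflag m x hx, h1 _ (by positivity) x hx]
    exact annihilator_anti (Submodule.comap_mono (depth_le_lowerFlag h hn hn4 hz m))
  · rw [hflag m x hx, h1 _ (by positivity) x hx, lowerFlag_eq_depth h hz hl m]

end Flag

/-! ### Arbitrary charts, and openness of positivity -/

section Chart

open Filter Topology

/-- Two charts of the same set of filtrations differ by a local biholomorphism. -/
theorem HolomorphicChart.exists_transition {V : Type*} [AddCommGroup V] [Module ℂ V]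
    {D : Set (ℤ → Submodule ℂ V)} {d e : ℕ} (c : HolomorphicChart D d) (c' : HolomorphicChart D e)
    {x : Fin d → ℂ} (hx : x ∈ c.source) (hxc : c.toFun x ∈ c'.toFun '' c'.source) :
    ∃ (S : Set (Fin d → ℂ)) (φ : (Fin d → ℂ) → Fin e → ℂ), IsOpen S ∧ x ∈ S ∧
      ∀ y ∈ S, AnalyticAt ℂ φ y ∧ Function.Bijective (fderiv ℂ φ y) ∧ φ y ∈ c'.source ∧
        c'.toFun (φ y) = c.toFun y := by
  obtain ⟨hS, φ, hφ, hφc⟩ := c'.lift d c.source c.toFun c.isOpen_source c.holomorphic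
  obtain ⟨hT, ψ, hψ, hψc⟩ := c.lift e c'.source c'.toFun c'.isOpen_source c'.holomorphic
  refine ⟨_, φ, hS, ⟨hx, hxc⟩, ?_⟩
  rintro y ⟨hy, hyc⟩
  obtain ⟨hφy, hcφ⟩ := hφc y hy hyc
  have hyT : φ y ∈ {z ∈ c'.source | c'.toFun z ∈ c.toFun '' c.source} :=
    ⟨hφy, hcφ ▸ Set.mem_image_of_mem _ hy⟩
  have hψφ : ∀ y, y ∈ c.source → c.toFun y ∈ c'.toFun '' c'.source → ψ (φ y) = y := by
    intro y hy hyc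
    obtain ⟨h1, h2⟩ := hφc y hy hyc
    obtain ⟨h3, h4⟩ := hψc (φ y) h1 (h2 ▸ Set.mem_image_of_mem _ hy)
    exact c.injOn h3 hy (h4.trans h2)
  have hφψ : ∀ z, z ∈ c'.source → c'.toFun z ∈ c.toFun '' c.source → φ (ψ z) = z := by
    intro z hz hzc
    obtain ⟨h1, h2⟩ := hψc z hz hzc
    obtain ⟨h3, h4⟩ := hφc (ψ z) h1 (h2 ▸ Set.mem_image_of_mem _ hz)
    exact c'.injOn h3 hz (h4.trans h2)
  have hdφ := (hφ y ⟨hy, hyc⟩).differentiableAt.hasFDerivAt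
  have hdψ := (hψ (φ y) hyT).differentiableAt.hasFDerivAt
  have e1 : ψ ∘ φ =ᶠ[𝓝 y] id := by
    filter_upwards [hS.mem_nhds ⟨hy, hyc⟩] with y' hy' using hψφ y' hy'.1 hy'.2
  have e2 : φ ∘ ψ =ᶠ[𝓝 (φ y)] id := by
    filter_upwards [hT.mem_nhds hyT] with z hz using hφψ z hz.1 hz.2
  have e3 := (hdψ.comp y hdφ).unique ((hasFDerivAt_id y).congr_of_eventuallyEq e1)
  have hdφ' : HasFDerivAt φ (fderiv ℂ φ y) (ψ (φ y)) := by rwa [hψφ y hy hyc]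
  have e4 := (hdφ'.comp (φ y) hdψ).unique ((hasFDerivAt_id (φ y)).congr_of_eventuallyEq e2)
  refine ⟨hφ y ⟨hy, hyc⟩, ?_, hφy, hcφ⟩
  refine Function.bijective_iff_has_inverse.2 ⟨fderiv ℂ ψ (φ y), fun v => ?_, fun v => ?_⟩
  · exact congrArg (fun T => T v) e3
  · exact congrArg (fun T => T v) e4

variable {V : Type*} [NormedAddCommGroup V] [NormedSpace ℂ V] [FiniteDimensional ℂ V]
  [CompleteSpace V]
variable {n : ℕ} {B : LinearMap.BilinForm ℂ V} {F U : ℤ → Submodule ℂ V}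

theorem mapFlag_one : mapFlag (1 : V →L[ℂ] V) F = F := by
  funext p
  exact Submodule.map_id (F p)

theorem analyticAt_and_bijective_fderiv_comp {E M M' : Type*} [NormedAddCommGroup E]
    [NormedSpace ℂ E] [NormedAddCommGroup M] [NormedSpace ℂ M] [NormedAddCommGroup M']
    [NormedSpace ℂ M'] [FiniteDimensional ℂ M] (T : M ≃ₗ[ℂ] M') {φ : E → M} {y : E}
    (hφ : AnalyticAt ℂ φ y) (hb : Function.Bijective (fderiv ℂ φ y)) :
    AnalyticAt ℂ (fun z => T (φ z)) y ∧ Function.Bijective (fderiv ℂ (fun z => T (φ z)) y) := by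
  have hT : ∀ x, HasFDerivAt (fun z => T z) (LinearMap.toContinuousLinearMap T.toLinearMap) x :=
    fun x => (LinearMap.toContinuousLinearMap T.toLinearMap).hasFDerivAt
  refine ⟨((LinearMap.toContinuousLinearMap T.toLinearMap).analyticAt (φ y)).comp hφ, ?_⟩
  have h1 : HasFDerivAt (fun z => T (φ z)) _ y :=
    (hT (φ y)).comp y hφ.differentiableAt.hasFDerivAt
  rw [h1.fderiv]
  exact T.bijective.comp hb

/-- Existence of charts at `F`, and the derived flag in an arbitrary chart at `F`. -/
theorem charts_at (h : IsIsotropicPair n B F U) (hn : 2 ≤ n) (hz : HasNonzeroPieces n F U)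
    {D : Set (ℤ → Submodule ℂ V)}
    (hanti : ∀ F' ∈ D, Antitone F') (htop : ∀ F' ∈ D, ∀ p, p ≤ 0 → F' p = ⊤)
    (hbot : ∀ F' ∈ D, ∀ p : ℤ, n < p → F' p = ⊥)
    (hiso : ∀ F' ∈ D, ∀ p, ∀ u ∈ F' p, ∀ v ∈ F' (n - p + 1), B u v = 0)
    (hnear : ∀ᶠ A in 𝓝 (0 : V →L[ℂ] V), A ∈ lowerSkew B U → mapFlag (cayley A) F ∈ D) :
    (∃ (d : ℕ) (c : HolomorphicChart D d), F ∈ c.toFun '' c.source) ∧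
    ∀ (d : ℕ) (c : HolomorphicChart D d), ∀ x ∈ c.source, c.toFun x = F →
      (∀ m, IsHolomorphicSubbundleAt (derivedFlag (periodSystem c.toFun 1) m) x) ∧
      (∀ m : ℕ, n ≤ 2 ^ m → derivedFlag (periodSystem c.toFun 1) m x = ⊥) ∧
      (⨆ m, bracketFlag (fun y => ⨅ α ∈ periodSystem c.toFun 1 y,
        LinearMap.ker α.toLinearMap) m x = ⊤) ∧
      ((Odd n ∨ n ≤ 4) → ∀ m, derivedFlag (periodSystem c.toFun 1) m x ≤
        periodSystem c.toFun (2 ^ m) x) ∧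
      (HasLargePieces n F U →
        ∀ m, derivedFlag (periodSystem c.toFun 1) m x = periodSystem c.toFun (2 ^ m) x) := by
  obtain ⟨e, c', L, h0, hc', hunit⟩ := exists_cayleyChart h hanti htop hbot hiso hnear
  have hFc : F ∈ c'.toFun '' c'.source := by
    refine ⟨0, h0, ?_⟩
    rw [hc', map_zero, ZeroMemClass.coe_zero, cayley_zero, mapFlag_one]
  refine ⟨⟨e, c', hFc⟩, fun d c x hx hxF => ?_⟩
  -- The given chart is compared with the Cayley chart at the same point; the composite of `L` with
  -- the transition then carries the coframe.
  obtain ⟨S, φ, hS, hxS, hφ⟩ := c.exists_transition c' hx (by rwa [hxF])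
  have hL := fun y (hy : y ∈ S) =>
    analyticAt_and_bijective_fderiv_comp L.toLinearEquiv (hφ y hy).1 (hφ y hy).2.1
  obtain ⟨θ, hθ, hθh⟩ := exists_maurerCartan (B := B) (f := c.toFun) (L := fun z => L (φ z))
    h.monotone h.antitone hS (fun y hy => (hL y hy).1) (fun y hy => (hL y hy).2)
    (fun y hy => hunit _ (hφ y hy).2.2.1)
    (fun y hy => by rw [← (hφ y hy).2.2.2, hc'])
  exact derivedFlag_properties h hn hz hθ hθh hxS

/-- A positivity condition on `F₁ ∩ σ⁻¹ F₂` persists if `F₁`, `F₂` are moved a little. -/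
theorem eventually_pos_of_pos {σ : V → V} (hσ : Continuous σ)
    (hσr : ∀ (r : ℝ) u, σ ((r : ℂ) • u) = (r : ℂ) • σ u) {q : V → ℝ} (hq : Continuous q)
    (hqr : ∀ (r : ℝ) u, q ((r : ℂ) • u) = r ^ 2 * q u) (F₁ F₂ : Submodule ℂ V)
    (hpos : ∀ u ∈ F₁, σ u ∈ F₂ → u ≠ 0 → 0 < q u) :
    ∀ᶠ A in 𝓝 (0 : V →L[ℂ] V), ∀ u ∈ F₁.map (cayley A).toLinearMap,
      σ u ∈ F₂.map (cayley A).toLinearMap → u ≠ 0 → 0 < q u := by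
  have hfst : ∀ u : V, AnalyticAt ℂ (fun z : (V →L[ℂ] V) × V => cayley z.1) (0, u) := fun u =>
    analyticAt_cayley analyticAt_fst (by simp)
  have hunit : ∀ u : V, IsUnit (cayley (0, u).1 : V →L[ℂ] V) := fun u => by
    simp [cayley_zero]
  have hmove : ∀ (K : Submodule ℂ V) (τ : V → V) (u : V), Continuous τ → τ u ∉ K →
      ∀ᶠ z in 𝓝 ((0 : V →L[ℂ] V), u), τ z.2 ∉ K.map (cayley z.1).toLinearMap := by
    intro K τ u hτ hu
    have h1 : ContinuousAt (fun z : (V →L[ℂ] V) × V => Ring.inverse (cayley z.1) (τ z.2))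
        ((0 : V →L[ℂ] V), u) :=
      (analyticAt_inverse_comp (hfst u) (hunit u)).continuousAt.clm_apply
        (hτ.comp continuous_snd).continuousAt
    have h2 : ((K : Set V)ᶜ) ∈ 𝓝 (Ring.inverse (cayley (0 : V →L[ℂ] V)) (τ u)) := by
      refine K.closed_of_finiteDimensional.isOpen_compl.mem_nhds ?_
      rw [cayley_zero, Ring.inverse_one]
      exact hu
    filter_upwards [h1.eventually h2, eventually_isUnit (hfst u).continuousAt (hunit u)]
      with z hz hz' hmem
    obtain ⟨w, hw, hwz⟩ := hmem
    refine hz ?_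
    change Ring.inverse (cayley z.1) (τ z.2) ∈ K
    rw [← hwz]
    change Ring.inverse (cayley z.1) (cayley z.1 w) ∈ K
    rwa [inverse_apply_apply hz']
  -- Near each unit vector either one of the two memberships fails, which is an open condition in
  -- the pair, or `q` stays positive. Compactness makes the neighbourhood of `A = 0` uniform, and
  -- homogeneity extends the result from the sphere.
  have hcomp := (isCompact_sphere (0 : V) 1).eventually_forall_of_forall_eventually
    (x₀ := (0 : V →L[ℂ] V)) (P := fun A u => u ∈ F₁.map (cayley A).toLinearMap →
      σ u ∈ F₂.map (cayley A).toLinearMap → 0 < q u) (by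
    intro u hu
    have hu0 : u ≠ 0 := by
      rintro rfl
      simp at hu
    by_cases h1 : u ∈ F₁
    · by_cases h2 : σ u ∈ F₂
      · have h3 := (hq.comp (continuous_snd (X := V →L[ℂ] V))).continuousAt.eventually
          (lt_mem_nhds (hpos u h1 h2 hu0) : ∀ᶠ t in 𝓝 (q ((0 : V →L[ℂ] V), u).2), 0 < t)
        filter_upwards [h3] with z hz _ _ using hz
      · filter_upwards [hmove F₂ σ u hσ h2] with z hz _ hz' using absurd hz' hz
    · filter_upwards [hmove F₁ id u continuous_id h1] with z hz hz' using absurd hz' hz)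
  filter_upwards [hcomp] with A hA u hu hσu hu0
  have hnorm : 0 < ‖u‖ := norm_pos_iff.2 hu0
  have h1 := hA (((‖u‖⁻¹ : ℝ) : ℂ) • u) (by
    rw [mem_sphere_zero_iff_norm, norm_smul, Complex.norm_real, norm_inv, norm_norm,
      inv_mul_cancel₀ hnorm.ne']) (Submodule.smul_mem _ _ hu)
    (by
      rw [hσr]
      exact Submodule.smul_mem _ _ hσu)
  rw [hqr] at h1
  exact (pos_iff_pos_of_mul_pos h1).1 (by positivity)

end Chart
end
end PeriodDomain

namespace PeriodDomain

noncomputable section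

/-! ### Conjugation and the complexified form -/

section Conj

variable {H : Type*} [AddCommGroup H] [Module ℚ H]

theorem conj_tmul (a : ℂ) (x : H) : conj (a ⊗ₜ[ℚ] x) = starRingEnd ℂ a ⊗ₜ[ℚ] x := rfl

theorem conj_conj (u : ℂ ⊗[ℚ] H) : conj (conj u) = u := by
  induction u using TensorProduct.induction_on with
  | zero => simp
  | tmul a x => simp [conj_tmul]
  | add x y hx hy => rw [map_add, map_add, hx, hy]

theorem mem_map_conj {K : Submodule ℂ (ℂ ⊗[ℚ] H)} {u : ℂ ⊗[ℚ] H} :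
    u ∈ K.map conj ↔ conj u ∈ K := by
  constructor
  · rintro ⟨v, hv, rfl⟩
    rwa [conj_conj]
  · exact fun hu => ⟨conj u, hu, conj_conj u⟩

theorem finrank_map_conj (K : Submodule ℂ (ℂ ⊗[ℚ] H)) :
    Module.finrank ℂ (K.map conj) = Module.finrank ℂ K := by
  let j : K ≃+ K.map conj :=
    { toFun := fun u => ⟨conj u, mem_map_conj.2 (by rw [conj_conj]; exact u.2)⟩
      invFun := fun u => ⟨conj u, mem_map_conj.1 u.2⟩
      left_inv := fun u => Subtype.ext (conj_conj _)
      right_inv := fun u => Subtype.ext (conj_conj _)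
      map_add' := fun u v => Subtype.ext (map_add conj _ _) }
  have := rank_eq_of_equiv_equiv (starRingEnd ℂ) j (star_involutive (R := ℂ)).bijective
    (fun r m => Subtype.ext (map_smulₛₗ conj r (m : ℂ ⊗[ℚ] H)))
  exact (congrArg Cardinal.toNat this).symm

variable (Q : LinearMap.BilinForm ℚ H)

theorem baseChange_conj (u v : ℂ ⊗[ℚ] H) :
    LinearMap.BilinForm.baseChange ℂ Q (conj u) (conj v) =
      starRingEnd ℂ (LinearMap.BilinForm.baseChange ℂ Q u v) := by
  induction u using TensorProduct.induction_on with
  | zero => simp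
  | tmul a x =>
    induction v using TensorProduct.induction_on with
    | zero => simp
    | tmul b y =>
      rw [conj_tmul, conj_tmul, LinearMap.BilinForm.baseChange_tmul,
        LinearMap.BilinForm.baseChange_tmul]
      simp [Algebra.smul_def]
    | add v w hv hw => rw [map_add, map_add, map_add, hv, hw, map_add]
  | add u w hu hw =>
    rw [map_add, map_add, LinearMap.add_apply, hu, hw, map_add, LinearMap.add_apply, map_add]

theorem baseChange_symm {n : ℕ} (hQs : ∀ u v, Q u v = (-1) ^ n * Q v u) (u v : ℂ ⊗[ℚ] H) :
    LinearMap.BilinForm.baseChange ℂ Q u v =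
      (-1) ^ n * LinearMap.BilinForm.baseChange ℂ Q v u := by
  induction u using TensorProduct.induction_on with
  | zero => simp
  | tmul a x =>
    induction v using TensorProduct.induction_on with
    | zero => simp
    | tmul b y =>
      rw [LinearMap.BilinForm.baseChange_tmul, LinearMap.BilinForm.baseChange_tmul, hQs x y,
        Algebra.smul_def, Algebra.smul_def]
      simp
      ring
    | add v w hv hw => rw [map_add, hv, hw, map_add, LinearMap.add_apply, mul_add]
  | add u w hu hw => rw [map_add, LinearMap.add_apply, hu, hw, map_add, mul_add]

/-- Pairing with `1 ⊗ x`, for `x` in the rational dual basis, reads off the coordinates of `u`. -/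
theorem baseChange_eq_zero [Module.Finite ℚ H] (hQ : Q.Nondegenerate) (u : ℂ ⊗[ℚ] H)
    (hu : ∀ v, LinearMap.BilinForm.baseChange ℂ Q u v = 0) : u = 0 := by
  let b := Module.finBasis ℚ H
  let bc := b.baseChange ℂ
  have h1 : ∀ x : H, ∑ i, bc.repr u i * ((Q (b i) x : ℚ) : ℂ) = 0 := by
    intro x
    have h2 := hu (1 ⊗ₜ x)
    rw [← bc.sum_repr u, map_sum, LinearMap.sum_apply] at h2
    rw [← h2]
    refine Finset.sum_congr rfl fun i _ => ?_
    rw [map_smul, LinearMap.smul_apply, Module.Basis.baseChange_apply,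
      LinearMap.BilinForm.baseChange_tmul, Algebra.smul_def]
    simp
  have hdual : ∀ i, ∃ x : H, ∀ j, Q (b j) x = if j = i then 1 else 0 := by
    intro i
    refine ⟨LinearMap.BilinForm.dualBasis Q.flip hQ.flip b i, fun j => ?_⟩
    exact LinearMap.BilinForm.apply_dualBasis_left hQ.flip b i j
  refine bc.ext_elem fun i => ?_
  obtain ⟨x, hx⟩ := hdual i
  simpa [hx, apply_ite] using h1 x

end Conj

/-! ### Stability of the Hodge–Riemann conditions -/

section Domain

variable {H : Type*} [AddCommGroup H] [Module ℚ H] {n : ℕ} {Q : LinearMap.BilinForm ℚ H}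
  {F F' : ℤ → Submodule ℂ (ℂ ⊗[ℚ] H)}

theorem mem_hodgePiece {p q : ℤ} {u : ℂ ⊗[ℚ] H} :
    u ∈ hodgePiece F p q ↔ u ∈ F p ∧ conj u ∈ F q :=
  and_congr_right fun _ => mem_map_conj

/-- `F p` and `conj (F q)` span everything, because `conj (F (q + 1))` is already a complement of `F
p`. Hence the Hodge numbers depend only on the dimensions of the filtration. -/
theorem IsHodgeFiltration.finrank_add_finrank_hodgePiece [Module.Finite ℚ H]
    (hF : IsHodgeFiltration n F) {p q : ℤ} (hpq : p + q = n) :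
    Module.finrank ℂ (ℂ ⊗[ℚ] H) + Module.finrank ℂ (hodgePiece F p q) =
      Module.finrank ℂ (F p) + Module.finrank ℂ (F q) := by
  have h1 : F p ⊔ (F q).map conj = ⊤ := by
    rw [eq_top_iff, ← (hF.isCompl p).sup_eq_top]
    exact sup_le_sup_left (Submodule.map_mono (hF.antitone (by omega))) _
  rw [← finrank_map_conj (F q), ← Submodule.finrank_sup_add_finrank_inf_eq, h1, finrank_top]
  rfl

theorem IsPolarizedBy.re_pos (hF : IsPolarizedBy n Q F) {p : ℤ} (hp : p ∈ Finset.Icc (0 : ℤ) n)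
    {u : ℂ ⊗[ℚ] H} (hu : u ∈ F p) (hu' : conj u ∈ F (n - p)) (h0 : u ≠ 0) :
    0 < (Complex.I ^ (p - (n - p)) *
      LinearMap.BilinForm.baseChange ℂ Q u (conj u)).re := by
  have hs : ∀ q : ℤ, q ≠ p → (Pi.single p u : ℤ → ℂ ⊗[ℚ] H) q = 0 := fun q hq => by simp [hq]
  have h1 : ∑ q ∈ Finset.Icc (0 : ℤ) n, (Pi.single p u : ℤ → ℂ ⊗[ℚ] H) q = u := by
    rw [Finset.sum_eq_single p (fun q _ hq => hs q hq) (fun h => absurd hp h),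
      Pi.single_eq_same]
  have h2 : ∑ q ∈ Finset.Icc (0 : ℤ) n,
      Complex.I ^ (q - (n - q)) • (Pi.single p u : ℤ → ℂ ⊗[ℚ] H) q =
      Complex.I ^ (p - (n - p)) • u := by
    rw [Finset.sum_eq_single p (fun q _ hq => by rw [hs q hq, smul_zero])
      (fun h => absurd hp h), Pi.single_eq_same]
  obtain ⟨r, hr, h3⟩ := hF.positive (Pi.single p u) (fun q => by
    by_cases hq : q = p
    · subst hq
      rw [Pi.single_eq_same]
      exact mem_hodgePiece.2 ⟨hu, hu'⟩
    · rw [hs q hq]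
      exact zero_mem _) (by rwa [h1])
  rw [h1, h2, map_smul, LinearMap.smul_apply, smul_eq_mul] at h3
  rwa [h3, Complex.ofReal_re]

/-- Conjugation changes `i^{p-q}` by `(-1)^n`, and the symmetry of `Q` gives the same sign back. -/
theorem im_weil_eq_zero (hQs : ∀ u v, Q u v = (-1) ^ n * Q v u) (p : ℤ) (u : ℂ ⊗[ℚ] H) :
    (Complex.I ^ (p - (n - p)) * LinearMap.BilinForm.baseChange ℂ Q u (conj u)).im = 0 := by
  rw [← Complex.conj_eq_iff_im, map_mul, ← baseChange_conj, conj_conj,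
    baseChange_symm Q hQs (conj u) u, map_zpow₀, Complex.conj_I, ← mul_assoc]
  congr 1
  have h1 : ((-1 : ℂ)) ^ (p - (n - p)) = (-1) ^ n := by
    have : p - (n - p) = 2 * p - n := by ring
    rw [this, zpow_sub₀ (by norm_num), zpow_mul]
    rcases neg_one_pow_eq_or ℂ n with h | h <;> simp [h]
  rw [← neg_one_mul Complex.I, mul_zpow, h1, mul_right_comm, ← mul_pow]
  norm_num

theorem baseChange_conj_eq_zero (hQs : ∀ u v, Q u v = (-1) ^ n * Q v u) (hanti : Antitone F)
    (hiso : ∀ p, ∀ u ∈ F p, ∀ v ∈ F (n - p + 1), LinearMap.BilinForm.baseChange ℂ Q u v = 0)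
    {p q : ℤ} (hpq : p ≠ q) {u v : ℂ ⊗[ℚ] H} (hu : u ∈ hodgePiece F p (n - p))
    (hv : v ∈ hodgePiece F q (n - q)) :
    LinearMap.BilinForm.baseChange ℂ Q u (conj v) = 0 := by
  rw [mem_hodgePiece] at hu hv
  rcases lt_or_gt_of_ne hpq with h | h
  · have h1 := hiso q v hv.1 (conj u) (hanti (by omega) hu.2)
    rw [← conj_conj u, baseChange_conj, baseChange_symm Q hQs, h1, mul_zero, map_zero]
  · exact hiso p u hu.1 (conj v) (hanti (by omega) hv.2)

/-- Membership is separated into equalities, which isometries preserve, and open conditions in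
finitely many degrees. Disjointness with the right dimensions gives complements, and orthogonality
of the Hodge pieces reduces positivity to one piece at a time. -/
theorem mem_periodDomain_of_finrank_eq [Module.Finite ℚ H] {h : ℕ → ℕ → ℕ}
    (hQs : ∀ u v, Q u v = (-1) ^ n * Q v u) (hF : F ∈ periodDomain Q n h)
    (hanti : Antitone F') (htop : ∀ p, p ≤ 0 → F' p = ⊤) (hbot : ∀ p : ℤ, n < p → F' p = ⊥)
    (hiso : ∀ p, ∀ u ∈ F' p, ∀ v ∈ F' (n - p + 1), LinearMap.BilinForm.baseChange ℂ Q u v = 0)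
    (hdim : ∀ p, Module.finrank ℂ (F' p) = Module.finrank ℂ (F p))
    (hdisj : ∀ p ∈ Finset.Icc (0 : ℤ) n, ∀ u ∈ F' p, conj u ∈ F' (n - p + 1) → u = 0)
    (hpos : ∀ p ∈ Finset.Icc (0 : ℤ) n, ∀ u ∈ F' p, conj u ∈ F' (n - p) → u ≠ 0 →
      0 < (Complex.I ^ (p - (n - p)) * LinearMap.BilinForm.baseChange ℂ Q u (conj u)).re) :
    F' ∈ periodDomain Q n h := by
  obtain ⟨hF, -, hFh⟩ := hF
  have hdisj' : ∀ p, ∀ u ∈ F' p, conj u ∈ F' (n - p + 1) → u = 0 := by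
    intro p u hu hu'
    by_cases h0 : p < 0
    · rw [hbot _ (by omega), Submodule.mem_bot] at hu'
      rw [← conj_conj u, hu', map_zero]
    by_cases h1 : n < p
    · rwa [hbot p h1, Submodule.mem_bot] at hu
    exact hdisj p (by rw [Finset.mem_Icc]; omega) u hu hu'
  have hF' : IsHodgeFiltration n F' := by
    refine ⟨hanti, htop, hbot, fun p => ?_⟩
    refine (Submodule.isCompl_iff_disjoint _ _ ?_).2 (Submodule.disjoint_def.2 fun u hu hu' =>
      hdisj' p u hu (mem_map_conj.1 hu'))
    rw [finrank_map_conj, hdim, hdim, ← finrank_map_conj (F (n - p + 1)),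
      Submodule.finrank_add_eq_of_isCompl (hF.isCompl p)]
  refine ⟨hF', ⟨hiso, fun u hu hu0 => ?_⟩, fun p q hpq => ?_⟩
  · have hsum : LinearMap.BilinForm.baseChange ℂ Q
        (∑ p ∈ Finset.Icc (0 : ℤ) n, Complex.I ^ (p - (n - p)) • u p)
        (conj (∑ p ∈ Finset.Icc (0 : ℤ) n, u p)) =
        ∑ p ∈ Finset.Icc (0 : ℤ) n, Complex.I ^ (p - (n - p)) *
          LinearMap.BilinForm.baseChange ℂ Q (u p) (conj (u p)) := by
      rw [map_sum, LinearMap.sum_apply]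
      refine Finset.sum_congr rfl fun p hp => ?_
      rw [map_smul, LinearMap.smul_apply, smul_eq_mul, map_sum, map_sum,
        Finset.sum_eq_single p (fun q _ hq => baseChange_conj_eq_zero hQs hanti hiso hq.symm
          (hu p) (hu q)) (fun h => absurd hp h)]
    have hpos' : ∀ p ∈ Finset.Icc (0 : ℤ) n, u p ≠ 0 → 0 < (Complex.I ^ (p - (n - p)) *
        LinearMap.BilinForm.baseChange ℂ Q (u p) (conj (u p))).re := fun p hp h0 =>
      hpos p hp (u p) (mem_hodgePiece.1 (hu p)).1 (mem_hodgePiece.1 (hu p)).2 h0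
    refine ⟨∑ p ∈ Finset.Icc (0 : ℤ) n, (Complex.I ^ (p - (n - p)) *
      LinearMap.BilinForm.baseChange ℂ Q (u p) (conj (u p))).re, ?_, ?_⟩
    · obtain ⟨p, hp, hp0⟩ := Finset.exists_ne_zero_of_sum_ne_zero hu0
      refine Finset.sum_pos' (fun q hq => ?_) ⟨p, hp, hpos' p hp hp0⟩
      by_cases h0 : u q = 0
      · simp [h0]
      · exact (hpos' q hq h0).le
    · rw [hsum, Complex.ofReal_sum]
      refine Finset.sum_congr rfl fun p _ => Complex.ext ?_ ?_
      · rw [Complex.ofReal_re]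
      · rw [Complex.ofReal_im, im_weil_eq_zero hQs]
  · rw [← hFh p q hpq]
    have h1 := hF'.finrank_add_finrank_hodgePiece (p := p) (q := q) (by exact_mod_cast hpq)
    have h2 := hF.finrank_add_finrank_hodgePiece (p := p) (q := q) (by exact_mod_cast hpq)
    rw [hdim, hdim, ← h2] at h1
    exact Nat.add_left_cancel h1

end Domain

end
end PeriodDomain

namespace PeriodDomain

noncomputable section

/-! ### Continuity of conjugation and of the Hermitian expression -/

section Continuity

variable {V : Type*} [NormedAddCommGroup V] [NormedSpace ℂ V] [FiniteDimensional ℂ V]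

theorem continuous_of_conjLinear (σ : V →ₛₗ[starRingEnd ℂ] V) : Continuous σ := by
  let b := Module.finBasis ℂ V
  have h1 : ∀ u, σ u = ∑ i, starRingEnd ℂ (b.coord i u) • σ (b i) := fun u => by
    conv_lhs => rw [← b.sum_repr u, map_sum]
    exact Finset.sum_congr rfl fun i _ => map_smulₛₗ σ _ _
  rw [show (σ : V → V) = _ from funext h1]
  exact continuous_finsetSum _ fun i _ =>
    ((Complex.continuous_conj.comp (b.coord i).continuous_of_finiteDimensional).smul
      continuous_const)

theorem continuous_bilin_apply (B : LinearMap.BilinForm ℂ V) {σ : V → V} (hσ : Continuous σ) :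
    Continuous fun u => B u (σ u) := by
  let b := Module.finBasis ℂ V
  have h1 : ∀ u, B u (σ u) = ∑ i, b.coord i u * B (b i) (σ u) := fun u => by
    conv_lhs => rw [← b.sum_repr u, map_sum, LinearMap.sum_apply]
    refine Finset.sum_congr rfl fun i _ => ?_
    rw [map_smul, LinearMap.smul_apply, smul_eq_mul, b.sum_repr]
    rfl
  rw [funext h1]
  exact continuous_finsetSum _ fun i _ =>
    (b.coord i).continuous_of_finiteDimensional.mul
      ((B (b i)).continuous_of_finiteDimensional.comp hσ)

end Continuity

/-! ### Charts of the period domain and the theorem -/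

section Main

open Filter Topology

variable {H : Type*} [AddCommGroup H] [Module ℚ H] {n : ℕ} {Q : LinearMap.BilinForm ℚ H}
  {F : ℤ → Submodule ℂ (ℂ ⊗[ℚ] H)} {h : ℕ → ℕ → ℕ}

/-- The increasing filtration `conj F^{n-p+1}` opposed to `F`. -/
def opposedFlag (n : ℕ) (F : ℤ → Submodule ℂ (ℂ ⊗[ℚ] H)) (p : ℤ) : Submodule ℂ (ℂ ⊗[ℚ] H) :=
  (F (n - p + 1)).map conj

theorem finrank_hodgePiece (hF : F ∈ periodDomain Q n h) {q : ℤ} (h0 : 0 ≤ q) (hq : q ≤ n) :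
    ∃ r : ℕ, q.toNat + r = n ∧
      Module.finrank ℂ (hodgePiece F q (n - q)) = h q.toNat r := by
  refine ⟨(n - q).toNat, by omega, ?_⟩
  rw [← hF.2.2 q.toNat (n - q).toNat (by omega), Int.toNat_of_nonneg h0,
    Int.toNat_of_nonneg (by omega)]

theorem mem_opposedFlag {p : ℤ} {u : ℂ ⊗[ℚ] H} :
    u ∈ opposedFlag n F p ↔ conj u ∈ F (n - p + 1) := mem_map_conj

theorem hodgePiece_eq_inf (q : ℤ) : hodgePiece F q (n - q) = F q ⊓ opposedFlag n F (q + 1) := by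
  rw [opposedFlag, sub_add_eq_sub_sub, sub_add_cancel]
  rfl

theorem exists_mem_hodgePiece_ne_zero (hF : F ∈ periodDomain Q n h)
    (hh : ∀ p q, p + q = n → h p q ≠ 0) {q : ℤ} (h0 : 0 ≤ q) (hq : q ≤ n) :
    ∃ z ∈ hodgePiece F q (n - q), z ≠ 0 := by
  obtain ⟨r, hr, hd⟩ := finrank_hodgePiece hF h0 hq
  refine (Submodule.ne_bot_iff _).1 fun hb => hh _ _ hr ?_
  rw [← hd, hb, finrank_bot]

theorem exists_mem_hodgePiece_notMem_span [Module.Finite ℚ H] (hF : F ∈ periodDomain Q n h)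
    (hh : ∀ p q, p + q = n → 2 ≤ h p q) {q : ℤ} (h0 : 0 ≤ q) (hq : q ≤ n) (w : ℂ ⊗[ℚ] H) :
    ∃ z ∈ hodgePiece F q (n - q), z ∉ Submodule.span ℂ {w} := by
  obtain ⟨r, hr, hd⟩ := finrank_hodgePiece hF h0 hq
  refine SetLike.not_le_iff_exists.1 fun hle => ?_
  have h1 := (Submodule.finrank_mono hle).trans (finrank_span_le_card {w})
  have h2 := hh _ _ hr
  rw [hd] at h1
  simp at h1
  omega

theorem charts_at_periodDomain [Module.Finite ℚ H] (hn : 2 ≤ n) (hQ : Q.Nondegenerate)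
    (hQs : ∀ u v, Q u v = (-1) ^ n * Q v u) (hh : ∀ p q, p + q = n → h p q ≠ 0)
    (hF : F ∈ periodDomain Q n h) :
    (∃ (d : ℕ) (c : HolomorphicChart (periodDomain Q n h) d), F ∈ c.toFun '' c.source) ∧
    ∀ (d : ℕ) (c : HolomorphicChart (periodDomain Q n h) d), ∀ x ∈ c.source, c.toFun x = F →
      (∀ m, IsHolomorphicSubbundleAt (derivedFlag (periodSystem c.toFun 1) m) x) ∧
      (∀ m : ℕ, n ≤ 2 ^ m → derivedFlag (periodSystem c.toFun 1) m x = ⊥) ∧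
      (⨆ m, bracketFlag (fun y => ⨅ α ∈ periodSystem c.toFun 1 y,
        LinearMap.ker α.toLinearMap) m x = ⊤) ∧
      ((Odd n ∨ n ≤ 4) → ∀ m, derivedFlag (periodSystem c.toFun 1) m x ≤
        periodSystem c.toFun (2 ^ m) x) ∧
      ((∀ p q, p + q = n → 2 ≤ h p q) →
        ∀ m, derivedFlag (periodSystem c.toFun 1) m x = periodSystem c.toFun (2 ^ m) x) := by
  let e : (ℂ ⊗[ℚ] H) ≃ₗ[ℂ] (Fin (Module.finrank ℂ (ℂ ⊗[ℚ] H)) → ℂ) :=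
    (Module.finBasis ℂ (ℂ ⊗[ℚ] H)).equivFun
  -- An auxiliary norm from coordinates; the statement itself does not involve it.
  let _ : NormedAddCommGroup (ℂ ⊗[ℚ] H) := NormedAddCommGroup.induced _ _ e e.injective
  let _ : NormedSpace ℂ (ℂ ⊗[ℚ] H) := NormedSpace.induced ℂ _ _ e
  have : FiniteDimensional ℂ (ℂ ⊗[ℚ] H) := inferInstance
  have : CompleteSpace (ℂ ⊗[ℚ] H) := FiniteDimensional.complete ℂ _
  set B : LinearMap.BilinForm ℂ (ℂ ⊗[ℚ] H) := LinearMap.BilinForm.baseChange ℂ Q with hB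
  have hpair : IsIsotropicPair n B F (opposedFlag n F) :=
    { nondeg := baseChange_eq_zero Q hQ
      symm := baseChange_symm Q hQs
      antitone := hF.1.antitone
      monotone := fun p q hpq => Submodule.map_mono (hF.1.antitone (by omega))
      isCompl := hF.1.isCompl
      eq_top := hF.1.eq_top
      eq_bot := hF.1.eq_bot
      isotropic_F := hF.2.1.isotropic
      isotropic_U := fun p u hu v hv => by
        rw [mem_opposedFlag] at hu hv
        have h1 := hF.2.1.isotropic _ _ hu _ (show conj v ∈ F (n - (n - p + 1) + 1) from hv)
        rw [← conj_conj u, ← conj_conj v, baseChange_conj, h1, map_zero] }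
  have hz : HasNonzeroPieces n F (opposedFlag n F) := fun q h0 hq => by
    obtain ⟨z, hz, hz0⟩ := exists_mem_hodgePiece_ne_zero hF hh h0 hq
    rw [hodgePiece_eq_inf] at hz
    exact ⟨z, hz.1, hz.2, hz0⟩
  have hconj : Continuous (conj : (ℂ ⊗[ℚ] H) →ₛₗ[starRingEnd ℂ] (ℂ ⊗[ℚ] H)) :=
    continuous_of_conjLinear (V := ℂ ⊗[ℚ] H) conj
  have hconjr : ∀ (r : ℝ) (u : ℂ ⊗[ℚ] H), conj ((r : ℂ) • u) = (r : ℂ) • conj u := fun r u => by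
    rw [map_smulₛₗ, Complex.conj_ofReal]
  -- Disjointness is obtained as positivity of a function that is never positive: the claim holds
  -- only if no nonzero `u` satisfies the two memberships.
  have hdisj : ∀ᶠ A in 𝓝 (0 : (ℂ ⊗[ℚ] H) →L[ℂ] (ℂ ⊗[ℚ] H)), ∀ p ∈ Finset.Icc (0 : ℤ) n,
      ∀ u ∈ (F p).map (cayley A).toLinearMap,
        conj u ∈ (F (n - p + 1)).map (cayley A).toLinearMap → u ≠ 0 → 0 < -‖u‖ ^ 2 :=
    (Filter.eventually_all_finset _).2 fun p _ =>
      eventually_pos_of_pos hconj hconjr (q := fun u => -‖u‖ ^ 2) (by fun_prop)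
        (fun r u => by
          rw [norm_smul, Complex.norm_real, mul_pow, Real.norm_eq_abs, sq_abs]
          ring) _ _
        fun u hu hu' h0 => absurd (Submodule.disjoint_def.1 (hF.1.isCompl p).disjoint u hu
          (mem_map_conj.2 hu')) h0
  have hpos : ∀ᶠ A in 𝓝 (0 : (ℂ ⊗[ℚ] H) →L[ℂ] (ℂ ⊗[ℚ] H)), ∀ p ∈ Finset.Icc (0 : ℤ) n,
      ∀ u ∈ (F p).map (cayley A).toLinearMap,
        conj u ∈ (F (n - p)).map (cayley A).toLinearMap → u ≠ 0 →
        0 < (Complex.I ^ (p - (n - p)) * B u (conj u)).re :=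
    (Filter.eventually_all_finset _).2 fun p hp =>
      eventually_pos_of_pos hconj hconjr
        (q := fun u => (Complex.I ^ (p - (n - p)) * B u (conj u)).re)
        (Complex.continuous_re.comp (continuous_const.mul (continuous_bilin_apply B hconj)))
        (fun r u => by
          rw [hconjr, map_smul, map_smul, LinearMap.smul_apply, smul_eq_mul, smul_eq_mul,
            ← Complex.re_ofReal_mul, Complex.ofReal_pow]
          ring_nf) _ _
        fun u hu hu' h0 => hF.2.1.re_pos hp hu hu' h0
  have hunit1 : ∀ᶠ A in 𝓝 (0 : (ℂ ⊗[ℚ] H) →L[ℂ] (ℂ ⊗[ℚ] H)), IsUnit (1 - A) :=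
    eventually_isUnit (X := fun A => 1 - A) (by fun_prop) (by simp)
  have hnear : ∀ᶠ A in 𝓝 (0 : (ℂ ⊗[ℚ] H) →L[ℂ] (ℂ ⊗[ℚ] H)),
      A ∈ lowerSkew B (opposedFlag n F) → mapFlag (cayley A) F ∈ periodDomain Q n h := by
    filter_upwards [hdisj, hpos, hunit1] with A h1 h2 h3 hA
    have hg := isUnipotentIsometry_cayley hpair.monotone hA h3
    have hgu := hg.isUnit hpair.nondeg
    refine mem_periodDomain_of_finrank_eq hQs hF (fun p q hpq =>
      Submodule.map_mono (hF.1.antitone hpq)) (fun p hp => ?_) (fun p hp => ?_) ?_ (fun p => ?_)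
      (fun p hp u hu hu' => ?_) h2
    · rw [mapFlag, hF.1.eq_top p hp, Submodule.map_top, LinearMap.range_eq_top]
      exact fun v => ⟨_, apply_inverse_apply hgu v⟩
    · rw [mapFlag, hF.1.eq_bot p hp, Submodule.map_bot]
    · rintro p _ ⟨u, hu, rfl⟩ _ ⟨v, hv, rfl⟩
      exact (hg.isometry u v).trans (hF.2.1.isotropic p u hu v hv)
    · exact (Submodule.equivMapOfInjective (cayley A).toLinearMap (injective_of_isUnit hgu)
        (F p)).finrank_eq.symm
    · by_contra h0
      have := h1 p hp u hu hu' h0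
      nlinarith [sq_nonneg ‖u‖]
  obtain ⟨hc, h5⟩ := charts_at hpair hn hz (D := periodDomain Q n h)
    (fun F' hF' => hF'.1.antitone) (fun F' hF' => hF'.1.eq_top) (fun F' hF' => hF'.1.eq_bot)
    (fun F' hF' => hF'.2.1.isotropic) hnear
  refine ⟨hc, fun d c x hx hxF => ?_⟩
  obtain ⟨k1, k2, k3, k4, k5⟩ := h5 d c x hx hxF
  refine ⟨k1, k2, k3, k4, fun hl => k5 fun q h0 hq w => ?_⟩
  obtain ⟨z, hz, hzw⟩ := exists_mem_hodgePiece_notMem_span hF hl h0 hq w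
  rw [hodgePiece_eq_inf] at hz
  exact ⟨z, hz.1, hz.2, hzw⟩

theorem le_two_pow_of_log_le (hn : n ≠ 0) {m : ℕ} (h : Real.log n / Real.log 2 ≤ m) :
    n ≤ 2 ^ m := by
  rw [div_le_iff₀ (Real.log_pos one_lt_two), ← Real.log_pow, Real.log_le_log_iff
    (by positivity) (by positivity)] at h
  exact_mod_cast h

end Main
end
end PeriodDomain

open PeriodDomain in
theorem theorem3 {H : Type*} [AddCommGroup H] [Module ℚ H] [Module.Finite ℚ H]
    (Q : LinearMap.BilinForm ℚ H) (n : ℕ) (hn : 2 ≤ n) (hQ : Q.Nondegenerate)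
    (hQs : ∀ u v, Q u v = (-1) ^ n * Q v u)
    (h : ℕ → ℕ → ℕ) (hh : ∀ p q, p + q = n → h p q ≠ 0) :
    (∀ F ∈ periodDomain Q n h, ∃ (d : ℕ) (c : HolomorphicChart (periodDomain Q n h) d),
      F ∈ c.toFun '' c.source) ∧
    ∀ (d : ℕ) (c : HolomorphicChart (periodDomain Q n h) d),
      (∀ m : ℕ, ∀ x ∈ c.source,
        IsHolomorphicSubbundleAt (derivedFlag (periodSystem c.toFun 1) m) x) ∧
      (∀ m : ℕ, Real.log n / Real.log 2 ≤ m → ∀ x ∈ c.source,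
        derivedFlag (periodSystem c.toFun 1) m x = ⊥) ∧
      IsBracketGenerating (periodSystem c.toFun 1) c.source ∧
      ((Odd n ∨ n ≤ 4) → ∀ m : ℕ, ∀ x ∈ c.source,
        derivedFlag (periodSystem c.toFun 1) m x ≤ periodSystem c.toFun (2 ^ m) x) ∧
      ((∀ p q, p + q = n → 2 ≤ h p q) → ∀ m : ℕ, ∀ x ∈ c.source,
        derivedFlag (periodSystem c.toFun 1) m x = periodSystem c.toFun (2 ^ m) x) := by
  refine ⟨fun F hF => (charts_at_periodDomain hn hQ hQs hh hF).1, fun d c => ?_⟩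
  -- Every point of a chart is treated with its own filtration as base point.
  have key := fun x (hx : x ∈ c.source) => (charts_at_periodDomain hn hQ hQs hh
    ((c.holomorphic x hx).1)).2 d c x hx rfl
  exact ⟨fun m x hx => (key x hx).1 m,
    fun m hm x hx => (key x hx).2.1 m (le_two_pow_of_log_le (by omega) hm),
    fun x hx => (key x hx).2.2.1, fun hn4 m x hx => (key x hx).2.2.2.1 hn4 m,
    fun hl m x hx => (key x hx).2.2.2.2 hl m⟩
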